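/- A knot projection $P$ is (the image of) a generic immersion of a circle into the 2-sphere $S^2$, i.e. a smooth immersion whose only self-intersections are finitely many transverse double points; knot projections are considered up to smooth sphere isotopy. An edge of $P$ is an arc of $P$ between two consecutive passages through double points, and an $n$-gon of $P$ is a connected component of $S^2\setminus P$ whose boundary consists of $n$ edges (the two disks bounded by a simple closed curve, which has no double points, are $0$-gons). Give $P$ an arbitrary orientation. An $n$-gon is coherent if the orientation of $P$ orients its boundary, i.e. if, walking along its edges in the direction of $P$, the $n$-gon lies always to the left or always to the right; otherwise it is incoherent. Let $\operatorname{Coh}^{\mathrm{odd}}(P)=1$ if $P$ has at least one coherent $n$-gon with $n$ odd, and $\operatorname{Coh}^{\mathrm{odd}}(P)=0$ otherwise. A weak RII move replaces, inside a disk, two disjoint strands of $P$ that run parallel in the same direction by two strands crossing each other exactly twice, which creates an incoherent $2$-gon; or it is the inverse of such a replacement. A strong RIII move takes three strands that, inside a disk, cross each other pairwise exactly once and bound a coherent $3$-gon, and moves one of the three across the crossing of the other two. Theorem. If two knot projections $P$ and $P'$, with arbitrary orientations, are related by a finite sequence of sphere isotopies, weak RII moves and strong RIII moves, then $\operatorname{Coh}^{\mathrm{odd}}(P)=\operatorname{Coh}^{\mathrm{odd}}(P')$.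 -/

import Mathlib

open Filter Topology
open scoped ContDiff

/-- Euclidean three-space; the 2-sphere is its unit sphere. -/
abbrev E3 : Type := EuclideanSpace ℝ (Fin 3)

/-- The 2-sphere. -/
abbrev sphere2 : Set E3 := Metric.sphere (0 : E3) 1

/-- The cross product on Euclidean three-space. -/
noncomputable def cross (u v : E3) : E3 := WithLp.toLp 2 (crossProduct u.ofLp v.ofLp)

/-- The circle is `ℝ / 2πℤ`: two parameters describe the same point of the circle. -/
def SameParam (s t : ℝ) : Prop := ∃ n : ℤ, t = s + 2 * Real.pi * n

/-- A knot projection, given by a generic immersion of the circle `ℝ / 2πℤ` into the 2-sphere,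
i.e. by a smooth `2π`-periodic immersed curve on the unit sphere whose only self-intersections are
finitely many transverse double points. The direction of the parameter is an orientation of the
knot projection; parametrizations of the same projection are identified by `Reparam` below. -/
structure KnotProjection where
  curve : ℝ → E3
  smooth : ContDiff ℝ ∞ curve
  periodic : Function.Periodic curve (2 * Real.pi)
  mem_sphere : ∀ t, curve t ∈ sphere2
  immersion : ∀ t, deriv curve t ≠ 0
  transverse : ∀ s t, curve s = curve t → ¬ SameParam s t →
    LinearIndependent ℝ ![deriv curve s, deriv curve t]
  no_triple : ∀ s t u, curve s = curve t → curve t = curve u →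
    SameParam s t ∨ SameParam t u ∨ SameParam s u
  finite_double : {p : E3 | ∃ s t, curve s = p ∧ curve t = p ∧ ¬ SameParam s t}.Finite

namespace KnotProjection

/-- The image of the immersion, as a subset of the sphere. -/
def image (P : KnotProjection) : Set E3 := Set.range P.curve

/-- The parameters at which the curve runs through a double point. -/
def doubleParams (P : KnotProjection) : Set ℝ :=
  {t | ∃ s, P.curve s = P.curve t ∧ ¬ SameParam s t}

/-- An edge: the open arc of the curve between two consecutive passages through double points.
(The simple closed curve has no double points and no edges.) -/
def IsEdge (P : KnotProjection) (E : Set E3) : Prop :=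
  ∃ a b : ℝ, a < b ∧ a ∈ P.doubleParams ∧ b ∈ P.doubleParams ∧
    (∀ t ∈ Set.Ioo a b, t ∉ P.doubleParams) ∧ E = P.curve '' Set.Ioo a b

/-- A polygon of `P`: a connected component of the complement of `P` in the sphere. -/
def IsFace (P : KnotProjection) (F : Set E3) : Prop :=
  ∃ x ∈ sphere2 \ P.image, F = connectedComponentIn (sphere2 \ P.image) x

/-- The sides of a polygon: the edges of `P` on its boundary. -/
def sides (P : KnotProjection) (F : Set E3) : Set (Set E3) :=
  {E | P.IsEdge E ∧ E ⊆ closure F}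

/-- The point at signed spherical distance `ε` from `curve t`, on the great circle perpendicular
to the curve at `curve t`; it is on the left for small `ε > 0` and on the right for small
`ε < 0` (left and right as seen from outside the sphere). -/
noncomputable def normalPoint (P : KnotProjection) (t ε : ℝ) : E3 :=
  Real.cos ε • P.curve t +
    Real.sin ε • (‖deriv P.curve t‖⁻¹ • cross (P.curve t) (deriv P.curve t))

/-- `F` lies immediately to the left of the oriented curve at the parameter `t`. -/
def OnLeft (P : KnotProjection) (F : Set E3) (t : ℝ) : Prop :=
  ∀ᶠ ε in 𝓝[>] (0 : ℝ), P.normalPoint t ε ∈ F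

/-- `F` lies immediately to the right of the oriented curve at the parameter `t`. -/
def OnRight (P : KnotProjection) (F : Set E3) (t : ℝ) : Prop :=
  ∀ᶠ ε in 𝓝[>] (0 : ℝ), P.normalPoint t (-ε) ∈ F

/-- A polygon is coherent when the orientation of `P` orients its boundary: walking along any of
its sides in the direction of `P`, one has the polygon always on the left, or always on the
right. -/
def IsCoherent (P : KnotProjection) (F : Set E3) : Prop :=
  (∀ t, t ∉ P.doubleParams → P.curve t ∈ closure F → P.OnLeft F t) ∨
  (∀ t, t ∉ P.doubleParams → P.curve t ∈ closure F → P.OnRight F t)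

/-- The odd coherent number: the number of coherent polygons with an odd number of sides. -/
noncomputable def oddCoherentNumber (P : KnotProjection) : ℕ∞ :=
  {F : Set E3 | P.IsFace F ∧ P.IsCoherent F ∧ Odd (P.sides F).ncard}.encard

open Classical in
/-- `Coh^odd`. -/
noncomputable def cohOdd (P : KnotProjection) : ℕ :=
  if P.oddCoherentNumber = 0 then 0 else 1

/-- `P'` is a reparametrization of `P`, of either orientation: `r` is a lift to `ℝ` of a
diffeomorphism of the circle. -/
def Reparam (P P' : KnotProjection) : Prop :=
  ∃ r : ℝ → ℝ, ContDiff ℝ ∞ r ∧ (∀ t, deriv r t ≠ 0) ∧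
    ((∀ t, r (t + 2 * Real.pi) = r t + 2 * Real.pi) ∨
      (∀ t, r (t + 2 * Real.pi) = r t - 2 * Real.pi)) ∧
    ∀ t, P'.curve t = P.curve (r t)

/-- `P'` is obtained from `P` by a smooth ambient isotopy of the sphere. The isotopy `H` and its
inverse `K` are given by smooth maps on the ambient space that preserve the sphere. -/
def SphereIsotopic (P P' : KnotProjection) : Prop :=
  ∃ H K : ℝ → E3 → E3,
    ContDiff ℝ ∞ (fun p : ℝ × E3 => H p.1 p.2) ∧
    ContDiff ℝ ∞ (fun p : ℝ × E3 => K p.1 p.2) ∧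
    (∀ s ∈ Set.Icc (0 : ℝ) 1, ∀ x ∈ sphere2,
      H s x ∈ sphere2 ∧ K s x ∈ sphere2 ∧ K s (H s x) = x ∧ H s (K s x) = x) ∧
    (∀ x ∈ sphere2, H 0 x = x) ∧
    ∀ t, P'.curve t = H 1 (P.curve t)

/-- An orientation preserving smooth embedding of the plane into the sphere. -/
structure IsPlanarChart (ψ : ℝ × ℝ → E3) : Prop where
  smooth : ContDiff ℝ ∞ ψ
  injective : Function.Injective ψ
  mem_sphere : ∀ p, ψ p ∈ sphere2
  oriented : ∀ p,
    0 < inner ℝ (cross (ψ p) (fderiv ℝ ψ p (1, 0))) (fderiv ℝ ψ p (0, 1))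

/-- The closed square; its image under a planar chart is the disk in which a move takes place. -/
def square : Set (ℝ × ℝ) := Set.Icc (-1) 1 ×ˢ Set.Icc (-1) 1

/-- Inside the disk `ψ(square)` the oriented curve `P` consists exactly of `k` strands, the `i`-th
one being the graph of `f i` over `[-1,1]`, run through from left to right if `d i = 1` and from
right to left if `d i = -1`, during the time interval `[τ i - 1, τ i + 1]` modulo `2π`. -/
def HasPicture (P : KnotProjection) (ψ : ℝ × ℝ → E3) {k : ℕ} (τ : Fin k → ℝ)
    (d : Fin k → ℝ) (f : Fin k → ℝ → ℝ) : Prop :=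
  (∀ i, ∀ x ∈ Set.Icc (-1 : ℝ) 1, P.curve (τ i + d i * x) = ψ (x, f i x)) ∧
  (∀ t, P.curve t ∈ ψ '' square → ∃ i, ∃ n : ℤ, |t - τ i - 2 * Real.pi * n| ≤ 1)

/-- `P'` is obtained from `P` by replacing, inside some disk on the sphere, the picture `f` by the
picture `f'`, and leaving `P` unchanged elsewhere. -/
def LocalReplacement (P P' : KnotProjection) {k : ℕ} (d : Fin k → ℝ)
    (f f' : Fin k → ℝ → ℝ) : Prop :=
  ∃ (ψ : ℝ × ℝ → E3) (τ : Fin k → ℝ), IsPlanarChart ψ ∧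
    P.HasPicture ψ τ d f ∧ P'.HasPicture ψ τ d f' ∧
    ∀ t, (∀ i, ∀ n : ℤ, 1 ≤ |t - τ i - 2 * Real.pi * n|) → P'.curve t = P.curve t

/-- `P'` is obtained from `P` by a weak second Reidemeister move creating an incoherent 2-gon:
two disjoint strands that run in parallel, in the same direction, are replaced by two strands
crossing each other twice. -/
def WeakRII (P P' : KnotProjection) : Prop :=
  ∃ h k : ℝ → ℝ, ∃ p q : ℝ, -1 < p ∧ p < q ∧ q < 1 ∧
    (∀ x ∈ Set.Icc (-1 : ℝ) 1, 0 < h x ∧ h x < 1) ∧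
    (∀ x ∈ Set.Icc (-1 : ℝ) 1, |k x| < 1) ∧
    k p = 0 ∧ k q = 0 ∧
    (∀ x ∈ Set.Ioo p q, k x < 0) ∧
    (∀ x ∈ Set.Ico (-1) p, 0 < k x) ∧ (∀ x ∈ Set.Ioc q 1, 0 < k x) ∧
    LocalReplacement P P' ![1, 1] ![fun _ => 0, h] ![fun _ => 0, k]

/-- The graph of `g` crosses the line `y = x / 2` exactly once, at abscissa `p`, passing from above
to below it, and the line `y = -x / 2` exactly once, at abscissa `q`, passing from below to above
it. If `p < 0 < q` it runs below the origin, and if `q < 0 < p` above it. -/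
def CrossesAt (g : ℝ → ℝ) (p q : ℝ) : Prop :=
  p ∈ Set.Ioo (-1 : ℝ) 1 ∧ q ∈ Set.Ioo (-1 : ℝ) 1 ∧ (∀ x ∈ Set.Icc (-1 : ℝ) 1, |g x| < 1) ∧
  g p = p / 2 ∧ (∀ x ∈ Set.Ico (-1) p, x / 2 < g x) ∧ (∀ x ∈ Set.Ioc p 1, g x < x / 2) ∧
  g q = -q / 2 ∧ (∀ x ∈ Set.Ico (-1) q, g x < -x / 2) ∧ (∀ x ∈ Set.Ioc q 1, -x / 2 < g x)

/-- `P'` is obtained from `P` by a strong third Reidemeister move: of three strands that cross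
each other pairwise and bound a coherent 3-gon, one is moved across the crossing of the other two.
The strands on the lines `y = x / 2` and `y = -x / 2` run from right to left, and the third one
runs from left to right, first below and then above the crossing at the origin. -/
def StrongRIII (P P' : KnotProjection) : Prop :=
  ∃ g k : ℝ → ℝ, ∃ p q p' q' : ℝ,
    CrossesAt g p q ∧ p < 0 ∧ 0 < q ∧ CrossesAt k p' q' ∧ q' < 0 ∧ 0 < p' ∧
    LocalReplacement P P' ![-1, -1, 1]
      ![fun x => x / 2, fun x => -x / 2, g] ![fun x => x / 2, fun x => -x / 2, k]

/-- Equivalence of knot projections under weak RII and strong RIII: the equivalence relation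
generated by the two moves, up to sphere isotopy and the choice of a parametrization and an
orientation. -/
def WeakIIStrongIIIEquiv : KnotProjection → KnotProjection → Prop :=
  Relation.EqvGen fun P P' =>
    Reparam P P' ∨ SphereIsotopic P P' ∨ WeakRII P P' ∨ StrongRIII P P'

end KnotProjection

/-!
The move of type strong RIII is harmless for a simple reason: the disk contains a coherent triangle
before the move and another one after it, so the invariant equals `1` on both sides
(`exists_isOddCoherent_of_triangle`, `cohOdd_eq_of_strongRIII`). For changes of the parametrization
or of the orientation and for isotopies, all notions are transported; a diffeomorphism of the sphere
preserves or exchanges the left and the right side along the whole curve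
(`isOddCoherent_image`).

The weak RII move needs an argument. Two strands run in the same direction, so a polygon between
them lies to the left of one strand and to the right of the other one and is incoherent
(`BandPicture.disjoint_band_of_isCoherent`). This applies to the polygon between the strands before
the move, to its two remnants after the move and to the new 2-gon. The polygons that do not meet the
band between the strands correspond to each other before and after the move, by a homeomorphism of
the complement of the curve and the band that rescales vertical segments above and below the band
(`BandSwap.isFace_image`). Such a polygon remains coherent: it is to the left of the upper strand if
it lies above the band and to the right of the lower strand if it lies below, whichever strand is
the upper one (`BandSwap.isCoherent_image`). Finally, both crossings are corners of the polygon
above the band and of the polygon below it. Each of them gains two sides, or four if they are the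
same polygon, and the parity of the number of sides does not change
(`BandSwap.odd_ncard_sides_iff`). Sides are counted by their starting points on the circle
(`ncard_sides`).

The topological input is that near a simple point the complement of the curve has exactly two sides
(`exists_collar`), which belong to different polygons (`not_onLeft_and_onRight`). The latter is the
part of the Jordan curve theorem that survives for curves with double points; it follows from the
jump of the winding number across the curve (`tendsto_windingIntegral_sub`). It implies that a
polygon is coherent if and only if it never lies to the right of the curve, or never to the left
(`isCoherent_iff`).
-/

/-! ### Triple products -/

/-- The triple product `(u × v) · w`. -/
noncomputable def triple (u v w : E3) : ℝ := inner ℝ (cross u v) w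

lemma triple_apply (u v w : E3) : triple u v w =
    (u 1 * v 2 - u 2 * v 1) * w 0 + (u 2 * v 0 - u 0 * v 2) * w 1 +
      (u 0 * v 1 - u 1 * v 0) * w 2 := by
  simp only [triple, cross, cross_apply, PiLp.inner_apply, Fin.sum_univ_three, RCLike.inner_apply,
    conj_trivial, Matrix.cons_val]
  ring

lemma inner_apply_three (u v : E3) : inner ℝ u v = u 0 * v 0 + u 1 * v 1 + u 2 * v 2 := by
  simp only [PiLp.inner_apply, Fin.sum_univ_three, RCLike.inner_apply, conj_trivial]
  ring

lemma cross_zero_apply (u v : E3) : cross u v 0 = u 1 * v 2 - u 2 * v 1 := by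
  simp [cross, cross_apply]

lemma cross_one_apply (u v : E3) : cross u v 1 = u 2 * v 0 - u 0 * v 2 := by
  simp [cross, cross_apply]

lemma cross_two_apply (u v : E3) : cross u v 2 = u 0 * v 1 - u 1 * v 0 := by
  simp [cross, cross_apply]

lemma triple_add_right (u v w w' : E3) : triple u v (w + w') = triple u v w + triple u v w' := by
  simp [triple, inner_add_right]

lemma triple_smul_right (u v w : E3) (c : ℝ) : triple u v (c • w) = c * triple u v w := by
  simp [triple, inner_smul_right]

lemma triple_add_middle (u v v' w : E3) : triple u (v + v') w = triple u v w + triple u v' w := by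
  simp only [triple_apply, PiLp.add_apply]; ring

lemma triple_smul_middle (u v w : E3) (c : ℝ) : triple u (c • v) w = c * triple u v w := by
  simp only [triple_apply, PiLp.smul_apply, smul_eq_mul]; ring

lemma triple_self_right (u v : E3) : triple u v v = 0 := by
  simp only [triple_apply]; ring

lemma triple_self_outer (u v : E3) : triple u v u = 0 := by
  simp only [triple_apply]; ring

lemma inner_cross_self_left (u v : E3) : inner ℝ u (cross u v) = 0 := by
  rw [real_inner_comm]; exact triple_self_outer u v

lemma cross_smul_right (u v : E3) (c : ℝ) : cross u (c • v) = c • cross u v := by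
  ext i; fin_cases i <;>
    simp [cross_zero_apply, cross_one_apply, cross_two_apply] <;> ring

/-- Lagrange's identity for a tangent vector `v` at a point `u` of the unit sphere. -/
lemma triple_cross_eq (u v : E3) (hu : ‖u‖ = 1) (huv : inner ℝ u v = 0) :
    triple u v (cross u v) = ‖v‖ ^ 2 := by
  have h1 : inner ℝ u u = (1 : ℝ) := by rw [real_inner_self_eq_norm_sq, hu]; norm_num
  rw [← real_inner_self_eq_norm_sq]
  rw [inner_apply_three] at *
  simp only [triple_apply, cross_zero_apply, cross_one_apply, cross_two_apply]
  linear_combination (v 0 * v 0 + v 1 * v 1 + v 2 * v 2) * h1 -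
    (u 0 * v 0 + u 1 * v 1 + u 2 * v 2) * huv

/-- Two tangent vectors at a point of the sphere with vanishing triple product are parallel. -/
lemma exists_smul_eq_of_triple_eq_zero {u v w : E3} (hu : ‖u‖ = 1) (huv : inner ℝ u v = 0)
    (huw : inner ℝ u w = 0) (hv : v ≠ 0) (h : triple u v w = 0) : ∃ c : ℝ, w = c • v := by
  have h1 : inner ℝ u u = (1 : ℝ) := by rw [real_inner_self_eq_norm_sq, hu]; norm_num
  have hv2 : inner ℝ v v ≠ (0 : ℝ) := inner_self_ne_zero.2 hv
  refine ⟨inner ℝ v w / inner ℝ v v, ?_⟩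
  have h0 : inner ℝ v v • w - inner ℝ v w • v = (0 : E3) := by
    have e0 : inner ℝ u (inner ℝ v v • w - inner ℝ v w • v) = (0 : ℝ) := by
      simp [inner_sub_right, inner_smul_right, huv, huw]
    have e1 : inner ℝ v (inner ℝ v v • w - inner ℝ v w • v) = (0 : ℝ) := by
      simp only [inner_sub_right, inner_smul_right]; ring
    have e2 : triple u v (inner ℝ v v • w - inner ℝ v w • v) = (0 : ℝ) := by
      rw [sub_eq_add_neg, triple_add_right, ← neg_smul, triple_smul_right, triple_smul_right, h,
        triple_self_right]; ring
    set e := inner ℝ v v • w - inner ℝ v w • v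
    have h3 : triple u v (cross u v) = inner ℝ v v := by
      rw [triple_cross_eq u v hu huv, real_inner_self_eq_norm_sq]
    rw [inner_apply_three] at h1 huv e0 e1
    rw [inner_apply_three v v] at h3 hv2
    rw [triple_apply] at e2 h3
    simp only [cross_zero_apply, cross_one_apply, cross_two_apply] at h3
    ext i
    have hD := hv2
    rw [← h3] at hD
    simp only [PiLp.zero_apply]
    fin_cases i
    · refine (mul_eq_zero.1 ?_).resolve_left hD
      simp only [Fin.zero_eta]
      linear_combination (v 1 * (u 0 * v 1 - u 1 * v 0) - v 2 * (u 2 * v 0 - u 0 * v 2)) * e0 +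
        ((u 2 * v 0 - u 0 * v 2) * u 2 - (u 0 * v 1 - u 1 * v 0) * u 1) * e1 +
        (u 1 * v 2 - u 2 * v 1) * e2
    · refine (mul_eq_zero.1 ?_).resolve_left hD
      simp only [Fin.mk_one]
      linear_combination (v 2 * (u 1 * v 2 - u 2 * v 1) - v 0 * (u 0 * v 1 - u 1 * v 0)) * e0 +
        ((u 0 * v 1 - u 1 * v 0) * u 0 - (u 1 * v 2 - u 2 * v 1) * u 2) * e1 +
        (u 2 * v 0 - u 0 * v 2) * e2
    · refine (mul_eq_zero.1 ?_).resolve_left hD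
      simp only [Fin.reduceFinMk]
      linear_combination (v 0 * (u 2 * v 0 - u 0 * v 2) - v 1 * (u 1 * v 2 - u 2 * v 1)) * e0 +
        ((u 1 * v 2 - u 2 * v 1) * u 1 - (u 2 * v 0 - u 0 * v 2) * u 0) * e1 +
        (u 0 * v 1 - u 1 * v 0) * e2
  rw [sub_eq_zero] at h0
  rw [div_eq_inv_mul, mul_smul, ← h0, smul_smul, inv_mul_cancel₀ hv2, one_smul]

/-! ### Local inverses of parametrizations of the sphere -/

lemma norm_of_mem_sphere2 {x : E3} (hx : x ∈ sphere2) : ‖x‖ = 1 := by simpa using hx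

lemma inner_deriv_eq_zero {c : ℝ → E3} {w : E3} {s : ℝ} (hc : ∀ᶠ e in 𝓝 s, c e ∈ sphere2)
    (hw : HasDerivAt c w s) : inner ℝ (c s) w = 0 := by
  have h1 := hw.inner ℝ hw
  have h2 : (fun e => inner ℝ (c e) (c e)) =ᶠ[𝓝 s] fun _ => (1 : ℝ) := by
    filter_upwards [hc] with e he
    rw [real_inner_self_eq_norm_sq, norm_of_mem_sphere2 he]; norm_num
  have h3 := (h1.congr_of_eventuallyEq h2.symm).unique (hasDerivAt_const s (1 : ℝ))
  rw [real_inner_comm w] at h3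
  linarith [real_inner_comm w (c s)]

lemma inner_fderiv_eq_zero {Ψ : ℝ × ℝ → E3} {z : ℝ × ℝ} (hs : ∀ z, Ψ z ∈ sphere2)
    (hd : DifferentiableAt ℝ Ψ z) (v : ℝ × ℝ) : inner ℝ (Ψ z) (fderiv ℝ Ψ z v) = 0 := by
  have h1 : HasDerivAt (fun e : ℝ => Ψ (z + e • v)) (fderiv ℝ Ψ z v) 0 := by
    have h2 : HasDerivAt (fun e : ℝ => z + e • v) v 0 := by
      simpa using ((hasDerivAt_id (0 : ℝ)).smul_const v).const_add z
    have h3 : HasFDerivAt Ψ (fderiv ℝ Ψ z) (z + (0 : ℝ) • v) := by simpa using hd.hasFDerivAt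
    exact h3.comp_hasDerivAt (0 : ℝ) h2
  simpa using inner_deriv_eq_zero (Eventually.of_forall fun e => hs _) h1

lemma fderiv_apply_eq (Ψ : ℝ × ℝ → E3) (z v : ℝ × ℝ) :
    fderiv ℝ Ψ z v = v.1 • fderiv ℝ Ψ z (1, 0) + v.2 • fderiv ℝ Ψ z (0, 1) := by
  rw [← map_smul, ← map_smul, ← map_add]; simp

/-- A parametrized surface in the sphere whose partial derivatives are independent at `z₀` has a
local inverse, which is differentiable at the image of `z₀`. It is obtained from the inverse
function theorem for `(r, z) ↦ r • Ψ z` at `(1, z₀)`. -/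
theorem exists_local_inverse {Ψ : ℝ × ℝ → E3} {z₀ : ℝ × ℝ} (hΨ : ContDiffAt ℝ ∞ Ψ z₀)
    (hs : ∀ z, Ψ z ∈ sphere2)
    (hdet : triple (Ψ z₀) (fderiv ℝ Ψ z₀ (1, 0)) (fderiv ℝ Ψ z₀ (0, 1)) ≠ 0) :
    ∃ σ : E3 → ℝ × ℝ, (∀ᶠ z in 𝓝 z₀, σ (Ψ z) = z) ∧
      (∀ᶠ x in 𝓝 (Ψ z₀), x ∈ sphere2 → Ψ (σ x) = x) ∧ DifferentiableAt ℝ σ (Ψ z₀) ∧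
      ∀ w, inner ℝ (Ψ z₀) w = 0 → fderiv ℝ Ψ z₀ (fderiv ℝ σ (Ψ z₀) w) = w := by
  have hΨ1 : HasStrictFDerivAt Ψ (fderiv ℝ Ψ z₀) z₀ := hΨ.hasStrictFDerivAt (by simp)
  have hd : DifferentiableAt ℝ Ψ z₀ := hΨ1.differentiableAt
  have h00 : Ψ z₀ ≠ 0 := fun h => by simpa [h] using norm_of_mem_sphere2 (hs z₀)
  set Θ : ℝ × (ℝ × ℝ) → E3 := fun p => p.1 • Ψ p.2 with hΘ
  set D : ℝ × (ℝ × ℝ) →L[ℝ] E3 :=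
    (1 : ℝ) • (fderiv ℝ Ψ z₀).comp (ContinuousLinearMap.snd ℝ ℝ (ℝ × ℝ)) +
      (ContinuousLinearMap.fst ℝ ℝ (ℝ × ℝ)).smulRight (Ψ z₀) with hD
  have hDa : ∀ p, D p = fderiv ℝ Ψ z₀ p.2 + p.1 • Ψ z₀ := fun p => by simp [hD]
  have hΘ1 : HasStrictFDerivAt Θ D (1, z₀) := by
    have h2 : HasStrictFDerivAt (fun p : ℝ × (ℝ × ℝ) => Ψ p.2)
        ((fderiv ℝ Ψ z₀).comp (ContinuousLinearMap.snd ℝ ℝ (ℝ × ℝ))) (1, z₀) :=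
      HasStrictFDerivAt.comp (1, z₀) (g := Ψ) (f := Prod.snd) hΨ1 hasStrictFDerivAt_snd
    exact HasStrictFDerivAt.smul (c := Prod.fst) hasStrictFDerivAt_fst h2
  have hinj : Function.Injective D := by
    rw [injective_iff_map_eq_zero]
    rintro ⟨r, a, b⟩ h
    rw [hDa] at h
    have hn : inner ℝ (Ψ z₀) (Ψ z₀) = (1 : ℝ) := by
      rw [real_inner_self_eq_norm_sq, norm_of_mem_sphere2 (hs z₀)]; norm_num
    have hr : r = 0 := by
      have := congrArg (fun w => inner ℝ (Ψ z₀) w) h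
      simpa [inner_add_right, inner_smul_right, inner_fderiv_eq_zero hs hd, hn, h00] using this
    subst hr
    rw [zero_smul, add_zero, fderiv_apply_eq] at h
    have hb := congrArg (fun w => triple (Ψ z₀) (fderiv ℝ Ψ z₀ (1, 0)) w) h
    simp only [triple_add_right, triple_smul_right, triple_self_right] at hb
    have hb0 : b = 0 := by
      have h0 : triple (Ψ z₀) (fderiv ℝ Ψ z₀ (1, 0)) 0 = 0 := by simp [triple]
      rw [h0] at hb
      simpa [hdet] using hb
    subst hb0
    have h10 : fderiv ℝ Ψ z₀ (1, 0) ≠ 0 := fun h0 => hdet (by rw [h0]; simp [triple_apply])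
    have : a = 0 := by simpa [h10] using h
    simp [this]
  have hrank : Module.finrank ℝ (ℝ × (ℝ × ℝ)) = Module.finrank ℝ E3 := by simp
  let e : (ℝ × (ℝ × ℝ)) ≃L[ℝ] E3 :=
    (LinearEquiv.ofInjectiveOfFinrankEq (D : ℝ × (ℝ × ℝ) →ₗ[ℝ] E3) hinj
      hrank).toContinuousLinearEquiv
  have he : (e : ℝ × (ℝ × ℝ) →L[ℝ] E3) = D := by
    ext1; all_goals rfl
  have hΘ2 : HasStrictFDerivAt Θ (e : ℝ × (ℝ × ℝ) →L[ℝ] E3) (1, z₀) := by rw [he]; exact hΘ1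
  have hΘ0 : Θ (1, z₀) = Ψ z₀ := by simp [hΘ]
  set loc := hΘ2.localInverse
  have hl := hΘ2.eventually_left_inverse
  have hr := hΘ2.eventually_right_inverse
  have hld := hΘ2.to_localInverse.hasFDerivAt
  rw [hΘ0] at hr hld
  have hl1 : loc (Ψ z₀) = (1, z₀) := by rw [← hΘ0]; exact hΘ2.localInverse_apply_image
  have hsd : HasFDerivAt (fun x => (loc x).2)
      ((ContinuousLinearMap.snd ℝ ℝ (ℝ × ℝ)).comp (e.symm : E3 →L[ℝ] ℝ × (ℝ × ℝ))) (Ψ z₀) :=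
    hasFDerivAt_snd.comp (Ψ z₀) hld
  refine ⟨fun x => (loc x).2, ?_, ?_, hsd.differentiableAt, ?_⟩
  · have : Tendsto (fun z : ℝ × ℝ => ((1 : ℝ), z)) (𝓝 z₀) (𝓝 (1, z₀)) :=
      (Continuous.prodMk_right (1 : ℝ)).tendsto z₀
    filter_upwards [this.eventually hl] with z hz
    have h1 : Θ (1, z) = Ψ z := by simp [hΘ]
    rw [h1] at hz
    change (loc (Ψ z)).2 = z
    simp only [loc, hz]
  · have hc : Tendsto (fun x => (loc x).1) (𝓝 (Ψ z₀)) (𝓝 1) := by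
      have := (hld.continuousAt.fst).tendsto
      change Tendsto (fun x => (loc x).1) (𝓝 (Ψ z₀)) (𝓝 (loc (Ψ z₀)).1) at this
      rwa [hl1] at this
    filter_upwards [hr, hc.eventually (lt_mem_nhds zero_lt_one)] with x hx hpos hxs
    change (loc x).1 • Ψ (loc x).2 = x at hx
    have hn := congrArg norm hx
    rw [norm_smul, norm_of_mem_sphere2 (hs _), norm_of_mem_sphere2 hxs, mul_one,
      Real.norm_of_nonneg hpos.le] at hn
    rwa [hn, one_smul] at hx
  · intro w hw
    rw [hsd.fderiv]
    have h1 : D (e.symm w) = w := by rw [← he]; exact e.apply_symm_apply w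
    rw [hDa] at h1
    have h2 : (e.symm w).1 = 0 := by
      have := congrArg (fun w => inner ℝ (Ψ z₀) w) h1
      have hn : inner ℝ (Ψ z₀) (Ψ z₀) = (1 : ℝ) := by
        rw [real_inner_self_eq_norm_sq, norm_of_mem_sphere2 (hs z₀)]; norm_num
      simpa [inner_add_right, inner_smul_right, inner_fderiv_eq_zero hs hd, hn, hw, h00] using this
    rw [h2, zero_smul, add_zero] at h1
    exact h1

/-! ### Parameters of a knot projection -/

lemma SameParam.refl (s : ℝ) : SameParam s s := ⟨0, by simp⟩

lemma SameParam.symm {s t : ℝ} : SameParam s t → SameParam t s := by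
  rintro ⟨n, rfl⟩; exact ⟨-n, by push_cast; ring⟩

lemma SameParam.trans {s t u : ℝ} : SameParam s t → SameParam t u → SameParam s u := by
  rintro ⟨n, rfl⟩ ⟨m, rfl⟩; exact ⟨n + m, by push_cast; ring⟩

lemma SameParam.eq_of_abs_lt {s t : ℝ} (h : SameParam s t) (h' : |t - s| < 2 * Real.pi) :
    t = s := by
  obtain ⟨n, rfl⟩ := h
  have hp := Real.pi_pos
  rw [add_sub_cancel_left, abs_mul, abs_of_pos (by positivity : 0 < 2 * Real.pi)] at h'
  have h1 : |(n : ℝ)| < 1 := by nlinarith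
  have h2 : n = 0 := Int.abs_lt_one_iff.1 (by exact_mod_cast h1)
  simp [h2]

namespace KnotProjection

variable (P : KnotProjection)

lemma continuous_curve : Continuous P.curve := P.smooth.continuous

lemma differentiableAt_curve (t : ℝ) : DifferentiableAt ℝ P.curve t :=
  P.smooth.differentiable (by simp) t

lemma hasDerivAt_curve (t : ℝ) : HasDerivAt P.curve (deriv P.curve t) t :=
  (P.differentiableAt_curve t).hasDerivAt

lemma norm_curve (t : ℝ) : ‖P.curve t‖ = 1 := norm_of_mem_sphere2 (P.mem_sphere t)

lemma inner_curve_deriv (t : ℝ) : inner ℝ (P.curve t) (deriv P.curve t) = 0 :=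
  inner_deriv_eq_zero (Eventually.of_forall P.mem_sphere) (P.hasDerivAt_curve t)

lemma curve_add_int (t : ℝ) (n : ℤ) : P.curve (t + 2 * Real.pi * n) = P.curve t := by
  rw [mul_comm]; exact P.periodic.int_mul n t

lemma curve_eq_of_sameParam {s t : ℝ} (h : SameParam s t) : P.curve s = P.curve t := by
  obtain ⟨n, rfl⟩ := h; exact (P.curve_add_int s n).symm

variable {P} in
lemma sameParam_of_curve_eq {s t : ℝ} (ht : t ∉ P.doubleParams) (h : P.curve s = P.curve t) :
    SameParam s t := by
  by_contra h1; exact ht ⟨s, h, h1⟩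

variable {P} in
lemma mem_doubleParams_of_sameParam {s t : ℝ} (h : SameParam s t) (hs : s ∈ P.doubleParams) :
    t ∈ P.doubleParams := by
  obtain ⟨u, hu, hn⟩ := hs
  exact ⟨u, hu.trans (P.curve_eq_of_sameParam h), fun h1 => hn (h1.trans h.symm)⟩

lemma add_int_mem_doubleParams (t : ℝ) (n : ℤ) :
    t + 2 * Real.pi * n ∈ P.doubleParams ↔ t ∈ P.doubleParams :=
  ⟨mem_doubleParams_of_sameParam (SameParam.symm ⟨n, rfl⟩),
    mem_doubleParams_of_sameParam ⟨n, rfl⟩⟩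

lemma finite_sameParam_Icc (s a b : ℝ) : {u | SameParam s u ∧ u ∈ Set.Icc a b}.Finite := by
  have hp : 0 < 2 * Real.pi := by positivity
  refine ((Set.finite_Icc ⌈(a - s) / (2 * Real.pi)⌉ ⌊(b - s) / (2 * Real.pi)⌋).image
    (fun n : ℤ => s + 2 * Real.pi * n)).subset ?_
  rintro u ⟨⟨n, rfl⟩, h1, h2⟩
  refine ⟨n, ⟨Int.ceil_le.2 ?_, Int.le_floor.2 ?_⟩, rfl⟩
  · rw [div_le_iff₀ hp]; linarith
  · rw [le_div_iff₀ hp]; linarith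

lemma finite_doubleParams_Icc (a b : ℝ) : (P.doubleParams ∩ Set.Icc a b).Finite := by
  refine Set.Finite.of_finite_fibers P.curve (P.finite_double.subset ?_) ?_
  · rintro _ ⟨t, ⟨⟨s, hs, hn⟩, -⟩, rfl⟩
    exact ⟨s, t, hs, rfl, hn⟩
  · rintro _ ⟨t, ⟨⟨s, hs, hn⟩, -⟩, rfl⟩
    refine ((finite_sameParam_Icc s a b).union (finite_sameParam_Icc t a b)).subset ?_
    rintro u ⟨⟨-, hu⟩, hut⟩
    rcases P.no_triple s t u hs (Eq.symm hut) with h | h | h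
    · exact absurd h hn
    · exact Or.inr ⟨h, hu⟩
    · exact Or.inl ⟨h, hu⟩

/-- Double points are isolated along the curve. -/
lemma eventually_notMem_doubleParams (t : ℝ) : ∀ᶠ s in 𝓝[≠] t, s ∉ P.doubleParams := by
  have h1 := (P.finite_doubleParams_Icc (t - 1) (t + 1)).isClosed
  have h2 : ((P.doubleParams ∩ Set.Icc (t - 1) (t + 1)) \ {t})ᶜ ∈ 𝓝 t :=
    (((P.finite_doubleParams_Icc (t - 1) (t + 1)).subset
      Set.sdiff_subset).isClosed.isOpen_compl).mem_nhds
      (by simp)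
  filter_upwards [mem_nhdsWithin_of_mem_nhds h2, self_mem_nhdsWithin,
    mem_nhdsWithin_of_mem_nhds (Icc_mem_nhds (sub_one_lt t) (lt_add_one t))] with s hs hne hI hd
  exact hs ⟨⟨hd, hI⟩, hne⟩

variable {P} in
lemma eventually_notMem_doubleParams_nhds {t : ℝ} (ht : t ∉ P.doubleParams) :
    ∀ᶠ s in 𝓝 t, s ∉ P.doubleParams := by
  have := P.eventually_notMem_doubleParams t
  rw [eventually_nhdsWithin_iff] at this
  filter_upwards [this] with s hs
  by_cases h : s = t
  · rwa [h]
  · exact hs h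

lemma exists_int_sub_mem_Ico (s a : ℝ) :
    ∃ n : ℤ, a ≤ s - 2 * Real.pi * n ∧ s - 2 * Real.pi * n < a + 2 * Real.pi := by
  have := sub_toIcoDiv_zsmul_mem_Ico Real.two_pi_pos a s
  refine ⟨toIcoDiv Real.two_pi_pos a s, ?_⟩
  rw [zsmul_eq_mul] at this
  rwa [mul_comm (2 * Real.pi)]

lemma curve_sub_int (t : ℝ) (n : ℤ) : P.curve (t - 2 * Real.pi * n) = P.curve t :=
  P.curve_eq_of_sameParam ⟨n, by ring⟩

lemma isCompact_image : IsCompact P.image := by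
  have : P.image = P.curve '' Set.Icc 0 (2 * Real.pi) := by
    ext x
    constructor
    · rintro ⟨s, rfl⟩
      obtain ⟨n, h1, h2⟩ := exists_int_sub_mem_Ico s 0
      exact ⟨_, ⟨h1, by linarith⟩, P.curve_sub_int s n⟩
    · rintro ⟨s, -, rfl⟩; exact ⟨s, rfl⟩
  rw [this]
  exact isCompact_Icc.image P.continuous_curve

variable {P} in
/-- Near a simple point the curve consists of a single short arc. -/
lemma eventually_curve_near {t : ℝ} (ht : t ∉ P.doubleParams) {η : ℝ} (hη : 0 < η) :
    ∀ᶠ x in 𝓝 (P.curve t), ∀ s, P.curve s = x → ∃ n : ℤ, |s - 2 * Real.pi * n - t| < η := by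
  set K := P.curve '' (Set.Icc (t - Real.pi) (t + Real.pi) \ Set.Ioo (t - η) (t + η)) with hK
  have hKc : IsCompact K := (isCompact_Icc.diff isOpen_Ioo).image P.continuous_curve
  have htK : P.curve t ∉ K := by
    rintro ⟨s, ⟨⟨h1, h2⟩, h3⟩, hs⟩
    have := (sameParam_of_curve_eq ht hs).eq_of_abs_lt
      (by rw [abs_lt]; constructor <;> linarith [Real.pi_pos])
    subst this
    exact h3 ⟨by linarith, by linarith⟩
  filter_upwards [hKc.isClosed.isOpen_compl.mem_nhds htK] with x hx s hs
  obtain ⟨n, h1, h2⟩ := exists_int_sub_mem_Ico s (t - Real.pi)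
  refine ⟨n, ?_⟩
  by_contra h
  refine hx ⟨s - 2 * Real.pi * n, ⟨⟨h1, by linarith⟩, fun h3 => h ?_⟩, ?_⟩
  · rw [abs_lt]; constructor <;> linarith [h3.1, h3.2]
  · rw [P.curve_sub_int, hs]

/-! ### Polygons -/

/-- A point of the sphere off a closed set `C` has a connected neighbourhood in the complement of
`C` in the sphere: the radial projection of a small ball. -/
lemma _root_.exists_isPreconnected_nhds_sphere2 {C : Set E3} (hC : IsClosed C) {x : E3}
    (hx : x ∈ sphere2 \ C) : ∃ S : Set E3, IsPreconnected S ∧ S ⊆ sphere2 \ C ∧ x ∈ S ∧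
      ∀ᶠ y in 𝓝 x, y ∈ sphere2 → y ∈ S := by
  have hx1 := norm_of_mem_sphere2 hx.1
  have hx0 : x ≠ 0 := fun h => by simp [h] at hx1
  have hcont : ContinuousAt (fun v : E3 => ‖v‖⁻¹ • v) x :=
    (continuousAt_id.norm.inv₀ (by simpa using hx0)).smul continuousAt_id
  have hfx : ∀ y : E3, y ∈ sphere2 → ‖y‖⁻¹ • y = y := fun y hy => by
    rw [norm_of_mem_sphere2 hy]; simp
  have h1 : ∀ᶠ v in 𝓝 x, ‖v‖⁻¹ • v ∈ Cᶜ :=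
    hcont.eventually (by
      change Cᶜ ∈ 𝓝 (‖x‖⁻¹ • x)
      rw [hfx x hx.1]; exact hC.isOpen_compl.mem_nhds hx.2)
  obtain ⟨r, hr, hb⟩ := Metric.eventually_nhds_iff_ball.1 (h1.and (isOpen_ne.mem_nhds hx0))
  refine ⟨(fun v : E3 => ‖v‖⁻¹ • v) '' Metric.ball x r, ?_, ?_, ?_, ?_⟩
  · refine (convex_ball x r).isPreconnected.image _ fun v hv => ContinuousAt.continuousWithinAt ?_
    exact (continuousAt_id.norm.inv₀ (by simpa using (hb v hv).2)).smul continuousAt_id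
  · rintro _ ⟨v, hv, rfl⟩
    refine ⟨?_, (hb v hv).1⟩
    have : ‖v‖ ≠ 0 := by simpa using (hb v hv).2
    simp [norm_smul, this]
  · exact ⟨x, Metric.mem_ball_self hr, hfx x hx.1⟩
  · filter_upwards [Metric.ball_mem_nhds x hr] with y hy hys
    exact ⟨y, hy, hfx y hys⟩

variable {P}

namespace IsFace

variable {F G : Set E3}

lemma subset (hF : P.IsFace F) : F ⊆ sphere2 \ P.image := by
  obtain ⟨x, hx, rfl⟩ := hF; exact connectedComponentIn_subset _ _

lemma isPreconnected (hF : P.IsFace F) : IsPreconnected F := by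
  obtain ⟨x, hx, rfl⟩ := hF; exact isPreconnected_connectedComponentIn

lemma nonempty (hF : P.IsFace F) : F.Nonempty := by
  obtain ⟨x, hx, rfl⟩ := hF; exact ⟨x, mem_connectedComponentIn hx⟩

lemma eq_of_mem {x : E3} (hF : P.IsFace F) (hG : P.IsFace G) (h1 : x ∈ F) (h2 : x ∈ G) :
    F = G := by
  obtain ⟨y, hy, rfl⟩ := hF
  obtain ⟨z, hz, rfl⟩ := hG
  rw [connectedComponentIn_eq h1, connectedComponentIn_eq h2]

lemma subset_of_isPreconnected {S : Set E3} (hF : P.IsFace F) (hS : IsPreconnected S)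
    (hSX : S ⊆ sphere2 \ P.image) {x : E3} (hxS : x ∈ S) (hxF : x ∈ F) : S ⊆ F := by
  obtain ⟨y, hy, rfl⟩ := hF
  rw [connectedComponentIn_eq hxF]
  exact hS.subset_connectedComponentIn hxS hSX

lemma eventually_mem {x : E3} (hF : P.IsFace F) (hx : x ∈ F) :
    ∀ᶠ y in 𝓝 x, y ∈ sphere2 → y ∈ F := by
  obtain ⟨S, hS, hSX, hxS, h⟩ :=
    exists_isPreconnected_nhds_sphere2 P.isCompact_image.isClosed (hF.subset hx)
  filter_upwards [h] with y hy hys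
  exact hF.subset_of_isPreconnected hS hSX hxS hx (hy hys)

lemma mem_of_mem_closure {x : E3} (hF : P.IsFace F) (hx : x ∈ sphere2 \ P.image)
    (h : x ∈ closure F) : x ∈ F := by
  obtain ⟨S, hS, hSX, hxS, h1⟩ :=
    exists_isPreconnected_nhds_sphere2 P.isCompact_image.isClosed hx
  obtain ⟨y, hy, hyF⟩ := ((mem_closure_iff_frequently.1 h).and_eventually h1).exists
  exact hF.subset_of_isPreconnected hS hSX (hyF (hF.subset hy).1) hy hxS

end IsFace

lemma exists_isFace {x : E3} (hx : x ∈ sphere2 \ P.image) : ∃ F, P.IsFace F ∧ x ∈ F :=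
  ⟨_, ⟨x, hx, rfl⟩, mem_connectedComponentIn hx⟩

/-- A connected subset of the complement which is relatively open and closed in it is a polygon. -/
lemma isFace_of_isClopen {F : Set E3} (hne : F.Nonempty) (hc : IsPreconnected F)
    (hX : F ⊆ sphere2 \ P.image) (ho : ∀ x ∈ F, ∀ᶠ y in 𝓝 x, y ∈ sphere2 → y ∈ F)
    (hcl : ∀ x ∈ sphere2 \ P.image, x ∈ closure F → x ∈ F) : P.IsFace F := by
  obtain ⟨x, hx⟩ := hne
  obtain ⟨G, hG, hxG⟩ := exists_isFace (hX hx)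
  have hFG : F ⊆ G := hG.subset_of_isPreconnected hc hX hx hxG
  suffices G ⊆ F by rwa [hFG.antisymm this]
  have hU : ∀ y ∈ F, ∃ r > 0, ∀ z ∈ Metric.ball y r, z ∈ sphere2 → z ∈ F := fun y hy =>
    Metric.eventually_nhds_iff_ball.1 (ho y hy)
  choose! r hr hrF using hU
  intro y hy
  by_contra hyF
  obtain ⟨z, hzG, hz1, hz2⟩ := hG.isPreconnected (⋃ y ∈ F, Metric.ball y (r y)) (closure F)ᶜ
    (isOpen_biUnion fun _ _ => Metric.isOpen_ball) isClosed_closure.isOpen_compl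
    (fun z hz => by
      by_cases h : z ∈ closure F
      · have := hcl z (hG.subset hz) h
        exact Or.inl (Set.mem_biUnion this (Metric.mem_ball_self (hr z this)))
      · exact Or.inr h)
    ⟨x, hxG, Set.mem_biUnion hx (Metric.mem_ball_self (hr x hx))⟩
    ⟨y, hy, fun h => hyF (hcl y (hG.subset hy) h)⟩
  obtain ⟨w, hw, hzw⟩ := Set.mem_iUnion₂.1 hz1
  exact hz2 (subset_closure (hrF w hw z hzw (hG.subset hzG).1))

end KnotProjection

namespace KnotProjection

/-! ### The two sides of the curve -/

variable (P : KnotProjection)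

/-- The unit vector tangent to the sphere and pointing to the left of the curve. -/
noncomputable def leftNormal (t : ℝ) : E3 :=
  ‖deriv P.curve t‖⁻¹ • cross (P.curve t) (deriv P.curve t)

lemma normalPoint_eq (t ε : ℝ) :
    P.normalPoint t ε = Real.cos ε • P.curve t + Real.sin ε • P.leftNormal t := rfl

lemma norm_deriv_pos (t : ℝ) : 0 < ‖deriv P.curve t‖ := norm_pos_iff.2 (P.immersion t)

lemma norm_leftNormal (t : ℝ) : ‖P.leftNormal t‖ = 1 := by
  have h := triple_cross_eq (P.curve t) (deriv P.curve t) (P.norm_curve t) (P.inner_curve_deriv t)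
  rw [triple, real_inner_self_eq_norm_sq] at h
  have h2 : ‖cross (P.curve t) (deriv P.curve t)‖ = ‖deriv P.curve t‖ :=
    (sq_eq_sq₀ (norm_nonneg _) (norm_nonneg _)).1 h
  rw [leftNormal, norm_smul, h2, norm_inv, norm_norm, inv_mul_cancel₀ (P.norm_deriv_pos t).ne']

lemma inner_curve_leftNormal (t : ℝ) : inner ℝ (P.curve t) (P.leftNormal t) = 0 := by
  rw [leftNormal, inner_smul_right, inner_cross_self_left, mul_zero]

lemma triple_leftNormal (t : ℝ) :
    triple (P.curve t) (deriv P.curve t) (P.leftNormal t) = ‖deriv P.curve t‖ := by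
  rw [leftNormal, triple_smul_right, triple_cross_eq _ _ (P.norm_curve t) (P.inner_curve_deriv t)]
  field_simp [(P.norm_deriv_pos t).ne']

lemma normalPoint_mem_sphere2 (t ε : ℝ) : P.normalPoint t ε ∈ sphere2 := by
  have h : ‖P.normalPoint t ε‖ ^ 2 = 1 := by
    rw [normalPoint_eq, norm_add_sq_real, norm_smul, norm_smul, P.norm_curve, P.norm_leftNormal,
      inner_smul_left, inner_smul_right, P.inner_curve_leftNormal]
    simp
  have : ‖P.normalPoint t ε‖ = 1 := by
    have h0 := norm_nonneg (P.normalPoint t ε)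
    nlinarith
  simpa using this

lemma _root_.contDiff_cross {E : Type*} [NormedAddCommGroup E] [NormedSpace ℝ E] {f g : E → E3}
    (hf : ContDiff ℝ ∞ f) (hg : ContDiff ℝ ∞ g) : ContDiff ℝ ∞ fun x => cross (f x) (g x) := by
  rw [contDiff_euclidean] at *
  intro i
  fin_cases i
  · simp only [Fin.zero_eta, cross_zero_apply]
    exact ((hf 1).mul (hg 2)).sub ((hf 2).mul (hg 1))
  · simp only [Fin.mk_one, cross_one_apply]
    exact ((hf 2).mul (hg 0)).sub ((hf 0).mul (hg 2))
  · simp only [Fin.reduceFinMk, cross_two_apply]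
    exact ((hf 0).mul (hg 1)).sub ((hf 1).mul (hg 0))

lemma contDiff_deriv_curve : ContDiff ℝ ∞ (deriv P.curve) :=
  (contDiff_infty_iff_deriv.1 P.smooth).2

lemma contDiff_leftNormal : ContDiff ℝ ∞ P.leftNormal :=
  ((P.contDiff_deriv_curve.norm ℝ P.immersion).inv fun t => (P.norm_deriv_pos t).ne').smul
    (contDiff_cross P.smooth P.contDiff_deriv_curve)

lemma contDiff_normalPoint : ContDiff ℝ ∞ fun z : ℝ × ℝ => P.normalPoint z.1 z.2 := by
  simp only [normalPoint_eq]
  exact ((Real.contDiff_cos.comp contDiff_snd).smul (P.smooth.comp contDiff_fst)).add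
    ((Real.contDiff_sin.comp contDiff_snd).smul (P.contDiff_leftNormal.comp contDiff_fst))

@[simp] lemma normalPoint_zero (t : ℝ) : P.normalPoint t 0 = P.curve t := by
  simp [normalPoint_eq]

lemma hasDerivAt_normalPoint (t : ℝ) : HasDerivAt (P.normalPoint t) (P.leftNormal t) 0 := by
  have h1 := ((Real.hasDerivAt_cos 0).smul_const (P.curve t)).add
    ((Real.hasDerivAt_sin 0).smul_const (P.leftNormal t))
  simp only [Real.sin_zero, neg_zero, zero_smul, Real.cos_zero, one_smul, zero_add] at h1
  exact h1

lemma fderiv_normalPoint_fst (t : ℝ) :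
    fderiv ℝ (fun z : ℝ × ℝ => P.normalPoint z.1 z.2) (t, 0) (1, 0) = deriv P.curve t := by
  have h1 := (P.contDiff_normalPoint.differentiable (by simp) (t, 0)).hasFDerivAt
  have h2 : HasDerivAt (fun u : ℝ => (u, (0 : ℝ))) (1, 0) t :=
    (hasDerivAt_id t).prodMk (hasDerivAt_const t 0)
  have h3 := h1.comp_hasDerivAt t h2
  have h4 : ((fun z : ℝ × ℝ => P.normalPoint z.1 z.2) ∘ fun u : ℝ => (u, (0 : ℝ))) = P.curve := by
    ext1 u; simp
  rw [h4] at h3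
  exact h3.deriv.symm

lemma fderiv_normalPoint_snd (t : ℝ) :
    fderiv ℝ (fun z : ℝ × ℝ => P.normalPoint z.1 z.2) (t, 0) (0, 1) = P.leftNormal t := by
  have h1 := (P.contDiff_normalPoint.differentiable (by simp) (t, 0)).hasFDerivAt
  have h2 : HasDerivAt (fun v : ℝ => (t, v)) (0, 1) 0 :=
    (hasDerivAt_const 0 t).prodMk (hasDerivAt_id 0)
  exact (h1.comp_hasDerivAt 0 h2).unique (P.hasDerivAt_normalPoint t)

variable {P}

/-- A collar of the curve at a simple point: a function `σ` on a neighbourhood that vanishes on the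
curve, and connected sets `L` and `R` in the complement that contain the points of the sphere near
`P.curve t` at which `σ` is positive, respectively negative. The derivative of `σ` along a tangent
vector has the sign of its component to the left. -/
theorem exists_collar {t : ℝ} (ht : t ∉ P.doubleParams) :
    ∃ (σ : E3 → ℝ) (L R : Set E3) (δ : ℝ), 0 < δ ∧ IsPreconnected L ∧ IsPreconnected R ∧
      L ⊆ sphere2 \ P.image ∧ R ⊆ sphere2 \ P.image ∧
      (∀ᶠ x in 𝓝 (P.curve t), x ∈ sphere2 →
        (0 < σ x → x ∈ L) ∧ (σ x < 0 → x ∈ R) ∧ (σ x = 0 → x ∈ P.image)) ∧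
      (∀ u ∈ Set.Ioo (t - δ) (t + δ), ∀ ε ∈ Set.Ioo 0 δ,
        P.normalPoint u ε ∈ L ∧ P.normalPoint u (-ε) ∈ R) ∧
      σ (P.curve t) = 0 ∧ DifferentiableAt ℝ σ (P.curve t) ∧
      ∀ w, inner ℝ (P.curve t) w = 0 →
        triple (P.curve t) (deriv P.curve t) w = fderiv ℝ σ (P.curve t) w * ‖deriv P.curve t‖ := by
  set Ψ : ℝ × ℝ → E3 := fun z => P.normalPoint z.1 z.2 with hΨ
  have h0 : Ψ (t, 0) = P.curve t := P.normalPoint_zero t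
  have hs : ∀ z, Ψ z ∈ sphere2 := fun z => P.normalPoint_mem_sphere2 _ _
  obtain ⟨σ, hl, hr, hd, hw⟩ := exists_local_inverse (Ψ := Ψ) (z₀ := (t, 0))
    P.contDiff_normalPoint.contDiffAt hs (by
      rw [h0, fderiv_normalPoint_fst, fderiv_normalPoint_snd, triple_leftNormal]
      exact (P.norm_deriv_pos t).ne')
  have hσ0 : σ (P.curve t) = (t, 0) := by rw [← h0]; exact hl.self_of_nhds
  rw [h0] at hr hd hw
  obtain ⟨δ₁, hδ₁, hb⟩ := Metric.eventually_nhds_iff_ball.1 hl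
  have hbox : ∀ z : ℝ × ℝ, |z.1 - t| < δ₁ → |z.2| < δ₁ → z ∈ Metric.ball (t, (0 : ℝ)) δ₁ := by
    intro z h1 h2
    rw [Metric.mem_ball, Prod.dist_eq, max_lt_iff, Real.dist_eq, Real.dist_eq]
    exact ⟨h1, by simpa using h2⟩
  -- Points of the parameter box off the axis are mapped off the curve.
  have hoff : ∀ᶠ z in 𝓝 (t, (0 : ℝ)), z.2 ≠ 0 → Ψ z ∈ sphere2 \ P.image := by
    have hc : Tendsto Ψ (𝓝 (t, 0)) (𝓝 (P.curve t)) := by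
      rw [← h0]; exact P.contDiff_normalPoint.continuous.tendsto _
    filter_upwards [hc.eventually (eventually_curve_near ht hδ₁), hl] with z hz hlz hne
    refine ⟨hs z, ?_⟩
    rintro ⟨s, hs⟩
    obtain ⟨n, hn⟩ := hz s hs
    have h1 := hb (s - 2 * Real.pi * n, 0) (hbox _ hn (by simpa using hδ₁))
    have h2 : Ψ (s - 2 * Real.pi * n, 0) = Ψ z := by
      rw [← hs, ← P.curve_sub_int s n]; exact P.normalPoint_zero _
    rw [h2, hlz] at h1
    exact hne (by rw [h1])
  obtain ⟨δ, hδ, hδb⟩ := Metric.eventually_nhds_iff_ball.1 hoff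
  have hbox' : ∀ z : ℝ × ℝ, z.1 ∈ Set.Ioo (t - δ) (t + δ) → z.2 ∈ Set.Ioo (-δ) δ →
      z ∈ Metric.ball (t, (0 : ℝ)) δ := by
    rintro z ⟨h1, h2⟩ ⟨h3, h4⟩
    rw [Metric.mem_ball, Prod.dist_eq, max_lt_iff, Real.dist_eq, Real.dist_eq, abs_lt, abs_lt]
    refine ⟨⟨?_, ?_⟩, ⟨?_, ?_⟩⟩ <;> simp <;> linarith
  refine ⟨fun x => (σ x).2, Ψ '' (Set.Ioo (t - δ) (t + δ) ×ˢ Set.Ioo 0 δ),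
    Ψ '' (Set.Ioo (t - δ) (t + δ) ×ˢ Set.Ioo (-δ) 0), δ, hδ, ?_, ?_, ?_, ?_, ?_, ?_, ?_, ?_, ?_⟩
  · exact (isPreconnected_Ioo.prod isPreconnected_Ioo).image _
      P.contDiff_normalPoint.continuous.continuousOn
  · exact (isPreconnected_Ioo.prod isPreconnected_Ioo).image _
      P.contDiff_normalPoint.continuous.continuousOn
  · rintro _ ⟨z, ⟨h1, h2⟩, rfl⟩
    exact hδb z (hbox' z h1 ⟨by linarith [h2.1], h2.2⟩) h2.1.ne'
  · rintro _ ⟨z, ⟨h1, h2⟩, rfl⟩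
    exact hδb z (hbox' z h1 ⟨h2.1, by linarith [h2.2]⟩) h2.2.ne
  · have hc : Tendsto σ (𝓝 (P.curve t)) (𝓝 (t, 0)) := by
      rw [← hσ0]; exact hd.continuousAt
    have hc1 : ∀ᶠ x in 𝓝 (P.curve t), (σ x).1 ∈ Set.Ioo (t - δ) (t + δ) :=
      hc.fst_nhds.eventually (Ioo_mem_nhds (by simpa using hδ) (by simpa using hδ))
    have hc2 : ∀ᶠ x in 𝓝 (P.curve t), (σ x).2 ∈ Set.Ioo (-δ) δ :=
      hc.snd_nhds.eventually (Ioo_mem_nhds (by simpa using hδ) (by simpa using hδ))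
    filter_upwards [hr, hc1, hc2] with x hx h1 h2 hxs
    refine ⟨fun h => ⟨σ x, ⟨h1, h, h2.2⟩, hx hxs⟩, fun h => ⟨σ x, ⟨h1, h2.1, h⟩, hx hxs⟩,
      fun h => ?_⟩
    refine ⟨(σ x).1, ?_⟩
    rw [← P.normalPoint_zero, ← h]
    exact hx hxs
  · intro u hu ε hε
    exact ⟨⟨(u, ε), ⟨hu, hε⟩, rfl⟩,
      ⟨(u, -ε), ⟨hu, ⟨by simpa using hε.2, by simpa using hε.1⟩⟩, rfl⟩⟩
  · simp [hσ0]
  · exact hd.snd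
  · intro w hw0
    have h1 := hw w hw0
    have h2 : fderiv ℝ (fun x => (σ x).2) (P.curve t) w = (fderiv ℝ σ (P.curve t) w).2 := by
      rw [hd.hasFDerivAt.snd.fderiv]
      rfl
    rw [h2]
    rw [fderiv_apply_eq, fderiv_normalPoint_fst, fderiv_normalPoint_snd] at h1
    conv_lhs => rw [← h1]
    rw [triple_add_right, triple_smul_right, triple_smul_right, triple_self_right,
      triple_leftNormal]
    ring

lemma OnLeft.eq {F G : Set E3} {t : ℝ} (hF : P.IsFace F) (hG : P.IsFace G)
    (h1 : P.OnLeft F t) (h2 : P.OnLeft G t) : F = G := by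
  obtain ⟨ε, h3, h4⟩ := (h1.and h2).exists
  exact hF.eq_of_mem hG h3 h4

lemma OnRight.eq {F G : Set E3} {t : ℝ} (hF : P.IsFace F) (hG : P.IsFace G)
    (h1 : P.OnRight F t) (h2 : P.OnRight G t) : F = G := by
  obtain ⟨ε, h3, h4⟩ := (h1.and h2).exists
  exact hF.eq_of_mem hG h3 h4

lemma OnLeft.eventually {F : Set E3} {t : ℝ} (ht : t ∉ P.doubleParams) (hF : P.IsFace F)
    (h : P.OnLeft F t) : ∀ᶠ s in 𝓝 t, P.OnLeft F s := by
  obtain ⟨σ, L, R, δ, hδ, hL, -, hLX, -, -, hn, -⟩ := exists_collar ht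
  obtain ⟨ε, h1, h2⟩ := (Filter.Eventually.and h (Ioo_mem_nhdsGT hδ)).exists
  have hLF : L ⊆ F := hF.subset_of_isPreconnected hL hLX
    (hn t ⟨by linarith, by linarith⟩ ε h2).1 h1
  filter_upwards [Ioo_mem_nhds (by linarith : t - δ < t) (by linarith : t < t + δ)] with s hs
  filter_upwards [Ioo_mem_nhdsGT hδ] with e he
  exact hLF (hn s hs e he).1

lemma OnRight.eventually {F : Set E3} {t : ℝ} (ht : t ∉ P.doubleParams) (hF : P.IsFace F)
    (h : P.OnRight F t) : ∀ᶠ s in 𝓝 t, P.OnRight F s := by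
  obtain ⟨σ, L, R, δ, hδ, -, hR, -, hRX, -, hn, -⟩ := exists_collar ht
  obtain ⟨ε, h1, h2⟩ := (Filter.Eventually.and h (Ioo_mem_nhdsGT hδ)).exists
  have hRF : R ⊆ F := hF.subset_of_isPreconnected hR hRX
    (hn t ⟨by linarith, by linarith⟩ ε h2).2 h1
  filter_upwards [Ioo_mem_nhds (by linarith : t - δ < t) (by linarith : t < t + δ)] with s hs
  filter_upwards [Ioo_mem_nhdsGT hδ] with e he
  exact hRF (hn s hs e he).2

lemma exists_onLeft {t : ℝ} (ht : t ∉ P.doubleParams) : ∃ F, P.IsFace F ∧ P.OnLeft F t := by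
  obtain ⟨σ, L, R, δ, hδ, hL, -, hLX, -, -, hn, -⟩ := exists_collar ht
  have htt : t ∈ Set.Ioo (t - δ) (t + δ) := ⟨by linarith, by linarith⟩
  have h1 := (hn t htt (δ / 2) ⟨by linarith, by linarith⟩).1
  obtain ⟨F, hF, hxF⟩ := exists_isFace (hLX h1)
  refine ⟨F, hF, ?_⟩
  filter_upwards [Ioo_mem_nhdsGT hδ] with e he
  exact hF.subset_of_isPreconnected hL hLX h1 hxF (hn t htt e he).1

lemma exists_onRight {t : ℝ} (ht : t ∉ P.doubleParams) : ∃ F, P.IsFace F ∧ P.OnRight F t := by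
  obtain ⟨σ, L, R, δ, hδ, -, hR, -, hRX, -, hn, -⟩ := exists_collar ht
  have htt : t ∈ Set.Ioo (t - δ) (t + δ) := ⟨by linarith, by linarith⟩
  have h1 := (hn t htt (δ / 2) ⟨by linarith, by linarith⟩).2
  obtain ⟨F, hF, hxF⟩ := exists_isFace (hRX h1)
  refine ⟨F, hF, ?_⟩
  filter_upwards [Ioo_mem_nhdsGT hδ] with e he
  exact hF.subset_of_isPreconnected hR hRX h1 hxF (hn t htt e he).2

lemma tendsto_normalPoint (t : ℝ) {f : ℝ → ℝ} (hf : Continuous f) (h0 : f 0 = 0) :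
    Tendsto (fun ε => P.normalPoint t (f ε)) (𝓝[>] 0) (𝓝 (P.curve t)) := by
  have h1 : Continuous fun ε => P.normalPoint t (f ε) :=
    Continuous.comp (g := fun z : ℝ × ℝ => P.normalPoint z.1 z.2) (f := fun ε => (t, f ε))
      P.contDiff_normalPoint.continuous (continuous_const.prodMk hf)
  have h2 := h1.tendsto 0
  simp only [h0, normalPoint_zero] at h2
  exact h2.mono_left nhdsWithin_le_nhds

/-- The polygons whose boundary contains a simple point of the curve are the ones on its left and
on its right. -/
lemma curve_mem_closure_iff {F : Set E3} {t : ℝ} (ht : t ∉ P.doubleParams) (hF : P.IsFace F) :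
    P.curve t ∈ closure F ↔ P.OnLeft F t ∨ P.OnRight F t := by
  constructor
  · intro h
    obtain ⟨σ, L, R, δ, hδ, hL, hR, hLX, hRX, hx, hn, -⟩ := exists_collar ht
    have htt : t ∈ Set.Ioo (t - δ) (t + δ) := ⟨by linarith, by linarith⟩
    obtain ⟨y, hy, hyF⟩ := ((mem_closure_iff_frequently.1 h).and_eventually hx).exists
    obtain ⟨h1, h2, h3⟩ := hyF (hF.subset hy).1
    rcases lt_trichotomy (σ y) 0 with h4 | h4 | h4
    · have := hF.subset_of_isPreconnected hR hRX (h2 h4) hy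
      right
      filter_upwards [Ioo_mem_nhdsGT hδ] with e he
      exact this (hn t htt e he).2
    · exact absurd (h3 h4) (hF.subset hy).2
    · have := hF.subset_of_isPreconnected hL hLX (h1 h4) hy
      left
      filter_upwards [Ioo_mem_nhdsGT hδ] with e he
      exact this (hn t htt e he).1
  · rintro (h | h)
    · exact mem_closure_of_tendsto (tendsto_normalPoint t continuous_id rfl) h
    · exact mem_closure_of_tendsto (tendsto_normalPoint t continuous_neg neg_zero) h

lemma _root_.eventually_pos_of_hasDerivAt {f : ℝ → ℝ} {a : ℝ} (hf : HasDerivAt f a 0)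
    (h0 : f 0 = 0) (ha : 0 < a) : ∀ᶠ ε in 𝓝[>] (0 : ℝ), 0 < f ε := by
  have h1 := (hasDerivAt_iff_tendsto_slope_zero.1 hf).mono_left
    (nhdsWithin_mono 0 (fun x (hx : 0 < x) => hx.ne') : 𝓝[>] (0 : ℝ) ≤ 𝓝[≠] 0)
  filter_upwards [h1.eventually (lt_mem_nhds ha), self_mem_nhdsWithin] with ε h2 h3
  rw [zero_add, h0, sub_zero, smul_eq_mul] at h2
  exact (mul_pos_iff_of_pos_left (inv_pos.2 h3)).1 h2

/-- A path in the sphere that leaves a simple point of the curve with a velocity pointing to the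
left runs into the polygon on the left. -/
lemma onLeft_iff_of_path {F : Set E3} {t : ℝ} (ht : t ∉ P.doubleParams) (hF : P.IsFace F)
    {c : ℝ → E3} {w : E3} (hc : ∀ e, c e ∈ sphere2) (hc0 : c 0 = P.curve t)
    (hw : HasDerivAt c w 0) (hpos : 0 < triple (P.curve t) (deriv P.curve t) w) :
    P.OnLeft F t ↔ ∀ᶠ ε in 𝓝[>] (0 : ℝ), c ε ∈ F := by
  obtain ⟨σ, L, R, δ, hδ, hL, hR, hLX, hRX, hx, hn, hσ0, hd, htr⟩ := exists_collar ht
  have hw0 : inner ℝ (P.curve t) w = 0 := by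
    rw [← hc0]; exact inner_deriv_eq_zero (Eventually.of_forall hc) hw
  have htt : t ∈ Set.Ioo (t - δ) (t + δ) := ⟨by linarith, by linarith⟩
  have hcL : ∀ᶠ ε in 𝓝[>] (0 : ℝ), c ε ∈ L := by
    rw [← hc0] at hd
    have h1 : HasDerivAt (fun e => σ (c e)) (fderiv ℝ σ (c 0) w) 0 :=
      hd.hasFDerivAt.comp_hasDerivAt 0 hw
    have h2 := eventually_pos_of_hasDerivAt h1 (by rw [hc0, hσ0]) (by
      rw [htr w hw0, ← hc0] at hpos
      exact pos_of_mul_pos_left hpos (norm_nonneg _))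
    have h3 : Tendsto c (𝓝[>] 0) (𝓝 (P.curve t)) := by
      rw [← hc0]; exact hw.continuousAt.mono_left nhdsWithin_le_nhds
    filter_upwards [h2, h3.eventually hx] with e h4 h5
    exact (h5 (hc e)).1 h4
  constructor
  · intro h
    obtain ⟨ε, h1, h2⟩ := (Filter.Eventually.and h (Ioo_mem_nhdsGT hδ)).exists
    have := hF.subset_of_isPreconnected hL hLX (hn t htt ε h2).1 h1
    filter_upwards [hcL] with e he using this he
  · intro h
    obtain ⟨ε, h1, h2⟩ := (h.and hcL).exists
    have := hF.subset_of_isPreconnected hL hLX h2 h1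
    filter_upwards [Ioo_mem_nhdsGT hδ] with e he
    exact this (hn t htt e he).1

lemma onRight_iff_of_path {F : Set E3} {t : ℝ} (ht : t ∉ P.doubleParams) (hF : P.IsFace F)
    {c : ℝ → E3} {w : E3} (hc : ∀ e, c e ∈ sphere2) (hc0 : c 0 = P.curve t)
    (hw : HasDerivAt c w 0) (hneg : triple (P.curve t) (deriv P.curve t) w < 0) :
    P.OnRight F t ↔ ∀ᶠ ε in 𝓝[>] (0 : ℝ), c ε ∈ F := by
  obtain ⟨σ, L, R, δ, hδ, hL, hR, hLX, hRX, hx, hn, hσ0, hd, htr⟩ := exists_collar ht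
  have hw0 : inner ℝ (P.curve t) w = 0 := by
    rw [← hc0]; exact inner_deriv_eq_zero (Eventually.of_forall hc) hw
  have htt : t ∈ Set.Ioo (t - δ) (t + δ) := ⟨by linarith, by linarith⟩
  have hcR : ∀ᶠ ε in 𝓝[>] (0 : ℝ), c ε ∈ R := by
    rw [← hc0] at hd
    have h1 : HasDerivAt (fun e => -σ (c e)) (-fderiv ℝ σ (c 0) w) 0 :=
      (hd.hasFDerivAt.comp_hasDerivAt 0 hw).neg
    have h2 := eventually_pos_of_hasDerivAt h1 (by rw [hc0, hσ0, neg_zero]) (by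
      rw [htr w hw0, ← hc0] at hneg
      exact neg_pos.2 (neg_of_mul_neg_left hneg (norm_nonneg _)))
    have h3 : Tendsto c (𝓝[>] 0) (𝓝 (P.curve t)) := by
      rw [← hc0]; exact hw.continuousAt.mono_left nhdsWithin_le_nhds
    filter_upwards [h2, h3.eventually hx] with e h4 h5
    exact (h5 (hc e)).2.1 (neg_pos.1 h4)
  constructor
  · intro h
    obtain ⟨ε, h1, h2⟩ := (Filter.Eventually.and h (Ioo_mem_nhdsGT hδ)).exists
    have := hF.subset_of_isPreconnected hR hRX (hn t htt ε h2).2 h1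
    filter_upwards [hcR] with e he using this he
  · intro h
    obtain ⟨ε, h1, h2⟩ := (h.and hcR).exists
    have := hF.subset_of_isPreconnected hR hRX h2 h1
    filter_upwards [Ioo_mem_nhdsGT hδ] with e he
    exact this (hn t htt e he).2

end KnotProjection

/-! ### Winding integrals -/

section Winding

variable {γ γ' : ℝ → ℂ} {a b : ℝ}

/-- The integral of `dζ / (ζ - z)` along the path `γ` with derivative `γ'`. -/
noncomputable def windingIntegral (γ γ' : ℝ → ℂ) (a b : ℝ) (z : ℂ) : ℂ :=
  ∫ t in a..b, γ' t / (γ t - z)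

lemma intervalIntegrable_winding (hγ : Continuous γ) (hγ' : Continuous γ') {z : ℂ}
    (hz : ∀ t ∈ Set.uIcc a b, γ t ≠ z) :
    IntervalIntegrable (fun t => γ' t / (γ t - z)) MeasureTheory.volume a b :=
  (hγ'.continuousOn.div (hγ.continuousOn.sub continuousOn_const)
    fun t ht => sub_ne_zero.2 (hz t ht)).intervalIntegrable

lemma exp_windingIntegral (hγ : ∀ t, HasDerivAt γ (γ' t) t) (hγ' : Continuous γ') {z : ℂ}
    (hz : ∀ t, γ t ≠ z) (hab : γ a = γ b) : Complex.exp (windingIntegral γ γ' a b z) = 1 := by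
  have hc : Continuous fun t => γ' t / (γ t - z) :=
    hγ'.div ((continuous_iff_continuousAt.2 fun t => (hγ t).continuousAt).sub continuous_const)
      fun t => sub_ne_zero.2 (hz t)
  have hG : ∀ t, HasDerivAt (fun u => windingIntegral γ γ' a u z) (γ' t / (γ t - z)) t :=
    fun t => hc.integral_hasStrictDerivAt a t |>.hasDerivAt
  have hd : ∀ t, HasDerivAt
      (fun u => (γ u - z) * Complex.exp (-windingIntegral γ γ' a u z)) 0 t := by
    intro t
    refine (((hγ t).sub_const z).mul ((hG t).neg.cexp)).congr_deriv ?_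
    have := sub_ne_zero.2 (hz t)
    field_simp
    ring
  have h1 := is_const_of_deriv_eq_zero (fun t => (hd t).differentiableAt)
    (fun t => (hd t).deriv) a b
  simp only [windingIntegral, intervalIntegral.integral_same, neg_zero, Complex.exp_zero, mul_one,
    hab] at h1
  have h2 := sub_ne_zero.2 (hz b)
  have h3 : Complex.exp (-∫ t in a..b, γ' t / (γ t - z)) = 1 := by
    apply mul_left_cancel₀ h2
    rw [mul_one]; exact h1.symm
  rw [Complex.exp_neg, inv_eq_one] at h3
  exact h3

lemma continuousAt_windingIntegral (hγ : Continuous γ) (hγ' : Continuous γ') {z : ℂ}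
    (hz : ∀ t ∈ Set.uIcc a b, γ t ≠ z) : ContinuousAt (windingIntegral γ γ' a b) z := by
  obtain ⟨M, hM⟩ := (isCompact_uIcc (a := a) (b := b)).exists_bound_of_continuousOn
    hγ'.continuousOn
  have hK : IsCompact (γ '' Set.uIcc a b) := isCompact_uIcc.image hγ
  have hzK : z ∉ γ '' Set.uIcc a b := by rintro ⟨t, ht, h⟩; exact hz t ht h
  obtain ⟨r, hr, hb⟩ := Metric.isOpen_iff.1 hK.isClosed.isOpen_compl z hzK
  have hball : ∀ w ∈ Metric.ball z (r / 2), ∀ t ∈ Set.uIcc a b, r / 2 ≤ ‖γ t - w‖ := by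
    intro w hw t ht
    by_contra h
    push Not at h
    refine hb (a := γ t) ?_ ⟨t, ht, rfl⟩
    rw [Metric.mem_ball] at *
    calc dist (γ t) z ≤ dist (γ t) w + dist w z := dist_triangle _ _ _
      _ < r / 2 + r / 2 := by rw [dist_eq_norm (γ t)]; linarith
      _ = r := by ring
  have hne : ∀ w ∈ Metric.ball z (r / 2), ∀ t ∈ Set.uIcc a b, γ t ≠ w := by
    rintro w hw t ht rfl
    have := hball _ hw t ht
    simp at this; linarith
  refine intervalIntegral.continuousAt_of_dominated_interval (bound := fun _ => M / (r / 2))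
    ?_ ?_ intervalIntegrable_const ?_
  · filter_upwards [Metric.ball_mem_nhds z (half_pos hr)] with w hw
    have := (intervalIntegrable_winding hγ hγ' (hne w hw)).def'
    exact this.aestronglyMeasurable
  · filter_upwards [Metric.ball_mem_nhds z (half_pos hr)] with w hw
    refine Eventually.of_forall fun t ht => ?_
    have ht' := Set.uIoc_subset_uIcc ht
    rw [norm_div]
    exact div_le_div₀ ((norm_nonneg _).trans (hM t ht')) (hM t ht') (half_pos hr) (hball w hw t ht')
  · refine Eventually.of_forall fun t ht => ?_
    exact continuousAt_const.div (continuousAt_const.sub continuousAt_id)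
      (sub_ne_zero.2 (hz t (Set.uIoc_subset_uIcc ht)))

lemma eq_zero_of_exp_eq_one {w : ℂ} (h : Complex.exp w = 1) (hw : ‖w‖ < 1) : w = 0 := by
  obtain ⟨n, rfl⟩ := Complex.exp_eq_one_iff.1 h
  have h1 : |(n : ℝ)| * (2 * Real.pi) < 1 := by
    simpa [abs_of_pos Real.pi_pos] using hw
  have h2 : |(n : ℝ)| < 1 := by nlinarith [Real.pi_gt_three, abs_nonneg (n : ℝ)]
  have h3 : n = 0 := Int.abs_lt_one_iff.1 (by exact_mod_cast h2)
  simp [h3]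

lemma windingIntegral_eventually_eq (hγ : ∀ t, HasDerivAt γ (γ' t) t) (hγ' : Continuous γ')
    (hab : γ a = γ b) (hK : IsClosed (Set.range γ)) {z : ℂ} (hz : ∀ t, γ t ≠ z) :
    ∀ᶠ w in 𝓝 z, windingIntegral γ γ' a b w = windingIntegral γ γ' a b z := by
  have hc := continuousAt_windingIntegral (a := a) (b := b)
    (continuous_iff_continuousAt.2 fun t => (hγ t).continuousAt) hγ' (fun t _ => hz t)
  have h1 : ∀ᶠ w in 𝓝 z, w ∈ (Set.range γ)ᶜ :=
    hK.isOpen_compl.mem_nhds (by rintro ⟨t, h⟩; exact hz t h)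
  filter_upwards [h1, Metric.continuousAt_iff'.1 hc 1 one_pos] with w hw hb
  rw [dist_eq_norm] at hb
  refine sub_eq_zero.1 (eq_zero_of_exp_eq_one ?_ hb)
  rw [Complex.exp_sub, exp_windingIntegral hγ hγ' hz hab,
    exp_windingIntegral hγ hγ' (fun t ht => hw ⟨t, ht⟩) hab, div_one]

lemma windingIntegral_eq_zero_of_large (hγ : ∀ t, HasDerivAt γ (γ' t) t) (hγ' : Continuous γ')
    (hab : γ a = γ b) (hK : IsCompact (Set.range γ)) :
    ∃ C : ℝ, ∀ z, C ≤ ‖z‖ → windingIntegral γ γ' a b z = 0 := by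
  obtain ⟨M, hM⟩ := (isCompact_uIcc (a := a) (b := b)).exists_bound_of_continuousOn
    hγ'.continuousOn
  obtain ⟨B, hB⟩ := hK.isBounded.exists_norm_le
  have hM0 : 0 ≤ M := (norm_nonneg _).trans (hM a Set.left_mem_uIcc)
  refine ⟨B + (M * |b - a| + 1), fun z hz => ?_⟩
  have hpos : 0 < M * |b - a| + 1 := by positivity
  have hdist : ∀ t, M * |b - a| + 1 ≤ ‖γ t - z‖ := by
    intro t
    have h1 := norm_sub_norm_le z (γ t)
    rw [norm_sub_rev] at h1
    have h2 := hB _ (Set.mem_range_self t)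
    linarith
  have hne : ∀ t, γ t ≠ z := fun t h => by
    have := hdist t
    simp [h] at this; linarith
  refine eq_zero_of_exp_eq_one (exp_windingIntegral hγ hγ' hne hab) ?_
  have h1 : ‖windingIntegral γ γ' a b z‖ ≤ M / (M * |b - a| + 1) * |b - a| := by
    refine intervalIntegral.norm_integral_le_of_norm_le_const fun t ht => ?_
    rw [norm_div]
    exact div_le_div₀ hM0 (hM t (Set.uIoc_subset_uIcc ht)) hpos (hdist t)
  refine h1.trans_lt ?_
  rw [div_mul_eq_mul_div, div_lt_one hpos]
  linarith

lemma log_sub_log_neg_of_im_pos {w : ℂ} (h : 0 < w.im) :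
    Complex.log w - Complex.log (-w) = Real.pi * Complex.I := by
  rw [Complex.log, Complex.log, norm_neg, Complex.arg_neg_eq_arg_sub_pi_of_im_pos h]
  push_cast; ring

/-- When `z` crosses the path from left to right at a simple point, the winding integral jumps by
`2πi`: close to that point `dζ / (ζ - z)` has a primitive, with branch cut on the left for the
points `z` on the left and on the right for those on the right. -/
theorem tendsto_windingIntegral_sub (hγ : ∀ t, HasDerivAt γ (γ' t) t) (hγ' : Continuous γ')
    {t₀ : ℝ} (ha : a < t₀) (hb : t₀ < b) (hv : γ' t₀ ≠ 0)
    (hs : ∀ t ∈ Set.Icc a b, t ≠ t₀ → γ t ≠ γ t₀) :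
    Tendsto (fun ε : ℝ => windingIntegral γ γ' a b (γ t₀ + ε * Complex.I * γ' t₀) -
      windingIntegral γ γ' a b (γ t₀ - ε * Complex.I * γ' t₀)) (𝓝[>] 0)
      (𝓝 (2 * Real.pi * Complex.I)) := by
  have hγc : Continuous γ := continuous_iff_continuousAt.2 fun t => (hγ t).continuousAt
  set v := γ' t₀ with hvdef
  set g : ℝ → ℂ := fun t => (γ t - γ t₀) / v with hg
  have hgd : ∀ t, HasDerivAt g (γ' t / v) t := fun t => ((hγ t).sub_const _).div_const v
  have hg0 : g t₀ = 0 := by simp [hg]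
  have hre : HasDerivAt (fun t => (g t).re) 1 t₀ := by
    have h1 := hgd t₀
    rw [div_self hv] at h1
    have h2 := Complex.reCLM.hasFDerivAt.comp_hasDerivAt t₀ h1
    rw [Complex.reCLM_apply, Complex.one_re] at h2
    exact h2
  have hsign : ∀ᶠ t in 𝓝[≠] t₀, 0 < (t - t₀) * (g t).re := by
    have h1 := hasDerivAt_iff_tendsto_slope.1 hre
    filter_upwards [h1.eventually (lt_mem_nhds one_pos), self_mem_nhdsWithin] with t h2 h3
    rw [slope_def_field, hg0, Complex.zero_re, sub_zero] at h2
    have h4 : t - t₀ ≠ 0 := sub_ne_zero.2 h3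
    have h5 : (t - t₀) * (g t).re = (g t).re / (t - t₀) * (t - t₀) ^ 2 := by field_simp
    rw [h5]; positivity
  rw [eventually_nhdsWithin_iff, Metric.eventually_nhds_iff_ball] at hsign
  obtain ⟨r, hr, hsr⟩ := hsign
  obtain ⟨δ, hδ, hδr, hδa, hδb⟩ : ∃ δ > 0, δ < r ∧ a < t₀ - δ ∧ t₀ + δ < b := by
    refine ⟨min (r / 2) (min ((t₀ - a) / 2) ((b - t₀) / 2)), ?_, ?_, ?_, ?_⟩
    · simp only [gt_iff_lt, lt_min_iff]; exact ⟨by linarith, by linarith, by linarith⟩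
    · linarith [min_le_left (r / 2) (min ((t₀ - a) / 2) ((b - t₀) / 2))]
    · linarith [min_le_right (r / 2) (min ((t₀ - a) / 2) ((b - t₀) / 2)),
        min_le_left ((t₀ - a) / 2) ((b - t₀) / 2)]
    · linarith [min_le_right (r / 2) (min ((t₀ - a) / 2) ((b - t₀) / 2)),
        min_le_right ((t₀ - a) / 2) ((b - t₀) / 2)]
  have hsgn : ∀ t ∈ Set.Icc (t₀ - δ) (t₀ + δ), t ≠ t₀ → 0 < (t - t₀) * (g t).re := by
    intro t ht hne
    refine hsr t ?_ hne
    rw [Metric.mem_ball, Real.dist_eq, abs_lt]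
    constructor <;> linarith [ht.1, ht.2]
  have hp : 0 < (g (t₀ + δ)).re := by
    have := hsgn (t₀ + δ) ⟨by linarith, le_rfl⟩ (by linarith)
    rw [add_sub_cancel_left] at this
    exact (mul_pos_iff_of_pos_left hδ).1 this
  have hm : (g (t₀ - δ)).re < 0 := by
    have := hsgn (t₀ - δ) ⟨le_rfl, by linarith⟩ (by linarith)
    nlinarith
  -- The contribution of the arc close to the crossing, for the point `γ t₀ + s * ε * I * v`.
  have hinner : ∀ s : ℂ, (s = 1 ∨ s = -1) → ∀ ε : ℝ, 0 < ε →
      (∀ t ∈ Set.uIcc (t₀ - δ) (t₀ + δ), γ t ≠ γ t₀ + s * (ε * Complex.I * v)) ∧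
      windingIntegral γ γ' (t₀ - δ) (t₀ + δ) (γ t₀ + s * (ε * Complex.I * v)) =
        Complex.log (s * Complex.I * g (t₀ + δ) + ε) -
          Complex.log (s * Complex.I * g (t₀ - δ) + ε) := by
    intro s hs1 ε hε
    have hss : s * s = 1 := by rcases hs1 with rfl | rfl <;> norm_num
    have hs0 : s ≠ 0 := by rintro rfl; simp at hss
    have hslit : ∀ t ∈ Set.uIcc (t₀ - δ) (t₀ + δ),
        s * Complex.I * g t + ε ∈ Complex.slitPlane := by
      intro t ht
      rw [Set.uIcc_of_le (by linarith)] at ht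
      by_cases h : t = t₀
      · left
        simpa [h, hg0] using hε
      · right
        have h1 := hsgn t ht h
        have h2 : (g t).re ≠ 0 := fun h2 => by simp [h2] at h1
        rcases hs1 with rfl | rfl <;> simpa using h2
    have hrel : ∀ t, γ t - (γ t₀ + s * (ε * Complex.I * v)) =
        (s * Complex.I * g t + ε) * (-(s * Complex.I) * v) := by
      intro t
      simp only [hg]
      field_simp
      linear_combination (-(γ t - γ t₀)) * (hss - s ^ 2 * Complex.I_sq)
    have hI0 : -(s * Complex.I) * v ≠ 0 := by simp [hs0, hv]
    have hne : ∀ t ∈ Set.uIcc (t₀ - δ) (t₀ + δ), γ t ≠ γ t₀ + s * (ε * Complex.I * v) := by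
      intro t ht
      rw [← sub_ne_zero, hrel]
      exact mul_ne_zero (Complex.slitPlane_ne_zero (hslit t ht)) hI0
    refine ⟨hne, ?_⟩
    refine intervalIntegral.integral_eq_sub_of_hasDerivAt
      (f := fun t => Complex.log (s * Complex.I * g t + ε)) (fun t ht => ?_)
      (intervalIntegrable_winding hγc hγ' hne)
    have h1 := (((hgd t).const_mul (s * Complex.I)).add_const (ε : ℂ)).clog_real (hslit t ht)
    refine h1.congr_deriv ?_
    rw [hrel]
    have h2 := Complex.slitPlane_ne_zero (hslit t ht)
    rw [div_eq_div_iff h2 (mul_ne_zero h2 hI0)]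
    field_simp
    linear_combination γ' t * (hss - s ^ 2 * Complex.I_sq)
  have hlim : ∀ s : ℂ, Tendsto (fun ε : ℝ => γ t₀ + s * (ε * Complex.I * v)) (𝓝[>] 0)
      (𝓝 (γ t₀)) := by
    intro s
    have : Continuous fun ε : ℝ => γ t₀ + s * (ε * Complex.I * v) := by fun_prop
    have h2 := this.tendsto 0
    simp only [Complex.ofReal_zero, zero_mul, mul_zero, add_zero] at h2
    exact h2.mono_left nhdsWithin_le_nhds
  have hout1 : ∀ t ∈ Set.uIcc a (t₀ - δ), γ t ≠ γ t₀ := fun t ht => by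
    rw [Set.uIcc_of_le hδa.le] at ht
    exact hs t ⟨ht.1, by linarith [ht.2]⟩ (by linarith [ht.2])
  have hout2 : ∀ t ∈ Set.uIcc (t₀ + δ) b, γ t ≠ γ t₀ := fun t ht => by
    rw [Set.uIcc_of_le hδb.le] at ht
    exact hs t ⟨by linarith [ht.1], ht.2⟩ (by linarith [ht.1])
  have hT1 : ∀ s : ℂ, Tendsto (fun ε : ℝ => windingIntegral γ γ' a (t₀ - δ)
      (γ t₀ + s * (ε * Complex.I * v))) (𝓝[>] 0)
      (𝓝 (windingIntegral γ γ' a (t₀ - δ) (γ t₀))) := fun s =>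
    (continuousAt_windingIntegral hγc hγ' hout1).tendsto.comp (hlim s)
  have hT2 : ∀ s : ℂ, Tendsto (fun ε : ℝ => windingIntegral γ γ' (t₀ + δ) b
      (γ t₀ + s * (ε * Complex.I * v))) (𝓝[>] 0)
      (𝓝 (windingIntegral γ γ' (t₀ + δ) b (γ t₀))) := fun s =>
    (continuousAt_windingIntegral hγc hγ' hout2).tendsto.comp (hlim s)
  have hav : ∀ s : ℂ, ∀ (c d : ℝ), (∀ t ∈ Set.uIcc c d, γ t ≠ γ t₀) → ∀ᶠ ε : ℝ in 𝓝[>] 0,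
      ∀ t ∈ Set.uIcc c d, γ t ≠ γ t₀ + s * (ε * Complex.I * v) := by
    intro s c d h
    have hK : IsCompact (γ '' Set.uIcc c d) := isCompact_uIcc.image hγc
    have h1 : γ t₀ ∉ γ '' Set.uIcc c d := by rintro ⟨t, ht, h'⟩; exact h t ht h'
    filter_upwards [(hlim s).eventually (hK.isClosed.isOpen_compl.mem_nhds h1)] with ε hε t ht h'
    exact hε ⟨t, ht, h'⟩
  have hlog : ∀ (s : ℂ) (t : ℝ), (s = 1 ∨ s = -1) → (g t).re ≠ 0 →
      Tendsto (fun ε : ℝ => Complex.log (s * Complex.I * g t + ε)) (𝓝[>] 0)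
        (𝓝 (Complex.log (s * Complex.I * g t))) := by
    intro s t hs1 h
    have h1 : Continuous fun ε : ℝ => s * Complex.I * g t + (ε : ℂ) := by fun_prop
    have h2 := h1.tendsto 0
    simp only [Complex.ofReal_zero, add_zero] at h2
    refine (h2.mono_left nhdsWithin_le_nhds).clog (Or.inr ?_)
    rcases hs1 with rfl | rfl <;> simpa using h
  have hW : ∀ s : ℂ, (s = 1 ∨ s = -1) → Tendsto (fun ε : ℝ => windingIntegral γ γ' a b
      (γ t₀ + s * (ε * Complex.I * v))) (𝓝[>] 0)
      (𝓝 (windingIntegral γ γ' a (t₀ - δ) (γ t₀) +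
        (Complex.log (s * Complex.I * g (t₀ + δ)) - Complex.log (s * Complex.I * g (t₀ - δ))) +
        windingIntegral γ γ' (t₀ + δ) b (γ t₀))) := by
    intro s hs1
    refine (((hT1 s).add ((hlog s _ hs1 hp.ne').sub (hlog s _ hs1 hm.ne))).add (hT2 s)).congr' ?_
    filter_upwards [hav s _ _ hout1, hav s _ _ hout2, self_mem_nhdsWithin] with ε h1 h2 h3
    obtain ⟨h4, h5⟩ := hinner s hs1 ε h3
    have i1 := intervalIntegrable_winding hγc hγ' h1
    have i2 := intervalIntegrable_winding hγc hγ' h4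
    have i3 := intervalIntegrable_winding hγc hγ' h2
    rw [← h5]
    simp only [windingIntegral]
    rw [intervalIntegral.integral_add_adjacent_intervals i1 i2,
      intervalIntegral.integral_add_adjacent_intervals (i1.trans i2) i3]
  have hfin := (hW 1 (Or.inl rfl)).sub (hW (-1) (Or.inr rfl))
  have e1 := log_sub_log_neg_of_im_pos (w := Complex.I * g (t₀ + δ)) (by simpa using hp)
  have e2 := log_sub_log_neg_of_im_pos (w := -(Complex.I * g (t₀ - δ))) (by simpa using hm)
  rw [neg_neg] at e2
  convert hfin using 2
  · simp only [one_mul, neg_mul, sub_eq_add_neg]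
  · simp only [one_mul, neg_mul]
    linear_combination -e1 - e2

end Winding

/-! ### A polygon does not lie on both sides of the curve -/

/-- The stereographic projection from `b` to the complex plane, and its inverse. -/
lemma exists_stereographic {b : E3} (hb : b ∈ sphere2) : ∃ (S : E3 → ℂ) (R : ℂ → E3),
    ContDiff ℝ ∞ R ∧ (∀ z, R z ∈ sphere2 ∧ R z ≠ b) ∧ (∀ z, S (R z) = z) ∧
    (∀ x ∈ sphere2, x ≠ b → R (S x) = x) ∧ ∀ x ∈ sphere2, x ≠ b → ContDiffAt ℝ ∞ S x := by
  have hb1 := norm_of_mem_sphere2 hb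
  have hb0 : b ≠ 0 := fun h => by simp [h] at hb1
  have : Fact (Module.finrank ℝ E3 = 2 + 1) := ⟨by simp⟩
  have hrank : Module.finrank ℝ (ℝ ∙ b)ᗮ = Module.finrank ℝ ℂ := by
    rw [Submodule.finrank_orthogonal_span_singleton (n := 2) hb0, Complex.finrank_real_complex]
  let e : (ℝ ∙ b)ᗮ ≃L[ℝ] ℂ := ContinuousLinearEquiv.ofFinrankEq hrank
  refine ⟨fun x => e (stereoToFun b x), fun z => (stereoInvFun hb1 (e.symm z) : E3),
    ?_, ?_, ?_, ?_, ?_⟩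
  · exact (contDiff_stereoInvFunAux (v := b)).comp
      ((ℝ ∙ b)ᗮ.subtypeL.contDiff.comp e.symm.contDiff)
  · intro z
    refine ⟨(stereoInvFun hb1 (e.symm z)).2, fun h => ?_⟩
    exact stereoInvFun_ne_north_pole hb1 (e.symm z) (Subtype.ext h)
  · intro z
    simp only [stereo_right_inv, e.apply_symm_apply]
  · intro x hx hne
    simp only [e.symm_apply_apply]
    exact congrArg Subtype.val (stereo_left_inv hb1 (x := ⟨x, hx⟩) hne)
  · intro x hx hne
    have hx1 := norm_of_mem_sphere2 hx
    have h1 : innerSL ℝ b x ≠ (1 : ℝ) := by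
      rw [innerSL_apply_apply]
      exact fun h => hne ((inner_eq_one_iff_of_norm_eq_one hb1 hx1).1 h).symm
    have hopen : IsOpen {x : E3 | innerSL ℝ b x ≠ (1 : ℝ)} :=
      isOpen_ne_fun (innerSL ℝ b).continuous continuous_const
    exact e.contDiff.contDiffAt.comp x
      ((contDiffOn_stereoToFun (v := b)).contDiffAt (hopen.mem_nhds h1))

namespace KnotProjection

variable {P : KnotProjection}

/-- The polygons on the two sides of the curve at a simple point are different. If there were only
one such polygon `F`, project the sphere to the plane from a point `b` of `F`. The winding integral
of the curve is locally constant and vanishes near infinity, hence on all of `F`; but it jumps by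
`2πi` across the curve. -/
theorem not_onLeft_and_onRight {F : Set E3} {t : ℝ} (ht : t ∉ P.doubleParams) (hF : P.IsFace F) :
    ¬ (P.OnLeft F t ∧ P.OnRight F t) := by
  rintro ⟨hl, hr⟩
  obtain ⟨b, hb⟩ := hF.nonempty
  obtain ⟨S, R, hR, hRs, hSR, hRS, hS⟩ := exists_stereographic (hF.subset hb).1
  have hcb : ∀ s, P.curve s ≠ b := fun s h => (hF.subset hb).2 ⟨s, h⟩
  have hRc : ∀ s, R (S (P.curve s)) = P.curve s := fun s => hRS _ (P.mem_sphere s) (hcb s)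
  set γ : ℝ → ℂ := fun s => S (P.curve s) with hγ
  have hγs : ContDiff ℝ ∞ γ := contDiff_iff_contDiffAt.2 fun s =>
    (hS _ (P.mem_sphere s) (hcb s)).comp s P.smooth.contDiffAt
  have hγd : ∀ s, HasDerivAt γ (deriv γ s) s := fun s =>
    (hγs.differentiable (by simp) s).hasDerivAt
  have hγ' : Continuous (deriv γ) := hγs.continuous_deriv (by simp)
  have hab : γ (t - Real.pi) = γ (t + Real.pi) := by
    simp only [hγ]
    rw [P.curve_eq_of_sameParam (s := t - Real.pi) (t := t + Real.pi) ⟨1, by push_cast; ring⟩]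
  have hrange : Set.range γ = S '' P.image := by
    rw [KnotProjection.image, ← Set.range_comp]; rfl
  have hK : IsCompact (Set.range γ) := by
    rw [hrange]
    refine P.isCompact_image.image_of_continuousOn ?_
    rintro _ ⟨s, rfl⟩
    exact (hS _ (P.mem_sphere s) (hcb s)).continuousAt.continuousWithinAt
  have hRd : ∀ z, HasFDerivAt R (fderiv ℝ R z) z := fun z =>
    (hR.differentiable (by simp) z).hasFDerivAt
  have hcd : deriv P.curve t = fderiv ℝ R (γ t) (deriv γ t) := by
    have h1 := (hRd (γ t)).comp_hasDerivAt t (hγd t)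
    have h2 : R ∘ γ = P.curve := by ext1 s; exact hRc s
    rw [h2] at h1
    exact h1.deriv
  set v := deriv γ t with hv
  have hv0 : v ≠ 0 := fun h => P.immersion t (by rw [hcd, h, map_zero])
  have hγne : ∀ x ∈ sphere2 \ P.image, ∀ s, γ s ≠ S x ∨ x = b := by
    intro x hx s
    by_contra! h
    refine hx.2 ⟨s, ?_⟩
    rw [← hRc s, ← hRS x hx.1 h.2]
    exact congrArg R h.1
  -- The winding integral as a function on the polygon, with the value 0 at `b`.
  classical
  set W := windingIntegral γ (deriv γ) (t - Real.pi) (t + Real.pi) with hW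
  set J : E3 → ℂ := fun x => if x = b then 0 else W (S x) with hJ
  obtain ⟨C, hC⟩ := windingIntegral_eq_zero_of_large hγd hγ' hab hK
  have hJ0 : ∀ x ∈ F, J x = J b := by
    intro x hx
    refine hF.isPreconnected.induction₂ (fun x y => J y = J x) (fun x hx => ?_)
      (fun x y z _ _ _ h1 h2 => h2.trans h1) (fun x y _ _ h => h.symm) hb hx
    by_cases hxb : x = b
    · subst hxb
      have hcomp : IsCompact (R '' Metric.closedBall 0 C) :=
        (isCompact_closedBall 0 C).image hR.continuous
      have hxn : x ∉ R '' Metric.closedBall 0 C := by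
        rintro ⟨z, -, h⟩; exact (hRs z).2 h
      filter_upwards [mem_nhdsWithin_of_mem_nhds (hcomp.isClosed.isOpen_compl.mem_nhds hxn),
        self_mem_nhdsWithin] with y hy hyF
      by_cases hyx : y = x
      · rw [hyx]
      · simp only [hJ, hyx, if_false, if_true]
        refine hC _ (le_of_not_ge fun h => hy ⟨S y, ?_, hRS y (hF.subset hyF).1 hyx⟩)
        simpa using h
    · have hxs := hF.subset hx
      have h1 := windingIntegral_eventually_eq hγd hγ' hab hK.isClosed
        (fun s => ((hγne x hxs s).resolve_right hxb))
      have h2 := (hS x hxs.1 hxb).continuousAt.tendsto.eventually h1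
      filter_upwards [mem_nhdsWithin_of_mem_nhds h2,
        mem_nhdsWithin_of_mem_nhds (isOpen_ne.mem_nhds hxb)] with y hy hyb
      simp only [hJ, hxb, hyb, if_false]
      exact hy
  have hWF : ∀ z, R z ∈ F → W z = 0 := by
    intro z hz
    have h1 := hJ0 _ hz
    simp only [hJ, (hRs z).2, if_false, if_true] at h1
    rwa [hSR] at h1
  -- A path crossing the curve transversally at `P.curve t`.
  set w := fderiv ℝ R (γ t) (Complex.I * v) with hw
  have hpath : ∀ a : ℝ, HasDerivAt (fun ε : ℝ => R (γ t + a * (ε * Complex.I * v))) (a • w) 0 := by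
    intro a
    have h1 : HasDerivAt (fun ε : ℝ => γ t + a * (ε * Complex.I * v)) (a * (Complex.I * v)) 0 := by
      have h2 : HasDerivAt (fun ε : ℝ => (ε : ℂ)) 1 0 := Complex.ofRealCLM.hasDerivAt
      have h3 := (((h2.mul_const Complex.I).mul_const v).const_mul (a : ℂ)).const_add (γ t)
      simpa using h3
    have h4 : HasFDerivAt R (fderiv ℝ R (γ t)) (γ t + a * (((0 : ℝ) : ℂ) * Complex.I * v)) := by
      simpa using hRd (γ t)
    refine (h4.comp_hasDerivAt (0 : ℝ) h1).congr_deriv ?_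
    rw [hw, ← map_smul, Complex.real_smul]
  have hw0 : inner ℝ (P.curve t) w = 0 := by
    have h1 := inner_deriv_eq_zero (Eventually.of_forall fun ε => (hRs _).1) (hpath 1)
    rw [one_smul] at h1
    rw [← hRc t]
    simpa using h1
  have htr : triple (P.curve t) (deriv P.curve t) w ≠ 0 := by
    intro h
    obtain ⟨c, hc⟩ := exists_smul_eq_of_triple_eq_zero (P.norm_curve t) (P.inner_curve_deriv t)
      hw0 (P.immersion t) h
    rw [hcd, hw, ← map_smul] at hc
    have hinj : ∀ u, fderiv ℝ S (P.curve t) (fderiv ℝ R (γ t) u) = u := by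
      intro u
      have h1 : HasFDerivAt S (fderiv ℝ S (P.curve t)) (R (γ t)) := by
        rw [hRc t]
        exact ((hS _ (P.mem_sphere t) (hcb t)).differentiableAt (by simp)).hasFDerivAt
      have h2 := h1.comp (γ t) (hRd (γ t))
      have h3 : S ∘ R = id := by ext1 z; exact hSR z
      rw [h3] at h2
      exact congrArg (fun L => L u) (h2.unique (hasFDerivAt_id _))
    have h2 := (hinj (Complex.I * v)).symm.trans ((congrArg _ hc).trans (hinj (c • v)))
    rw [Complex.real_smul] at h2
    have h3 := mul_right_cancel₀ hv0 h2
    simpa using congrArg Complex.im h3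
  have hmem : ∀ a : ℝ, a ≠ 0 → ∀ᶠ ε : ℝ in 𝓝[>] 0, R (γ t + a * (ε * Complex.I * v)) ∈ F := by
    intro a ha
    have hc0 : R (γ t + a * (((0 : ℝ) : ℂ) * Complex.I * v)) = P.curve t := by
      simp only [Complex.ofReal_zero, zero_mul, mul_zero, add_zero]; exact hRc t
    have hne : triple (P.curve t) (deriv P.curve t) (a • w) ≠ 0 := by
      rw [triple_smul_right]; exact mul_ne_zero ha htr
    rcases lt_or_gt_of_ne hne with h | h
    · exact (onRight_iff_of_path ht hF (c := fun ε : ℝ => R (γ t + a * (ε * Complex.I * v)))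
        (fun ε => (hRs _).1) hc0 (hpath a) h).1 hr
    · exact (onLeft_iff_of_path ht hF (c := fun ε : ℝ => R (γ t + a * (ε * Complex.I * v)))
        (fun ε => (hRs _).1) hc0 (hpath a) h).1 hl
  have hjump := tendsto_windingIntegral_sub (a := t - Real.pi) (b := t + Real.pi) hγd hγ'
    (t₀ := t) (by linarith [Real.pi_pos]) (by linarith [Real.pi_pos]) hv0 (by
      intro s hs hne h
      have h1 : P.curve s = P.curve t := by rw [← hRc s, ← hRc t]; exact congrArg R h
      refine hne ((sameParam_of_curve_eq ht h1).symm.eq_of_abs_lt ?_)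
      rw [abs_lt]; constructor <;> linarith [hs.1, hs.2, Real.pi_pos])
  have hzero : Tendsto (fun ε : ℝ => W (γ t + ε * Complex.I * v) - W (γ t - ε * Complex.I * v))
      (𝓝[>] 0) (𝓝 0) := by
    refine tendsto_const_nhds.congr' ?_
    filter_upwards [hmem 1 one_ne_zero, hmem (-1) (by norm_num)] with ε h1 h2
    have e1 := hWF _ h1
    have e2 := hWF _ h2
    simp only [Complex.ofReal_one, one_mul, Complex.ofReal_neg, neg_mul, ← sub_eq_add_neg] at e1 e2
    rw [e1, e2, sub_zero]
  have := tendsto_nhds_unique hjump hzero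
  simp [Real.pi_ne_zero] at this

end KnotProjection

namespace KnotProjection

/-! ### Coherence in terms of the two sides -/

variable {P : KnotProjection} {F : Set E3}

lemma isCoherent_iff (hF : P.IsFace F) : P.IsCoherent F ↔
    (∀ t, t ∉ P.doubleParams → ¬ P.OnRight F t) ∨
      (∀ t, t ∉ P.doubleParams → ¬ P.OnLeft F t) := by
  refine or_congr (forall₂_congr fun t ht => ?_) (forall₂_congr fun t ht => ?_) <;>
  · rw [curve_mem_closure_iff ht hF]
    have := not_onLeft_and_onRight ht hF
    tauto

lemma eventually_onLeft_iff {t : ℝ} (ht : t ∉ P.doubleParams) (hF : P.IsFace F) :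
    ∀ᶠ s in 𝓝 t, (P.OnLeft F s ↔ P.OnLeft F t) := by
  obtain ⟨G, hG, h⟩ := exists_onLeft ht
  filter_upwards [h.eventually ht hG] with s hs
  constructor
  · intro h1; rwa [h1.eq hF hG hs]
  · intro h1; rwa [h1.eq hF hG h]

lemma eventually_onRight_iff {t : ℝ} (ht : t ∉ P.doubleParams) (hF : P.IsFace F) :
    ∀ᶠ s in 𝓝 t, (P.OnRight F s ↔ P.OnRight F t) := by
  obtain ⟨G, hG, h⟩ := exists_onRight ht
  filter_upwards [h.eventually ht hG] with s hs
  constructor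
  · intro h1; rwa [h1.eq hF hG hs]
  · intro h1; rwa [h1.eq hF hG h]

lemma eventually_curve_mem_closure_iff {t : ℝ} (ht : t ∉ P.doubleParams) (hF : P.IsFace F) :
    ∀ᶠ s in 𝓝 t, (P.curve s ∈ closure F ↔ P.curve t ∈ closure F) := by
  filter_upwards [eventually_onLeft_iff ht hF, eventually_onRight_iff ht hF,
    eventually_notMem_doubleParams_nhds ht] with s h1 h2 h3
  rw [curve_mem_closure_iff ht hF, curve_mem_closure_iff h3 hF, h1, h2]

lemma curve_mem_closure_iff_of_Ioo {a b : ℝ} (hab : ∀ t ∈ Set.Ioo a b, t ∉ P.doubleParams)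
    (hF : P.IsFace F) {s t : ℝ} (hs : s ∈ Set.Ioo a b) (ht : t ∈ Set.Ioo a b) :
    P.curve s ∈ closure F ↔ P.curve t ∈ closure F := by
  refine (isPreconnected_Ioo (a := a) (b := b)).induction₂
    (fun s t => (P.curve s ∈ closure F ↔ P.curve t ∈ closure F)) (fun x hx => ?_)
    (fun x y z _ _ _ h1 h2 => h1.trans h2) (fun x y _ _ h => h.symm) hs ht
  filter_upwards [mem_nhdsWithin_of_mem_nhds (eventually_curve_mem_closure_iff (hab x hx) hF)]
    with y hy using hy.symm

/-! ### Counting the sides of a polygon -/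

/-- The parameters of double points at which the curve starts to run along the boundary of `F`. -/
def startSet (P : KnotProjection) (F : Set E3) : Set ℝ :=
  {a | a ∈ P.doubleParams ∧ ∀ᶠ s in 𝓝[>] a, P.curve s ∈ closure F}

lemma _root_.sameParam_iff_coe_eq {s t : ℝ} :
    SameParam s t ↔ (s : AddCircle (2 * Real.pi)) = t := by
  rw [eq_comm, ← sub_eq_zero, ← AddCircle.coe_sub, AddCircle.coe_eq_zero_iff]
  refine exists_congr fun n => ?_
  rw [zsmul_eq_mul]
  constructor <;> intro h <;> linarith

lemma exists_next {a : ℝ} (ha : a ∈ P.doubleParams) :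
    ∃ b, a < b ∧ b ∈ P.doubleParams ∧ ∀ t ∈ Set.Ioo a b, t ∉ P.doubleParams := by
  have hp := Real.two_pi_pos
  have hne : ((P.doubleParams ∩ Set.Icc a (a + 2 * Real.pi)) \ {a}).Nonempty := by
    refine ⟨a + 2 * Real.pi, ⟨?_, by linarith, le_rfl⟩, by simp [Real.pi_ne_zero]⟩
    simpa using (P.add_int_mem_doubleParams a 1).2 ha
  obtain ⟨b, ⟨⟨hb, hab, hb2⟩, hba⟩, hmin⟩ := Set.exists_min_image _ id
    ((P.finite_doubleParams_Icc a (a + 2 * Real.pi)).sdiff (t := {a})) hne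
  refine ⟨b, lt_of_le_of_ne hab (Ne.symm hba), hb, fun t ht htd => ?_⟩
  exact absurd (hmin t ⟨⟨htd, ht.1.le, by linarith [ht.2]⟩, ht.1.ne'⟩) (not_le.2 ht.2)

/-- Consecutive parameters of double points. -/
def IsNext (P : KnotProjection) (a b : ℝ) : Prop :=
  a < b ∧ b ∈ P.doubleParams ∧ ∀ t ∈ Set.Ioo a b, t ∉ P.doubleParams

lemma IsNext.eq {a b c : ℝ} (hb : P.IsNext a b) (hc : P.IsNext a c) : b = c := by
  rcases lt_trichotomy b c with h | h | h
  · exact absurd hb.2.1 (hc.2.2 b ⟨hb.1, h⟩)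
  · exact h
  · exact absurd hc.2.1 (hb.2.2 c ⟨hc.1, h⟩)

lemma IsNext.add_int {a b : ℝ} (h : P.IsNext a b) (n : ℤ) :
    P.IsNext (a + 2 * Real.pi * n) (b + 2 * Real.pi * n) := by
  refine ⟨by linarith [h.1], (P.add_int_mem_doubleParams b n).2 h.2.1, fun t ht htd => ?_⟩
  refine h.2.2 (t - 2 * Real.pi * n) ⟨by linarith [ht.1], by linarith [ht.2]⟩ ?_
  exact mem_doubleParams_of_sameParam ⟨-n, by push_cast; ring⟩ htd

lemma IsNext.sameParam {a b a' b' : ℝ} (ha : a ∈ P.doubleParams) (ha' : a' ∈ P.doubleParams)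
    (h : P.IsNext a b) (h' : P.IsNext a' b')
    (he : P.curve '' Set.Ioo a b = P.curve '' Set.Ioo a' b') : SameParam a a' := by
  obtain ⟨m, hm⟩ := Set.nonempty_Ioo.2 h.1
  obtain ⟨m', hm', hmm⟩ : P.curve m ∈ P.curve '' Set.Ioo a' b' := he ▸ ⟨m, hm, rfl⟩
  obtain ⟨n, hn⟩ := (sameParam_of_curve_eq (h.2.2 m hm) hmm).symm
  have had := (P.add_int_mem_doubleParams a n).2 ha
  refine ⟨n, le_antisymm ?_ ?_⟩
  · by_contra! hlt
    refine h.2.2 (a' - 2 * Real.pi * n) ⟨by linarith, ?_⟩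
      (mem_doubleParams_of_sameParam ⟨-n, by push_cast; ring⟩ ha')
    linarith [hm'.1, hm.2]
  · by_contra! hlt
    exact h'.2.2 _ ⟨hlt, by linarith [hm.1, hm'.2]⟩ had

lemma _root_.Set.ncard_image_eq_ncard_image {α β γ : Type*} {s : Set α} {f : α → β} {g : α → γ}
    (h : ∀ x ∈ s, ∀ y ∈ s, f x = f y ↔ g x = g y) : (f '' s).ncard = (g '' s).ncard := by
  have hx : ∀ b ∈ f '' s, ∃ x ∈ s, f x = b := fun b hb => hb
  choose r hrs hrf using hx
  refine Set.ncard_congr (fun b hb => g (r b hb)) (fun b hb => ⟨r b hb, hrs b hb, rfl⟩) ?_ ?_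
  · intro b c hb hc hbc
    rw [← hrf b hb, ← hrf c hc]
    exact (h _ (hrs b hb) _ (hrs c hc)).2 hbc
  · rintro _ ⟨x, hxs, rfl⟩
    have hb : f x ∈ f '' s := ⟨x, hxs, rfl⟩
    exact ⟨f x, hb, (h _ (hrs _ hb) _ hxs).1 (hrf _ hb)⟩

/-- Every side of `F` has a well-defined starting point on the circle, so that the sides can be
counted by these points. -/
theorem ncard_sides (hF : P.IsFace F) : (P.sides F).ncard =
    ((fun a : ℝ => (a : AddCircle (2 * Real.pi))) '' P.startSet F).ncard := by
  have hn : ∀ a ∈ P.doubleParams, ∃ b, P.IsNext a b := fun a ha => exists_next ha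
  choose! nxt hnxt using hn
  have hsides : P.sides F = (fun a => P.curve '' Set.Ioo a (nxt a)) '' P.startSet F := by
    ext E
    constructor
    · rintro ⟨⟨a, b, hab, ha, hb, hI, rfl⟩, hE⟩
      refine ⟨a, ⟨ha, ?_⟩, ?_⟩
      · filter_upwards [Ioo_mem_nhdsGT hab] with s hs using hE ⟨s, hs, rfl⟩
      · simp only [(hnxt a ha).eq ⟨hab, hb, hI⟩]
    · rintro ⟨a, ⟨ha, hs⟩, rfl⟩
      obtain ⟨h1, h2, h3⟩ := hnxt a ha
      refine ⟨⟨a, nxt a, h1, ha, h2, h3, rfl⟩, ?_⟩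
      obtain ⟨s, hs1, hs2⟩ := (hs.and (Ioo_mem_nhdsGT h1)).exists
      rintro _ ⟨t, ht, rfl⟩
      exact (curve_mem_closure_iff_of_Ioo h3 hF hs2 ht).1 hs1
  rw [hsides]
  refine Set.ncard_image_eq_ncard_image fun a ha a' ha' => ?_
  rw [← sameParam_iff_coe_eq]
  constructor
  · exact (hnxt a ha.1).sameParam ha.1 ha'.1 (hnxt a' ha'.1)
  · rintro ⟨n, rfl⟩
    rw [(hnxt _ ha'.1).eq ((hnxt a ha.1).add_int n)]
    ext x
    constructor
    · rintro ⟨t, ht, rfl⟩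
      exact ⟨t + 2 * Real.pi * n, ⟨by linarith [ht.1], by linarith [ht.2]⟩, P.curve_add_int t n⟩
    · rintro ⟨t, ht, rfl⟩
      exact ⟨t - 2 * Real.pi * n, ⟨by linarith [ht.1], by linarith [ht.2]⟩, P.curve_sub_int t n⟩

/-! ### The invariant -/

/-- A coherent polygon with an odd number of sides. -/
def IsOddCoherent (P : KnotProjection) (F : Set E3) : Prop :=
  P.IsFace F ∧ P.IsCoherent F ∧ Odd (P.sides F).ncard

lemma cohOdd_eq (P : KnotProjection) [Decidable (∃ F, P.IsOddCoherent F)] :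
    P.cohOdd = if ∃ F, P.IsOddCoherent F then 1 else 0 := by
  have h : P.oddCoherentNumber = 0 ↔ ¬ ∃ F, P.IsOddCoherent F := by
    rw [oddCoherentNumber, Set.encard_eq_zero, Set.eq_empty_iff_forall_notMem, not_exists]
    rfl
  unfold cohOdd
  by_cases h1 : ∃ F, P.IsOddCoherent F
  · rw [if_neg (by rw [h]; exact not_not.2 h1), if_pos h1]
  · rw [if_pos (h.2 h1), if_neg h1]

lemma cohOdd_eq_cohOdd {P P' : KnotProjection}
    (h : (∃ F, P.IsOddCoherent F) ↔ ∃ F, P'.IsOddCoherent F) : P.cohOdd = P'.cohOdd := by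
  classical
  rw [cohOdd_eq, cohOdd_eq]
  simp only [h]

end KnotProjection

lemma forall_pos_or_forall_neg {f : ℝ → ℝ} (hf : Continuous f) (h0 : ∀ t, f t ≠ 0) :
    (∀ t, 0 < f t) ∨ ∀ t, f t < 0 := by
  by_contra! h
  obtain ⟨⟨a, ha⟩, b, hb⟩ := h
  obtain ⟨c, hc⟩ := mem_range_of_exists_le_of_exists_ge hf ⟨a, ha⟩ ⟨b, hb⟩
  exact h0 c hc

namespace KnotProjection

/-! ### Reparametrizations and isotopies -/

lemma isOddCoherent_iff_of_reparam {P P' : KnotProjection} (h : P.Reparam P') (F : Set E3) :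
    P'.IsOddCoherent F ↔ P.IsOddCoherent F := by
  obtain ⟨r, hr, hr0, hper, hc⟩ := h
  have hrc : Continuous r := hr.continuous
  have hrd : ∀ t, HasDerivAt r (deriv r t) t := fun t =>
    (hr.differentiable (by simp) t).hasDerivAt
  obtain ⟨e, he, hper⟩ : ∃ e : ℤ, e * e = 1 ∧ ∀ (t : ℝ) (n : ℤ),
      r (t + 2 * Real.pi * n) = r t + 2 * Real.pi * ((e * n : ℤ) : ℝ) := by
    obtain ⟨e, he, h⟩ : ∃ e : ℤ, e * e = 1 ∧ ∀ t, r (t + 2 * Real.pi) = r t + 2 * Real.pi * e := by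
      rcases hper with h | h
      · exact ⟨1, by norm_num, fun t => by rw [h]; push_cast; ring⟩
      · exact ⟨-1, by norm_num, fun t => by rw [h]; push_cast; ring⟩
    refine ⟨e, he, fun t n => ?_⟩
    have hp : Function.Periodic (fun t => r t - e * t) (2 * Real.pi) := fun t => by
      simp only [h]; ring
    have := hp.int_mul n t
    rw [mul_comm (n : ℝ)] at this
    push_cast
    linarith
  have hsign := forall_pos_or_forall_neg (hr.continuous_deriv (by simp)) hr0
  have hmono : StrictMono r ∨ StrictAnti r := by
    rcases hsign with h | h
    · exact Or.inl (strictMono_of_deriv_pos h)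
    · exact Or.inr (strictAnti_of_deriv_neg h)
  have hinj : Function.Injective r := hmono.elim StrictMono.injective StrictAnti.injective
  have hsurj : Function.Surjective r := by
    intro y
    have hpi := Real.two_pi_pos
    obtain ⟨n, hn⟩ := exists_nat_gt (|y - r 0| / (2 * Real.pi))
    rw [div_lt_iff₀ hpi] at hn
    have h1 := hper 0 (e * n)
    have h2 := hper 0 (-(e * n))
    rw [mul_neg, ← mul_assoc, he] at h2
    rw [← mul_assoc, he] at h1
    push_cast at h1 h2
    exact mem_range_of_exists_le_of_exists_ge hrc
      ⟨_, by rw [h2]; linarith [neg_abs_le (y - r 0)]⟩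
      ⟨_, by rw [h1]; linarith [le_abs_self (y - r 0)]⟩
  have hsame : ∀ s t, SameParam (r s) (r t) ↔ SameParam s t := by
    intro s t
    constructor
    · rintro ⟨n, hn⟩
      refine ⟨e * n, hinj ?_⟩
      rw [hn, hper, ← mul_assoc, he, one_mul]
    · rintro ⟨n, rfl⟩
      exact ⟨e * n, hper s n⟩
  have hdbl : ∀ t, t ∈ P'.doubleParams ↔ r t ∈ P.doubleParams := by
    intro t
    constructor
    · rintro ⟨s, hs, hn⟩
      exact ⟨r s, by rw [← hc, ← hc, hs], fun h => hn ((hsame s t).1 h)⟩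
    · rintro ⟨s, hs, hn⟩
      obtain ⟨s, rfl⟩ := hsurj s
      exact ⟨s, by rw [hc, hc, hs], fun h => hn ((hsame s t).2 h)⟩
  have himage : P'.image = P.image := by
    have h1 : P'.curve = P.curve ∘ r := funext hc
    rw [image, h1, hsurj.range_comp]; rfl
  have hface : P'.IsFace F ↔ P.IsFace F := by
    unfold IsFace; rw [himage]
  have hderiv : ∀ t, deriv P'.curve t = deriv r t • deriv P.curve (r t) := by
    intro t
    have h1 := (P.hasDerivAt_curve (r t)).scomp t (hrd t)
    have h2 : P'.curve = P.curve ∘ r := funext hc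
    rw [h2]; exact h1.deriv
  have hnormal : ∀ t, P'.leftNormal t = (‖deriv r t‖⁻¹ * deriv r t) • P.leftNormal (r t) := by
    intro t
    rw [leftNormal, leftNormal, hderiv, hc, cross_smul_right, norm_smul, smul_smul, smul_smul,
      mul_inv]
    congr 1; ring
  have hcoh : P'.IsCoherent F ↔ P.IsCoherent F := by
    have hr1 : ∀ p : ℝ → Prop, (∀ t, p (r t)) ↔ ∀ t, p t := fun p => hsurj.forall.symm
    rcases hsign with h | h
    · have hN : ∀ t ε, P'.normalPoint t ε = P.normalPoint (r t) ε := by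
        intro t ε
        rw [normalPoint_eq, normalPoint_eq, hnormal, hc, Real.norm_of_nonneg (h t).le,
          inv_mul_cancel₀ (h t).ne', one_smul]
      unfold IsCoherent OnLeft OnRight
      simp only [hN, hdbl, hc]
      rw [hr1 fun t => t ∉ P.doubleParams → P.curve t ∈ closure F →
        ∀ᶠ ε in 𝓝[>] (0 : ℝ), P.normalPoint t ε ∈ F, hr1 fun t => t ∉ P.doubleParams →
        P.curve t ∈ closure F → ∀ᶠ ε in 𝓝[>] (0 : ℝ), P.normalPoint t (-ε) ∈ F]
    · have hN : ∀ t ε, P'.normalPoint t ε = P.normalPoint (r t) (-ε) := by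
        intro t ε
        rw [normalPoint_eq, normalPoint_eq, hnormal, hc, Real.norm_of_nonpos (h t).le,
          inv_neg, neg_mul, inv_mul_cancel₀ (h t).ne, Real.cos_neg, Real.sin_neg, smul_smul]
        simp
      unfold IsCoherent OnLeft OnRight
      simp only [hN, hdbl, hc, neg_neg]
      rw [hr1 fun t => t ∉ P.doubleParams → P.curve t ∈ closure F →
        ∀ᶠ ε in 𝓝[>] (0 : ℝ), P.normalPoint t ε ∈ F, hr1 fun t => t ∉ P.doubleParams →
        P.curve t ∈ closure F → ∀ᶠ ε in 𝓝[>] (0 : ℝ), P.normalPoint t (-ε) ∈ F, or_comm]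
  have hedge : ∀ E, P'.IsEdge E ↔ P.IsEdge E := by
    intro E
    have himg : ∀ a b : ℝ, P'.curve '' Set.Ioo a b = P.curve '' (r '' Set.Ioo a b) := fun a b => by
      rw [Set.image_image]; simp only [hc]
    have hnd : ∀ a b : ℝ, (∀ t ∈ Set.Ioo a b, t ∉ P'.doubleParams) ↔
        ∀ t ∈ r '' Set.Ioo a b, t ∉ P.doubleParams := fun a b => by
      rw [Set.forall_mem_image]; simp only [hdbl]
    rcases hmono with h | h
    · have hI : ∀ a b, r '' Set.Ioo a b = Set.Ioo (r a) (r b) := fun a b =>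
        (h.orderIsoOfSurjective r hsurj).image_Ioo a b
      constructor
      · rintro ⟨a, b, hab, ha, hb, hn, rfl⟩
        exact ⟨r a, r b, h hab, (hdbl a).1 ha, (hdbl b).1 hb, by rw [← hI]; exact (hnd a b).1 hn,
          by rw [himg, hI]⟩
      · rintro ⟨a, b, hab, ha, hb, hn, rfl⟩
        obtain ⟨a, rfl⟩ := hsurj a
        obtain ⟨b, rfl⟩ := hsurj b
        exact ⟨a, b, h.lt_iff_lt.1 hab, (hdbl a).2 ha, (hdbl b).2 hb,
          (hnd a b).2 (by rw [hI]; exact hn), by rw [himg, hI]⟩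
    · have hI : ∀ a b, r '' Set.Ioo a b = Set.Ioo (r b) (r a) := fun a b => by
        ext x
        obtain ⟨x, rfl⟩ := hsurj x
        rw [hinj.mem_set_image]
        simp only [Set.mem_Ioo, h.lt_iff_gt]
        exact and_comm
      constructor
      · rintro ⟨a, b, hab, ha, hb, hn, rfl⟩
        exact ⟨r b, r a, h hab, (hdbl b).1 hb, (hdbl a).1 ha, by rw [← hI]; exact (hnd a b).1 hn,
          by rw [himg, hI]⟩
      · rintro ⟨a, b, hab, ha, hb, hn, rfl⟩
        obtain ⟨a, rfl⟩ := hsurj a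
        obtain ⟨b, rfl⟩ := hsurj b
        exact ⟨b, a, h.lt_iff_gt.1 hab, (hdbl b).2 hb, (hdbl a).2 ha,
          (hnd b a).2 (by rw [hI]; exact hn), by rw [himg, hI]⟩
  have hsides : P'.sides F = P.sides F := by
    unfold sides; simp only [hedge]
  rw [IsOddCoherent, IsOddCoherent, hface, hcoh, hsides]

lemma cohOdd_eq_of_reparam {P P' : KnotProjection} (h : P.Reparam P') : P.cohOdd = P'.cohOdd :=
  cohOdd_eq_cohOdd (exists_congr fun F => (isOddCoherent_iff_of_reparam h F).symm)

/-- A diffeomorphism of the sphere either preserves or exchanges the two sides along the whole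
curve, because the Jacobian determinant does not vanish along the curve. -/
lemma isOddCoherent_image {P P' : KnotProjection} {φ κ : E3 → E3} (hφ : ContDiff ℝ ∞ φ)
    (hκ : ContDiff ℝ ∞ κ)
    (hs : ∀ x ∈ sphere2, φ x ∈ sphere2 ∧ κ x ∈ sphere2 ∧ κ (φ x) = x ∧ φ (κ x) = x)
    (hc : ∀ t, P'.curve t = φ (P.curve t)) {F : Set E3} (hF : P.IsOddCoherent F) :
    P'.IsOddCoherent (φ '' F) := by
  obtain ⟨hface, hcoh, hodd⟩ := hF
  have hinj : ∀ x ∈ sphere2, ∀ y ∈ sphere2, φ x = φ y → x = y := fun x hx y hy h => by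
    rw [← (hs x hx).2.2.1, h, (hs y hy).2.2.1]
  have hcc : ∀ s t, P'.curve s = P'.curve t ↔ P.curve s = P.curve t := fun s t => by
    rw [hc, hc]
    exact ⟨hinj _ (P.mem_sphere s) _ (P.mem_sphere t), congrArg φ⟩
  have hdbl : P'.doubleParams = P.doubleParams := by
    unfold doubleParams; simp only [hcc]
  have hFs : F ⊆ sphere2 := fun x hx => (hface.subset hx).1
  have hmem : ∀ x ∈ sphere2, φ x ∈ φ '' F ↔ x ∈ F := by
    intro x hx
    constructor
    · rintro ⟨y, hy, h⟩
      rwa [← hinj y (hFs hy) x hx h]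
    · exact fun h => ⟨x, h, rfl⟩
  have hX : ∀ x ∈ sphere2 \ P.image, φ x ∈ sphere2 \ P'.image := by
    rintro x ⟨hx, hxi⟩
    refine ⟨(hs x hx).1, ?_⟩
    rintro ⟨t, ht⟩
    rw [hc] at ht
    exact hxi ⟨t, hinj _ (P.mem_sphere t) _ hx ht⟩
  have hX' : ∀ x ∈ sphere2 \ P'.image, κ x ∈ sphere2 \ P.image := by
    rintro x ⟨hx, hxi⟩
    refine ⟨(hs x hx).2.1, ?_⟩
    rintro ⟨t, ht⟩
    exact hxi ⟨t, by rw [hc, ht, (hs x hx).2.2.2]⟩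
  have hface' : P'.IsFace (φ '' F) := by
    obtain ⟨x, hx⟩ := hface.nonempty
    obtain ⟨G, hG, hxG⟩ := exists_isFace (hX x (hface.subset hx))
    have h1 : φ '' F ⊆ G := hG.subset_of_isPreconnected
      (hface.isPreconnected.image φ hφ.continuous.continuousOn)
      (by rintro _ ⟨y, hy, rfl⟩; exact hX y (hface.subset hy)) ⟨x, hx, rfl⟩ hxG
    have h2 : κ '' G ⊆ F := hface.subset_of_isPreconnected
      (hG.isPreconnected.image κ hκ.continuous.continuousOn)
      (by rintro _ ⟨y, hy, rfl⟩; exact hX' y (hG.subset hy))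
      ⟨φ x, hxG, (hs x (hFs hx)).2.2.1⟩ hx
    have h3 : G ⊆ φ '' F := fun y hy =>
      ⟨κ y, h2 ⟨y, hy, rfl⟩, (hs y (hG.subset hy).1).2.2.2⟩
    rwa [h1.antisymm h3]
  have hcl : ∀ t, P'.curve t ∈ closure (φ '' F) ↔ P.curve t ∈ closure F := by
    intro t
    rw [hc]
    constructor
    · intro h
      have h1 := image_closure_subset_closure_image hκ.continuous ⟨_, h, rfl⟩
      rw [(hs _ (P.mem_sphere t)).2.2.1, Set.image_image] at h1
      refine closure_mono ?_ h1
      rintro _ ⟨y, hy, rfl⟩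
      simp only [(hs y (hFs hy)).2.2.1]
      exact hy
    · exact fun h => image_closure_subset_closure_image hφ.continuous ⟨_, h, rfl⟩
  have hφd : ∀ x, HasFDerivAt φ (fderiv ℝ φ x) x := fun x =>
    (hφ.differentiable (by simp) x).hasFDerivAt
  have hcd : ∀ t, deriv P'.curve t = fderiv ℝ φ (P.curve t) (deriv P.curve t) := by
    intro t
    have h1 := (hφd (P.curve t)).comp_hasDerivAt t (P.hasDerivAt_curve t)
    have h2 : φ ∘ P.curve = P'.curve := funext fun s => (hc s).symm
    rw [h2] at h1
    exact h1.deriv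
  have hpath : ∀ t, HasDerivAt (fun ε => φ (P.normalPoint t ε))
      (fderiv ℝ φ (P.curve t) (P.leftNormal t)) 0 := by
    intro t
    have h1 : HasFDerivAt φ (fderiv ℝ φ (P.curve t)) (P.normalPoint t 0) := by
      rw [normalPoint_zero]; exact hφd _
    exact h1.comp_hasDerivAt (0 : ℝ) (P.hasDerivAt_normalPoint t)
  have hpath' : ∀ t, HasDerivAt (fun ε => φ (P.normalPoint t (-ε)))
      (-fderiv ℝ φ (P.curve t) (P.leftNormal t)) 0 := by
    intro t
    have h1 : HasDerivAt (fun ε => φ (P.normalPoint t ε))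
      (fderiv ℝ φ (P.curve t) (P.leftNormal t)) (-0) := by rw [neg_zero]; exact hpath t
    exact (h1.scomp (0 : ℝ) (hasDerivAt_neg (0 : ℝ))).congr_deriv (neg_one_smul ℝ _)
  have hps : ∀ t ε, φ (P.normalPoint t ε) ∈ sphere2 := fun t ε =>
    (hs _ (P.normalPoint_mem_sphere2 t ε)).1
  -- The sign of `m` tells whether `φ` preserves or exchanges the two sides of the curve.
  set m : ℝ → ℝ := fun t => triple (P'.curve t) (deriv P'.curve t)
    (fderiv ℝ φ (P.curve t) (P.leftNormal t)) with hm
  have hmc : Continuous m := by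
    have h1 : Continuous fun t => fderiv ℝ φ (P.curve t) (P.leftNormal t) :=
      ((hφ.continuous_fderiv (by simp)).comp P.continuous_curve).clm_apply
        P.contDiff_leftNormal.continuous
    have h2 := P'.continuous_curve
    have h3 := P'.contDiff_deriv_curve.continuous
    simp only [hm, triple_apply]
    fun_prop
  have hm0 : ∀ t, m t ≠ 0 := by
    intro t h
    have h0 := inner_deriv_eq_zero (Eventually.of_forall (hps t)) (hpath t)
    rw [normalPoint_zero, ← hc] at h0
    obtain ⟨a, ha⟩ := exists_smul_eq_of_triple_eq_zero (P'.norm_curve t) (P'.inner_curve_deriv t)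
      h0 (P'.immersion t) h
    have hκd : HasFDerivAt κ (fderiv ℝ κ (P'.curve t)) (φ (P.curve t)) := by
      rw [← hc]; exact (hκ.differentiable (by simp) _).hasFDerivAt
    have h1 : fderiv ℝ κ (P'.curve t) (deriv P'.curve t) = deriv P.curve t := by
      have h2 := hκd.comp_hasDerivAt t ((hφd (P.curve t)).comp_hasDerivAt t (P.hasDerivAt_curve t))
      have h3 : κ ∘ φ ∘ P.curve = P.curve := funext fun s => (hs _ (P.mem_sphere s)).2.2.1
      rw [h3, ← hcd] at h2
      exact h2.unique (P.hasDerivAt_curve t)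
    have h4 : fderiv ℝ κ (P'.curve t) (fderiv ℝ φ (P.curve t) (P.leftNormal t)) =
        P.leftNormal t := by
      have hκd' : HasFDerivAt κ (fderiv ℝ κ (P'.curve t)) (φ (P.normalPoint t 0)) := by
        rw [normalPoint_zero]; exact hκd
      have h2 := hκd'.comp_hasDerivAt (0 : ℝ) (hpath t)
      have h3 : (κ ∘ fun ε => φ (P.normalPoint t ε)) = P.normalPoint t :=
        funext fun ε => (hs _ (P.normalPoint_mem_sphere2 t ε)).2.2.1
      rw [h3] at h2
      exact h2.unique (P.hasDerivAt_normalPoint t)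
    rw [ha, map_smul, h1] at h4
    have h5 := P.triple_leftNormal t
    rw [← h4, triple_smul_right, triple_self_right, mul_zero] at h5
    exact (P.norm_deriv_pos t).ne h5
  have hc0 : ∀ t, φ (P.normalPoint t 0) = P'.curve t := fun t => by rw [normalPoint_zero, hc]
  have hc0' : ∀ t, φ (P.normalPoint t (-0)) = P'.curve t := fun t => by rw [neg_zero, hc0]
  have hmemn : ∀ t ε, φ (P.normalPoint t ε) ∈ φ '' F ↔ P.normalPoint t ε ∈ F := fun t ε =>
    hmem _ (P.normalPoint_mem_sphere2 t ε)
  have htn : ∀ t, triple (P'.curve t) (deriv P'.curve t)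
      (-fderiv ℝ φ (P.curve t) (P.leftNormal t)) = -m t := fun t => by
    rw [← neg_one_smul ℝ, triple_smul_right, neg_one_mul]
  refine ⟨hface', ?_, ?_⟩
  · rw [isCoherent_iff hface', hdbl]
    rw [isCoherent_iff hface] at hcoh
    rcases forall_pos_or_forall_neg hmc hm0 with h | h
    · have hL : ∀ t, t ∉ P.doubleParams → (P'.OnLeft (φ '' F) t ↔ P.OnLeft F t) := by
        intro t ht
        rw [onLeft_iff_of_path (hdbl ▸ ht) hface' (c := fun ε => φ (P.normalPoint t ε))
          (hps t) (hc0 t) (hpath t) (h t)]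
        simp only [hmemn]; rfl
      have hR : ∀ t, t ∉ P.doubleParams → (P'.OnRight (φ '' F) t ↔ P.OnRight F t) := by
        intro t ht
        rw [onRight_iff_of_path (hdbl ▸ ht) hface' (c := fun ε => φ (P.normalPoint t (-ε)))
          (fun _ => hps t _) (hc0' t) (hpath' t) (by rw [htn]; exact neg_neg_of_pos (h t))]
        simp only [hmemn]; rfl
      exact hcoh.imp (fun h t ht => by rw [hR t ht]; exact h t ht)
        (fun h t ht => by rw [hL t ht]; exact h t ht)
    · have hL : ∀ t, t ∉ P.doubleParams → (P'.OnLeft (φ '' F) t ↔ P.OnRight F t) := by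
        intro t ht
        rw [onLeft_iff_of_path (hdbl ▸ ht) hface' (c := fun ε => φ (P.normalPoint t (-ε)))
          (fun _ => hps t _) (hc0' t) (hpath' t) (by rw [htn]; exact neg_pos.2 (h t))]
        simp only [hmemn]; rfl
      have hR : ∀ t, t ∉ P.doubleParams → (P'.OnRight (φ '' F) t ↔ P.OnLeft F t) := by
        intro t ht
        rw [onRight_iff_of_path (hdbl ▸ ht) hface' (c := fun ε => φ (P.normalPoint t ε))
          (hps t) (hc0 t) (hpath t) (h t)]
        simp only [hmemn]; rfl
      exact hcoh.symm.imp (fun h t ht => by rw [hR t ht]; exact h t ht)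
        (fun h t ht => by rw [hL t ht]; exact h t ht)
  · rw [ncard_sides hface']
    rw [ncard_sides hface] at hodd
    have : P'.startSet (φ '' F) = P.startSet F := by
      unfold startSet; simp only [hdbl, hcl]
    rwa [this]

lemma cohOdd_eq_of_sphereIsotopic {P P' : KnotProjection} (h : P.SphereIsotopic P') :
    P.cohOdd = P'.cohOdd := by
  obtain ⟨H, K, hH, hK, hs, -, hc⟩ := h
  have hs1 := hs 1 ⟨zero_le_one, le_rfl⟩
  have hH1 : ContDiff ℝ ∞ (H 1) :=
    hH.comp ((contDiff_const (c := (1 : ℝ))).prodMk contDiff_id)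
  have hK1 : ContDiff ℝ ∞ (K 1) :=
    hK.comp ((contDiff_const (c := (1 : ℝ))).prodMk contDiff_id)
  refine cohOdd_eq_cohOdd ⟨fun ⟨F, hF⟩ => ⟨_, isOddCoherent_image hH1 hK1 hs1 hc hF⟩,
    fun ⟨F, hF⟩ => ⟨_, isOddCoherent_image hK1 hH1
      (fun x hx => ⟨(hs1 x hx).2.1, (hs1 x hx).1, (hs1 x hx).2.2.2, (hs1 x hx).2.2.1⟩)
      (fun t => ?_) hF⟩⟩
  rw [hc, (hs1 _ (P.mem_sphere t)).2.2.1]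

end KnotProjection

namespace KnotProjection

/-! ### Planar charts and strands -/

namespace IsPlanarChart

variable {ψ : ℝ × ℝ → E3}

lemma triple_pos (hψ : IsPlanarChart ψ) (z : ℝ × ℝ) :
    0 < triple (ψ z) (fderiv ℝ ψ z (1, 0)) (fderiv ℝ ψ z (0, 1)) := hψ.oriented z

lemma continuous (hψ : IsPlanarChart ψ) : Continuous ψ := hψ.smooth.continuous

/-- A planar chart is an open map to the sphere. -/
lemma eventually_mem_image (hψ : IsPlanarChart ψ) {z : ℝ × ℝ} {S : Set (ℝ × ℝ)} (hS : S ∈ 𝓝 z) :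
    ∀ᶠ x in 𝓝 (ψ z), x ∈ sphere2 → x ∈ ψ '' S := by
  obtain ⟨σ, hl, hr, hd, -⟩ := exists_local_inverse hψ.smooth.contDiffAt hψ.mem_sphere
    (hψ.triple_pos z).ne'
  have h1 : Tendsto σ (𝓝 (ψ z)) (𝓝 z) := by
    have := hd.continuousAt.tendsto
    rwa [hl.self_of_nhds] at this
  filter_upwards [hr, h1.eventually hS] with x h2 h3 hx
  exact ⟨σ x, h3, h2 hx⟩

lemma invFun_apply (hψ : IsPlanarChart ψ) (z : ℝ × ℝ) : Function.invFun ψ (ψ z) = z :=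
  Function.leftInverse_invFun hψ.injective z

lemma continuousWithinAt_invFun (hψ : IsPlanarChart ψ) (z : ℝ × ℝ) :
    ContinuousWithinAt (Function.invFun ψ) sphere2 (ψ z) := by
  intro S hS
  rw [hψ.invFun_apply z] at hS
  rw [Filter.mem_map, mem_nhdsWithin_iff_eventually]
  filter_upwards [hψ.eventually_mem_image hS] with x hx hxs
  obtain ⟨y, hy, rfl⟩ := hx hxs
  change Function.invFun ψ (ψ y) ∈ S
  rwa [hψ.invFun_apply y]

end IsPlanarChart

lemma isCompact_square : IsCompact square := isCompact_Icc.prod isCompact_Icc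

lemma mem_square {z : ℝ × ℝ} : z ∈ square ↔ (-1 ≤ z.1 ∧ z.1 ≤ 1) ∧ -1 ≤ z.2 ∧ z.2 ≤ 1 := Iff.rfl

lemma isClosed_image_square {ψ : ℝ × ℝ → E3} (hψ : IsPlanarChart ψ) : IsClosed (ψ '' square) :=
  (isCompact_square.image hψ.continuous).isClosed

variable {P : KnotProjection} {ψ : ℝ × ℝ → E3} {τ d : ℝ} {f : ℝ → ℝ}

/-- Around the parameter `τ` the curve runs along the graph of `f` over `[-1, 1]` in the chart `ψ`,
to the right if `d = 1` and to the left if `d = -1`. -/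
def IsStrand (P : KnotProjection) (ψ : ℝ × ℝ → E3) (τ d : ℝ) (f : ℝ → ℝ) : Prop :=
  ∀ x ∈ Set.Icc (-1 : ℝ) 1, P.curve (τ + d * x) = ψ (x, f x)

lemma IsStrand.continuousOn (hψ : IsPlanarChart ψ) (h : P.IsStrand ψ τ d f) :
    ContinuousOn f (Set.Icc (-1) 1) := by
  have hχ := hψ.invFun_apply
  have hc := hψ.continuousWithinAt_invFun
  intro x hx
  have h1 : ContinuousWithinAt (fun y => (Function.invFun ψ (P.curve (τ + d * y))).2)
      (Set.Icc (-1) 1) x := by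
    have h2 := hc (x, f x)
    rw [← h x hx] at h2
    have h3 : ContinuousWithinAt (fun y => P.curve (τ + d * y)) (Set.Icc (-1) 1) x :=
      (P.continuous_curve.comp (by fun_prop)).continuousWithinAt
    exact (ContinuousWithinAt.comp (f := fun y => P.curve (τ + d * y)) h2 h3
      (fun y _ => P.mem_sphere _)).snd
  refine h1.congr (fun y hy => ?_) ?_
  · rw [h y hy, hχ]
  · rw [h x hx, hχ]

/-- The upward direction of the chart points to the left of a strand that runs to the right, and to
the right of a strand that runs to the left. -/
lemma IsStrand.triple_pos (hψ : IsPlanarChart ψ) (h : P.IsStrand ψ τ d f) {x : ℝ}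
    (hx : x ∈ Set.Ioo (-1 : ℝ) 1) :
    0 < d * triple (P.curve (τ + d * x)) (deriv P.curve (τ + d * x))
      (fderiv ℝ ψ (x, f x) (0, 1)) := by
  have hxI := Set.Ioo_subset_Icc_self hx
  obtain ⟨σ, hl, hr, hd, hw⟩ := exists_local_inverse (Ψ := ψ) (z₀ := (x, f x))
    hψ.smooth.contDiffAt hψ.mem_sphere (hψ.triple_pos _).ne'
  have hcd : HasDerivAt (fun y => P.curve (τ + d * y)) (d • deriv P.curve (τ + d * x)) x := by
    have h1 : HasDerivAt (fun y => τ + d * y) d x := by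
      simpa using ((hasDerivAt_id x).const_mul d).const_add τ
    exact (P.hasDerivAt_curve (τ + d * x)).scomp x h1
  set w := d • deriv P.curve (τ + d * x) with hwdef
  have hw0 : inner ℝ (ψ (x, f x)) w = 0 := by
    rw [← h x hxI]
    exact inner_deriv_eq_zero (c := fun y => P.curve (τ + d * y))
      (Eventually.of_forall fun y => P.mem_sphere _) hcd
  have h1 : HasDerivAt (fun y => σ (P.curve (τ + d * y))) (fderiv ℝ σ (ψ (x, f x)) w) x := by
    have h2 : HasFDerivAt σ (fderiv ℝ σ (ψ (x, f x))) (P.curve (τ + d * x)) := by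
      rw [h x hxI]; exact hd.hasFDerivAt
    exact h2.comp_hasDerivAt x hcd
  have h3 : (fderiv ℝ σ (ψ (x, f x)) w).1 = 1 := by
    have h4 : HasDerivAt (fun y => (σ (P.curve (τ + d * y))).1)
        (fderiv ℝ σ (ψ (x, f x)) w).1 x :=
      (ContinuousLinearMap.fst ℝ ℝ ℝ).hasFDerivAt.comp_hasDerivAt x h1
    refine (h4.congr_of_eventuallyEq ?_).unique (hasDerivAt_id x)
    have h5 : Tendsto (fun y => P.curve (τ + d * y)) (𝓝 x) (𝓝 (ψ (x, f x))) := by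
      rw [← h x hxI]; exact hcd.continuousAt
    filter_upwards [h5.eventually hr, Ioo_mem_nhds hx.1 hx.2] with y h6 h7
    have h8 := h6 (P.mem_sphere _)
    rw [h y (Set.Ioo_subset_Icc_self h7)] at h8
    have h9 := hψ.injective h8
    rw [h y (Set.Ioo_subset_Icc_self h7), h9]
    rfl
  have h4 := hw w hw0
  rw [fderiv_apply_eq, h3, one_smul] at h4
  rw [← triple_smul_middle, ← hwdef, ← h4, triple_add_middle, triple_smul_middle,
    triple_self_right, mul_zero, add_zero, h x hxI]
  exact hψ.triple_pos _

lemma IsPlanarChart.hasDerivAt_vertical (hψ : IsPlanarChart ψ) (x y c : ℝ) :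
    HasDerivAt (fun ε => ψ (x, y + c * ε)) (c • fderiv ℝ ψ (x, y) (0, 1)) 0 := by
  have h1 : HasDerivAt (fun ε : ℝ => (x, y + c * ε)) (0, c) 0 := by
    refine (hasDerivAt_const _ _).prodMk ?_
    simpa using ((hasDerivAt_id (0 : ℝ)).const_mul c).const_add y
  have h2 : HasFDerivAt ψ (fderiv ℝ ψ (x, y)) (x, y + c * 0) := by
    simpa using (hψ.smooth.differentiable (by simp) (x, y)).hasFDerivAt
  refine (h2.comp_hasDerivAt (0 : ℝ) h1).congr_deriv ?_
  rw [← map_smul]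
  simp

variable {F : Set E3}

/-- Which polygon lies to the left of a strand can be tested along vertical segments; here `c = 1`
for the segments going up and `c = -1` for those going down. -/
lemma IsStrand.onLeft_iff (hψ : IsPlanarChart ψ) (h : P.IsStrand ψ τ d f) (hF : P.IsFace F) {x : ℝ}
    (hx : x ∈ Set.Ioo (-1 : ℝ) 1) (ht : τ + d * x ∉ P.doubleParams) {c : ℝ} (hc : c * d = 1) :
    P.OnLeft F (τ + d * x) ↔ ∀ᶠ ε in 𝓝[>] (0 : ℝ), ψ (x, f x + c * ε) ∈ F := by
  refine onLeft_iff_of_path ht hF (c := fun ε => ψ (x, f x + c * ε)) (fun _ => hψ.mem_sphere _) ?_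
    (hψ.hasDerivAt_vertical x (f x) c) ?_
  · rw [mul_zero, add_zero, h x (Set.Ioo_subset_Icc_self hx)]
  · have h1 := h.triple_pos hψ hx
    have hd : d ≠ 0 := right_ne_zero_of_mul_eq_one hc
    rw [triple_smul_right]
    have h2 : c = d / d ^ 2 := by field_simp; linarith
    rw [h2, div_mul_eq_mul_div]
    positivity

lemma IsStrand.onRight_iff (hψ : IsPlanarChart ψ) (h : P.IsStrand ψ τ d f) (hF : P.IsFace F)
    {x : ℝ} (hx : x ∈ Set.Ioo (-1 : ℝ) 1) (ht : τ + d * x ∉ P.doubleParams) {c : ℝ}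
    (hc : c * d = -1) :
    P.OnRight F (τ + d * x) ↔ ∀ᶠ ε in 𝓝[>] (0 : ℝ), ψ (x, f x + c * ε) ∈ F := by
  refine onRight_iff_of_path ht hF (c := fun ε => ψ (x, f x + c * ε)) (fun _ => hψ.mem_sphere _) ?_
    (hψ.hasDerivAt_vertical x (f x) c) ?_
  · rw [mul_zero, add_zero, h x (Set.Ioo_subset_Icc_self hx)]
  · have h1 := h.triple_pos hψ hx
    have hd : d ≠ 0 := by rintro rfl; simp at hc
    rw [triple_smul_right]
    have h2 : c = -(d / d ^ 2) := by field_simp; linarith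
    rw [h2, neg_mul, neg_lt_zero, div_mul_eq_mul_div]
    positivity

lemma deriv_curve_eq_of_sameParam {s t : ℝ} (h : SameParam s t) :
    deriv P.curve s = deriv P.curve t := by
  obtain ⟨n, rfl⟩ := h
  have h1 : (fun u => P.curve (u + 2 * Real.pi * n)) = P.curve :=
    funext fun u => P.curve_add_int u n
  rw [← deriv_comp_add_const, h1]

lemma normalPoint_eq_of_sameParam {s t : ℝ} (h : SameParam s t) :
    P.normalPoint s = P.normalPoint t := by
  unfold normalPoint
  rw [P.curve_eq_of_sameParam h, deriv_curve_eq_of_sameParam h]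

lemma onLeft_iff_of_sameParam {s t : ℝ} (h : SameParam s t) : P.OnLeft F s ↔ P.OnLeft F t := by
  unfold OnLeft; rw [normalPoint_eq_of_sameParam h]

lemma onRight_iff_of_sameParam {s t : ℝ} (h : SameParam s t) : P.OnRight F s ↔ P.OnRight F t := by
  unfold OnRight; rw [normalPoint_eq_of_sameParam h]

/-- In a disk with a picture, every passage of the curve is one of the strands. -/
lemma HasPicture.exists_strand {k : ℕ} {τ d : Fin k → ℝ} {f : Fin k → ℝ → ℝ}
    (hψ : IsPlanarChart ψ) (h : P.HasPicture ψ τ d f) (hd : ∀ i, d i = 1 ∨ d i = -1)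
    {t : ℝ} {z : ℝ × ℝ} (hz : z ∈ square) (ht : P.curve t = ψ z) :
    ∃ i, z.2 = f i z.1 ∧ SameParam (τ i + d i * z.1) t := by
  obtain ⟨i, n, hn⟩ := h.2 t (ht ▸ ⟨z, hz, rfl⟩)
  have hdd : d i * d i = 1 := by rcases hd i with h | h <;> rw [h] <;> norm_num
  set x := d i * (t - τ i - 2 * Real.pi * n) with hx
  have hxI : x ∈ Set.Icc (-1 : ℝ) 1 := by
    rw [Set.mem_Icc, ← abs_le, hx, abs_mul]
    rcases hd i with h | h <;> rw [h] <;> simpa using hn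
  have hsame : SameParam (τ i + d i * x) t := ⟨n, by rw [hx, ← mul_assoc, hdd]; ring⟩
  have h1 := h.1 i x hxI
  rw [P.curve_eq_of_sameParam hsame, ht] at h1
  have h2 := hψ.injective h1
  rw [h2]
  exact ⟨i, rfl, hsame⟩

end KnotProjection

namespace KnotProjection

/-! ### Strong third Reidemeister moves -/

variable {P : KnotProjection} {ψ : ℝ × ℝ → E3}

lemma not_sameParam_of_antiparallel (hψ : IsPlanarChart ψ) {τ τ' : ℝ} {f f' : ℝ → ℝ}
    (h : P.IsStrand ψ τ (-1) f) (h' : P.IsStrand ψ τ' 1 f') {x : ℝ} (hx : x ∈ Set.Ioo (-1 : ℝ) 1) :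
    ¬ SameParam (τ + -1 * x) (τ' + 1 * x) := by
  rintro ⟨n, hn⟩
  set e := min ((1 - x) / 2) ((1 + x) / 2) with he
  have he0 : 0 < e := lt_min (by linarith [hx.2]) (by linarith [hx.1])
  have he1 : e ≤ (1 - x) / 2 := min_le_left _ _
  have he2 : e ≤ (1 + x) / 2 := min_le_right _ _
  have a1 := h (x - e) ⟨by linarith [hx.1], by linarith [hx.2]⟩
  have a2 := h' (x + e) ⟨by linarith [hx.1], by linarith [hx.2]⟩
  have h2 : P.curve (τ + -1 * (x - e)) = P.curve (τ' + 1 * (x + e)) :=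
    P.curve_eq_of_sameParam ⟨n, by linarith⟩
  rw [a1, a2] at h2
  have h3 := congrArg Prod.fst (hψ.injective h2)
  simp only at h3
  linarith

lemma not_sameParam_of_parallel (hψ : IsPlanarChart ψ) {τ τ' d : ℝ} {f f' : ℝ → ℝ}
    (h : P.IsStrand ψ τ d f) (h' : P.IsStrand ψ τ' d f') (hne : f 1 ≠ f' 1) (x : ℝ) :
    ¬ SameParam (τ + d * x) (τ' + d * x) := by
  rintro ⟨n, hn⟩
  have h2 : P.curve (τ + d * 1) = P.curve (τ' + d * 1) :=
    P.curve_eq_of_sameParam ⟨n, by linarith⟩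
  rw [h 1 ⟨by norm_num, le_rfl⟩, h' 1 ⟨by norm_num, le_rfl⟩] at h2
  exact hne (congrArg Prod.snd (hψ.injective h2))

/-- A parameter on a strand belongs to the double points if another strand crosses there. -/
lemma IsStrand.mem_doubleParams {τ τ' d d' : ℝ} {f f' : ℝ → ℝ} (h : P.IsStrand ψ τ d f)
    (h' : P.IsStrand ψ τ' d' f') {x : ℝ} (hx : x ∈ Set.Icc (-1 : ℝ) 1) (hf : f x = f' x)
    (hn : ¬ SameParam (τ + d * x) (τ' + d' * x)) :
    τ + d * x ∈ P.doubleParams ∧ τ' + d' * x ∈ P.doubleParams := by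
  have h1 : P.curve (τ + d * x) = P.curve (τ' + d' * x) := by rw [h x hx, h' x hx, hf]
  exact ⟨⟨_, h1.symm, fun h => hn h.symm⟩, ⟨_, h1, hn⟩⟩

/-- If a set contains the strand shortly after the parameter at abscissa `x`, it contains a point of
the strand next to `x` in the direction of the strand. -/
lemma IsStrand.exists_mem_of_eventually {τ d : ℝ} {f : ℝ → ℝ} (h : P.IsStrand ψ τ d f) {x a : ℝ}
    (hd : d = 1 ∨ d = -1) (hx : x ∈ Set.Ioo (-1 : ℝ) 1) (ha : SameParam (τ + d * x) a) {S : Set E3}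
    (hS : ∀ᶠ s in 𝓝[>] a, P.curve s ∈ S) :
    ∀ η > 0, ∃ e ∈ Set.Ioo 0 η, x + d * e ∈ Set.Ioo (-1 : ℝ) 1 ∧
      ψ (x + d * e, f (x + d * e)) ∈ S := by
  intro η hη
  obtain ⟨n, rfl⟩ := ha
  set a := τ + d * x + 2 * Real.pi * n
  have hdd : d * d = 1 := by rcases hd with rfl | rfl <;> norm_num
  have hda : |d| = 1 := by rcases hd with rfl | rfl <;> norm_num
  have h1 : ∀ᶠ s in 𝓝[>] a, s ∈ Set.Ioo a (a + min η (min (1 - x) (1 + x))) :=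
    Ioo_mem_nhdsGT (by
      have : 0 < min η (min (1 - x) (1 + x)) :=
        lt_min hη (lt_min (by linarith [hx.2]) (by linarith [hx.1]))
      linarith)
  obtain ⟨s, hs, hs1, hs2⟩ := (hS.and h1).exists
  have e1 := min_le_left η (min (1 - x) (1 + x))
  have e2 := (min_le_right η (min (1 - x) (1 + x))).trans (min_le_left _ _)
  have e3 := (min_le_right η (min (1 - x) (1 + x))).trans (min_le_right _ _)
  have hI : x + d * (s - a) ∈ Set.Ioo (-1 : ℝ) 1 := by
    have h2 : |d * (s - a)| < 1 - |x| := by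
      rw [abs_mul, hda, one_mul, abs_of_pos (by linarith)]
      rcases abs_cases x with ⟨h, -⟩ | ⟨h, -⟩ <;> rw [h] <;> linarith
    have h3 := abs_lt.1 h2
    have h4 := neg_abs_le x
    have h5 := le_abs_self x
    constructor <;> linarith [h3.1, h3.2]
  refine ⟨s - a, ⟨by linarith, by linarith⟩, hI, ?_⟩
  rw [← h _ (Set.Ioo_subset_Icc_self hI), ← P.curve_add_int _ n]
  convert hs using 2
  linear_combination (s - a) * hdd

lemma IsStrand.eventually_of_forall {τ d : ℝ} {f : ℝ → ℝ} (h : P.IsStrand ψ τ d f) {x : ℝ}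
    (hd : d = 1 ∨ d = -1) (hx : x ∈ Set.Ioo (-1 : ℝ) 1) {S : Set E3} {η : ℝ} (hη : 0 < η)
    (hS : ∀ e ∈ Set.Ioo 0 η, x + d * e ∈ Set.Icc (-1 : ℝ) 1 → ψ (x + d * e, f (x + d * e)) ∈ S) :
    ∀ᶠ s in 𝓝[>] (τ + d * x), P.curve s ∈ S := by
  have hdd : d * d = 1 := by rcases hd with rfl | rfl <;> norm_num
  have h0 : 0 < min η (min (1 - x) (1 + x)) :=
    lt_min hη (lt_min (by linarith [hx.2]) (by linarith [hx.1]))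
  have e1 := min_le_left η (min (1 - x) (1 + x))
  have e2 := (min_le_right η (min (1 - x) (1 + x))).trans (min_le_left _ _)
  have e3 := (min_le_right η (min (1 - x) (1 + x))).trans (min_le_right _ _)
  filter_upwards [Ioo_mem_nhdsGT (lt_add_of_pos_right (τ + d * x) h0)] with s hs
  have hI : x + d * (s - (τ + d * x)) ∈ Set.Icc (-1 : ℝ) 1 := by
    rcases hd with rfl | rfl <;> constructor <;> linarith [hs.1, hs.2, hx.1, hx.2]
  have h1 := hS (s - (τ + d * x)) ⟨by linarith [hs.1], by linarith [hs.2]⟩ hI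
  rw [← h _ hI] at h1
  convert h1 using 2
  linear_combination (τ + d * x - s) * hdd

/-- The triangle bounded by the three strands of the third move is a coherent polygon with three
sides. -/
theorem exists_isOddCoherent_of_triangle (hψ : IsPlanarChart ψ) {τ : Fin 3 → ℝ} {g : ℝ → ℝ}
    {p q : ℝ} (h : P.HasPicture ψ τ ![-1, -1, 1] ![fun x => x / 2, fun x => -x / 2, g])
    (hg : CrossesAt g p q) (hp : p < 0) (hq : 0 < q) : ∃ F, P.IsOddCoherent F := by
  obtain ⟨hpI, hqI, hg1, hgp, hgp1, hgp2, hgq, hgq1, hgq2⟩ := hg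
  have hs0 : P.IsStrand ψ (τ 0) (-1) (fun x => x / 2) := fun x hx => by simpa using h.1 0 x hx
  have hs1 : P.IsStrand ψ (τ 1) (-1) (fun x => -x / 2) := fun x hx => by simpa using h.1 1 x hx
  have hs2 : P.IsStrand ψ (τ 2) 1 g := fun x hx => by simpa using h.1 2 x hx
  have hcov : ∀ t, ∀ z ∈ square, P.curve t = ψ z →
      (z.2 = z.1 / 2 ∧ SameParam (τ 0 + -1 * z.1) t) ∨
      (z.2 = -z.1 / 2 ∧ SameParam (τ 1 + -1 * z.1) t) ∨
      (z.2 = g z.1 ∧ SameParam (τ 2 + 1 * z.1) t) := by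
    intro t z hz ht
    obtain ⟨i, hi⟩ := h.exists_strand hψ (by intro i; fin_cases i <;> simp) hz ht
    fin_cases i
    · exact Or.inl hi
    · exact Or.inr (Or.inl hi)
    · exact Or.inr (Or.inr hi)
  have hgc := hs2.continuousOn hψ
  -- The upper boundary of the triangle.
  obtain ⟨u, hu⟩ : ∃ u : ℝ → ℝ, u = fun x => -|x| / 2 := ⟨_, rfl⟩
  have huc : Continuous u := by rw [hu]; fun_prop
  have hun : ∀ x ≤ 0, u x = x / 2 := fun x hx => by rw [hu]; simp only [abs_of_nonpos hx]; ring
  have hup : ∀ x, 0 ≤ x → u x = -x / 2 := fun x hx => by rw [hu]; simp only [abs_of_nonneg hx]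
  have hu1 : ∀ x, u x ≤ x / 2 := fun x => by
    rcases le_total x 0 with hx | hx
    · rw [hun x hx]
    · rw [hup x hx]; linarith
  have hu2 : ∀ x, u x ≤ -x / 2 := fun x => by
    rcases le_total x 0 with hx | hx
    · rw [hun x hx]; linarith
    · rw [hup x hx]
  have hgu : ∀ x ∈ Set.Ioo p q, g x < u x := by
    intro x hx
    rcases le_total x 0 with h0 | h0
    · rw [hun x h0]; exact hgp2 x ⟨hx.1, by linarith [hqI.2, hx.2]⟩
    · rw [hup x h0]; exact hgq1 x ⟨by linarith [hpI.1, hx.1], hx.2⟩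
  have hgup : g p = u p := by rw [hgp, hun p hp.le]
  have hguq : g q = u q := by rw [hgq, hup q hq.le]
  have hgu' : ∀ x ∈ Set.Icc p q, g x ≤ u x := by
    intro x hx
    rcases eq_or_lt_of_le hx.1 with h1 | h1
    · rw [← h1, hgup]
    rcases eq_or_lt_of_le hx.2 with h2 | h2
    · rw [h2, hguq]
    exact (hgu x ⟨h1, h2⟩).le
  have hIcc : Set.Icc p q ⊆ Set.Icc (-1 : ℝ) 1 := Set.Icc_subset_Icc hpI.1.le hqI.2.le
  -- The open and the closed triangle, and a parametrization by a rectangle.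
  set T : Set (ℝ × ℝ) := {z | z.1 ∈ Set.Ioo p q ∧ g z.1 < z.2 ∧ z.2 < u z.1} with hT
  set T' : Set (ℝ × ℝ) := {z | z.1 ∈ Set.Icc p q ∧ g z.1 ≤ z.2 ∧ z.2 ≤ u z.1} with hT'
  have hT'sq : T' ⊆ square := by
    rintro z ⟨h1, h2, h3⟩
    have h4 := hIcc h1
    have h5 := hg1 _ h4
    rw [abs_lt] at h5
    refine ⟨h4, by linarith [h5.1], ?_⟩
    have h6 := hu1 z.1
    linarith [h4.2]
  have hTT' : T ⊆ T' := fun z hz => ⟨Set.Ioo_subset_Icc_self hz.1, hz.2.1.le, hz.2.2.le⟩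
  set m : ℝ × ℝ → ℝ × ℝ := fun w => (w.1, g w.1 + w.2 * (u w.1 - g w.1)) with hm
  have hmc : ContinuousOn m (Set.Icc p q ×ˢ Set.Icc 0 1) := by
    have h1 : ContinuousOn (fun w : ℝ × ℝ => g w.1) (Set.Icc p q ×ˢ Set.Icc 0 1) :=
      hgc.comp continuousOn_fst fun w hw => hIcc hw.1
    have h2 : ContinuousOn (fun w : ℝ × ℝ => u w.1) (Set.Icc p q ×ˢ Set.Icc 0 1) :=
      (huc.comp continuous_fst).continuousOn
    exact continuousOn_fst.prodMk (h1.add (continuousOn_snd.mul (h2.sub h1)))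
  have hmT : m '' (Set.Ioo p q ×ˢ Set.Ioo 0 1) = T := by
    ext z
    constructor
    · rintro ⟨w, ⟨h1, h2, h3⟩, rfl⟩
      have h4 := hgu _ h1
      refine ⟨h1, ?_, ?_⟩
      · have : 0 < w.2 * (u w.1 - g w.1) := mul_pos h2 (by linarith)
        simp only [hm]; linarith
      · have : w.2 * (u w.1 - g w.1) < 1 * (u w.1 - g w.1) :=
          mul_lt_mul_of_pos_right h3 (by linarith)
        simp only [hm]; linarith
    · rintro ⟨h1, h2, h3⟩
      have h4 : 0 < u z.1 - g z.1 := by linarith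
      refine ⟨(z.1, (z.2 - g z.1) / (u z.1 - g z.1)),
        ⟨h1, div_pos (by linarith) h4, (div_lt_one h4).2 (by linarith)⟩, ?_⟩
      simp only [hm]
      rw [div_mul_cancel₀ _ h4.ne', add_sub_cancel]
  have hmT' : m '' (Set.Icc p q ×ˢ Set.Icc 0 1) = T' := by
    ext z
    constructor
    · rintro ⟨w, ⟨h1, h2, h3⟩, rfl⟩
      have h4 := sub_nonneg.2 (hgu' _ h1)
      refine ⟨h1, ?_, ?_⟩
      · have := mul_nonneg h2 h4
        simp only [hm]; linarith
      · have := mul_le_mul_of_nonneg_right h3 h4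
        simp only [hm]; linarith
    · rintro ⟨h1, h2, h3⟩
      have h4 : 0 ≤ u z.1 - g z.1 := by linarith
      refine ⟨(z.1, (z.2 - g z.1) / (u z.1 - g z.1)),
        ⟨h1, div_nonneg (by linarith) h4, div_le_one_of_le₀ (by linarith) h4⟩, ?_⟩
      simp only [hm]
      rw [div_mul_cancel_of_imp (fun h => by linarith), add_sub_cancel]
  have hT'c : IsCompact T' := hmT' ▸ (isCompact_Icc.prod isCompact_Icc).image_of_continuousOn hmc
  have hTc : IsPreconnected T := hmT ▸ (isPreconnected_Ioo.prod isPreconnected_Ioo).image m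
    (hmc.mono (Set.prod_mono Set.Ioo_subset_Icc_self Set.Ioo_subset_Icc_self))
  have hT'T : T' ⊆ closure T := by
    have h1 : closure (Set.Ioo p q ×ˢ Set.Ioo (0 : ℝ) 1) = Set.Icc p q ×ˢ Set.Icc 0 1 := by
      rw [closure_prod_eq, closure_Ioo (by linarith), closure_Ioo zero_ne_one]
    rw [← hmT', ← hmT, ← h1]
    exact ContinuousOn.image_closure (by rwa [h1])
  have hcl : closure (ψ '' T) = ψ '' T' := by
    refine Set.Subset.antisymm ?_ ?_
    · exact closure_minimal (Set.image_mono hTT') (hT'c.image hψ.continuous).isClosed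
    · exact (Set.image_mono hT'T).trans (image_closure_subset_closure_image hψ.continuous)
  have hF : P.IsFace (ψ '' T) := by
    refine isFace_of_isClopen ?_ (hTc.image ψ hψ.continuous.continuousOn) ?_ ?_ ?_
    · rw [← hmT]
      exact ((Set.nonempty_Ioo.2 (by linarith)).prod (Set.nonempty_Ioo.2 one_pos)).image m
        |>.image ψ
    · rintro _ ⟨z, hz, rfl⟩
      refine ⟨hψ.mem_sphere z, ?_⟩
      rintro ⟨t, ht⟩
      have h1 := hu1 z.1
      have h2 := hu2 z.1
      rcases hcov t z (hT'sq (hTT' hz)) ht with ⟨h3, -⟩ | ⟨h3, -⟩ | ⟨h3, -⟩ <;>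
        linarith [hz.2.1, hz.2.2]
    · rintro _ ⟨z, hz, rfl⟩
      refine hψ.eventually_mem_image ?_
      have hgz : ContinuousAt g z.1 := hgc.continuousAt
        (Icc_mem_nhds (by linarith [hz.1.1, hpI.1]) (by linarith [hz.1.2, hqI.2]))
      have h1 : ContinuousAt (fun w : ℝ × ℝ => g w.1) z :=
        ContinuousAt.comp (f := Prod.fst) hgz continuousAt_fst
      filter_upwards [continuousAt_fst.eventually (Ioo_mem_nhds hz.1.1 hz.1.2),
        h1.eventually_lt continuousAt_snd hz.2.1,
        continuousAt_snd.eventually_lt (huc.comp continuous_fst).continuousAt hz.2.2]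
        with w h2 h3 h4 using ⟨h2, h3, h4⟩
    · intro x hx hxc
      rw [hcl] at hxc
      obtain ⟨z, hz, rfl⟩ := hxc
      have hzI := hIcc hz.1
      have hlow : g z.1 ≠ z.2 := fun h1 => hx.2 ⟨τ 2 + 1 * z.1, by rw [hs2 _ hzI, h1]⟩
      have hupp : z.2 ≠ u z.1 := by
        intro h1
        rcases le_total z.1 0 with h0 | h0
        · exact hx.2 ⟨τ 0 + -1 * z.1,
            (hs0 _ hzI).trans (congrArg ψ (Prod.ext rfl ((hun _ h0).symm.trans h1.symm)))⟩
        · exact hx.2 ⟨τ 1 + -1 * z.1,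
            (hs1 _ hzI).trans (congrArg ψ (Prod.ext rfl ((hup _ h0).symm.trans h1.symm)))⟩
      have h2 := lt_of_le_of_ne hz.2.1 hlow
      have h3 := lt_of_le_of_ne hz.2.2 hupp
      refine ⟨z, ⟨⟨lt_of_le_of_ne hz.1.1 fun h1 => ?_, lt_of_le_of_ne hz.1.2 fun h1 => ?_⟩,
        h2, h3⟩, rfl⟩
      · rw [← h1] at h2 h3; linarith
      · rw [h1] at h2 h3; linarith
  -- The parts of the strands on the boundary of the triangle.
  have hb0 : ∀ x, (x, x / 2) ∈ T' ↔ x ∈ Set.Icc p 0 := by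
    intro x
    constructor
    · rintro ⟨h1, -, h2⟩
      refine ⟨h1.1, ?_⟩
      have := hu2 x
      simp only at h2; linarith
    · rintro ⟨h1, h2⟩
      have h3 : x ∈ Set.Icc p q := ⟨h1, by linarith⟩
      have h4 := hgu' x h3
      rw [hun x h2] at h4
      exact ⟨h3, h4, (hun x h2).ge⟩
  have hb1 : ∀ x, (x, -x / 2) ∈ T' ↔ x ∈ Set.Icc 0 q := by
    intro x
    constructor
    · rintro ⟨h1, -, h2⟩
      refine ⟨?_, h1.2⟩
      have := hu1 x
      simp only at h2; linarith
    · rintro ⟨h1, h2⟩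
      have h3 : x ∈ Set.Icc p q := ⟨by linarith, h2⟩
      have h4 := hgu' x h3
      rw [hup x h1] at h4
      exact ⟨h3, h4, (hup x h1).ge⟩
  have hb2 : ∀ x, (x, g x) ∈ T' ↔ x ∈ Set.Icc p q := fun x =>
    ⟨fun h => h.1, fun h => ⟨h, le_rfl, hgu' x h⟩⟩
  have hpass : ∀ t, P.curve t ∈ closure (ψ '' T) →
      (∃ x ∈ Set.Icc p 0, SameParam (τ 0 + -1 * x) t) ∨
      (∃ x ∈ Set.Icc 0 q, SameParam (τ 1 + -1 * x) t) ∨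
      ∃ x ∈ Set.Icc p q, SameParam (τ 2 + 1 * x) t := by
    intro t ht
    rw [hcl] at ht
    obtain ⟨⟨x, y⟩, hz, hzt⟩ := ht
    rcases hcov t _ (hT'sq hz) hzt.symm with ⟨h1, h2⟩ | ⟨h1, h2⟩ | ⟨h1, h2⟩
    · simp only at h1 h2; subst h1; exact Or.inl ⟨x, (hb0 x).1 hz, h2⟩
    · simp only at h1 h2; subst h1; exact Or.inr (Or.inl ⟨x, (hb1 x).1 hz, h2⟩)
    · simp only at h1 h2; subst h1; exact Or.inr (Or.inr ⟨x, (hb2 x).1 hz, h2⟩)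
  -- The three corners.
  have h0I : (0 : ℝ) ∈ Set.Ioo (-1 : ℝ) 1 := ⟨by norm_num, by norm_num⟩
  obtain ⟨hd01, hd10⟩ := hs0.mem_doubleParams hs1 (x := 0) (Set.Ioo_subset_Icc_self h0I)
    (by norm_num) (not_sameParam_of_parallel hψ hs0 hs1 (by norm_num) 0)
  obtain ⟨hd02, hd20⟩ := hs0.mem_doubleParams hs2 (x := p) (Set.Ioo_subset_Icc_self hpI)
    hgp.symm (not_sameParam_of_antiparallel hψ hs0 hs2 hpI)
  obtain ⟨hd12, hd21⟩ := hs1.mem_doubleParams hs2 (x := q) (Set.Ioo_subset_Icc_self hqI)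
    hgq.symm (not_sameParam_of_antiparallel hψ hs1 hs2 hqI)
  have hne_of : ∀ {τ' d' x t : ℝ}, SameParam (τ' + d' * x) t → τ' + d' * x ∈ P.doubleParams →
      t ∉ P.doubleParams → False := fun h1 h2 h3 => h3 (mem_doubleParams_of_sameParam h1 h2)
  have hcoh : P.IsCoherent (ψ '' T) := by
    left
    intro t ht htc
    have hdown : ∀ x ∈ Set.Ioo p q, ∀ᶠ ε in 𝓝[>] (0 : ℝ), ψ (x, u x + -1 * ε) ∈ ψ '' T := by
      intro x hx
      filter_upwards [Ioo_mem_nhdsGT (sub_pos.2 (hgu x hx))] with ε hε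
      refine ⟨_, ⟨hx, ?_, ?_⟩, rfl⟩ <;> simp only <;> linarith [hε.1, hε.2]
    have hupw : ∀ x ∈ Set.Ioo p q, ∀ᶠ ε in 𝓝[>] (0 : ℝ), ψ (x, g x + 1 * ε) ∈ ψ '' T := by
      intro x hx
      filter_upwards [Ioo_mem_nhdsGT (sub_pos.2 (hgu x hx))] with ε hε
      refine ⟨_, ⟨hx, ?_, ?_⟩, rfl⟩ <;> simp only <;> linarith [hε.1, hε.2]
    have hpq : ∀ x ∈ Set.Ioo p q, x ∈ Set.Ioo (-1 : ℝ) 1 := fun x hx =>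
      ⟨by linarith [hx.1, hpI.1], by linarith [hx.2, hqI.2]⟩
    rcases hpass t htc with ⟨x, hx, hxt⟩ | ⟨x, hx, hxt⟩ | ⟨x, hx, hxt⟩
    · have hxp : x ≠ p := by rintro rfl; exact hne_of hxt hd02 ht
      have hx0 : x ≠ 0 := by rintro rfl; exact hne_of hxt hd01 ht
      have hxI : x ∈ Set.Ioo p q :=
        ⟨lt_of_le_of_ne hx.1 hxp.symm, (lt_of_le_of_ne hx.2 hx0).trans hq⟩
      rw [← onLeft_iff_of_sameParam hxt, hs0.onLeft_iff hψ hF (hpq x hxI)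
        (fun h1 => hne_of hxt h1 ht) (c := -1) (by norm_num), ← hun x hx.2]
      exact hdown x hxI
    · have hxq : x ≠ q := by rintro rfl; exact hne_of hxt hd12 ht
      have hx0 : x ≠ 0 := by rintro rfl; exact hne_of hxt hd10 ht
      have hxI : x ∈ Set.Ioo p q :=
        ⟨hp.trans (lt_of_le_of_ne hx.1 hx0.symm), lt_of_le_of_ne hx.2 hxq⟩
      rw [← onLeft_iff_of_sameParam hxt, hs1.onLeft_iff hψ hF (hpq x hxI)
        (fun h1 => hne_of hxt h1 ht) (c := -1) (by norm_num), ← hup x hx.1]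
      exact hdown x hxI
    · have hxp : x ≠ p := by rintro rfl; exact hne_of hxt hd20 ht
      have hxq : x ≠ q := by rintro rfl; exact hne_of hxt hd21 ht
      have hxI : x ∈ Set.Ioo p q := ⟨lt_of_le_of_ne hx.1 hxp.symm, lt_of_le_of_ne hx.2 hxq⟩
      rw [← onLeft_iff_of_sameParam hxt, hs2.onLeft_iff hψ hF (hpq x hxI)
        (fun h1 => hne_of hxt h1 ht) (c := 1) (by norm_num)]
      exact hupw x hxI
  refine ⟨_, hF, hcoh, ?_⟩
  -- Abscissas of double points on the three sides.
  have hdbl : ∀ {τ' d' x a : ℝ}, x ∈ Set.Icc p q → SameParam (τ' + d' * x) a →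
      a ∈ P.doubleParams → ∀ y, P.curve (τ' + d' * x) = ψ (x, y) → (x, y) ∈ T' →
      ∃ s, ¬ SameParam s (τ' + d' * x) ∧ ((y = x / 2 ∧ SameParam (τ 0 + -1 * x) s) ∨
        (y = -x / 2 ∧ SameParam (τ 1 + -1 * x) s) ∨ (y = g x ∧ SameParam (τ 2 + 1 * x) s)) := by
    intro τ' d' x a hx hxa ha y hy hT1
    obtain ⟨s, hs, hns⟩ := mem_doubleParams_of_sameParam hxa.symm ha
    exact ⟨s, hns, hcov s (x, y) (hT'sq hT1) (by rw [hs, hy])⟩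
  -- Each strand runs along the boundary of the triangle from one corner to another: the first from
  -- abscissa `0` to `p`, the second from `q` to `0`, the third from `p` to `q`.
  have hstart : (fun a : ℝ => (a : AddCircle (2 * Real.pi))) '' P.startSet (ψ '' T) =
      {((τ 0 + -1 * 0 : ℝ) : AddCircle (2 * Real.pi)), ((τ 1 + -1 * q : ℝ) : AddCircle _),
        ((τ 2 + 1 * p : ℝ) : AddCircle _)} := by
    ext θ
    simp only [Set.mem_insert_iff, Set.mem_singleton_iff]
    constructor
    · rintro ⟨a, ⟨had, has⟩, rfl⟩
      have hac : P.curve a ∈ closure (ψ '' T) := isClosed_closure.mem_of_tendsto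
        (P.continuous_curve.continuousAt.mono_left nhdsWithin_le_nhds :
          Tendsto P.curve (𝓝[>] a) (𝓝 (P.curve a))) has
      rw [hcl] at has
      simp only
      rcases hpass a hac with ⟨x, hx, hxa⟩ | ⟨x, hx, hxa⟩ | ⟨x, hx, hxa⟩
      · left
        obtain ⟨s, hns, hs⟩ := hdbl ⟨hx.1, by linarith [hx.2]⟩ hxa had (x / 2)
          (hs0 x (hIcc ⟨hx.1, by linarith [hx.2]⟩)) ((hb0 x).2 hx)
        have hx0 : x = 0 := by
          rcases hs with ⟨-, h1⟩ | ⟨h1, -⟩ | ⟨h1, -⟩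
          · exact absurd h1.symm hns
          · linarith
          · rcases eq_or_lt_of_le hx.1 with h2 | h2
            · subst h2
              obtain ⟨e, he, -, z, hz, hze⟩ := hs0.exists_mem_of_eventually (Or.inr rfl) hpI hxa
                has 1 one_pos
              have h3 := hz.1.1
              rw [hψ.injective hze] at h3
              simp only at h3
              linarith [he.1]
            · exact absurd h1 (hgp2 x ⟨h2, by linarith [hx.2]⟩).ne'
        rw [← hx0]
        exact (sameParam_iff_coe_eq.1 hxa).symm
      · right; left
        obtain ⟨s, hns, hs⟩ := hdbl ⟨by linarith [hx.1], hx.2⟩ hxa had (-x / 2)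
          (hs1 x (hIcc ⟨by linarith [hx.1], hx.2⟩)) ((hb1 x).2 hx)
        have hx0 : x = 0 ∨ x = q := by
          rcases hs with ⟨h1, -⟩ | ⟨-, h1⟩ | ⟨h1, -⟩
          · left; linarith
          · exact absurd h1.symm hns
          · right
            by_contra h2
            exact absurd h1 (hgq1 x ⟨by linarith [hx.1], lt_of_le_of_ne hx.2 h2⟩).ne'
        rcases hx0 with rfl | rfl
        · obtain ⟨e, he, -, hz⟩ := hs1.exists_mem_of_eventually (Or.inr rfl) h0I hxa has 1 one_pos
          have h3 := ((hb1 _).1 ((hψ.injective.mem_set_image).1 hz)).1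
          linarith [he.1]
        · exact (sameParam_iff_coe_eq.1 hxa).symm
      · right; right
        obtain ⟨s, hns, hs⟩ := hdbl hx hxa had (g x) (hs2 x (hIcc hx)) ((hb2 x).2 hx)
        have hx0 : x = p ∨ x = q := by
          by_contra! h2
          have h3 := hgu x ⟨lt_of_le_of_ne hx.1 h2.1.symm, lt_of_le_of_ne hx.2 h2.2⟩
          rcases hs with ⟨h1, -⟩ | ⟨h1, -⟩ | ⟨-, h1⟩
          · linarith [hu1 x]
          · linarith [hu2 x]
          · exact absurd h1.symm hns
        rcases hx0 with rfl | rfl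
        · exact (sameParam_iff_coe_eq.1 hxa).symm
        · obtain ⟨e, he, -, hz⟩ := hs2.exists_mem_of_eventually (Or.inl rfl) hqI hxa has 1 one_pos
          have h3 := ((hb2 _).1 ((hψ.injective.mem_set_image).1 hz)).2
          linarith [he.1]
    · rintro (rfl | rfl | rfl)
      · refine ⟨_, ⟨hd01, ?_⟩, rfl⟩
        rw [hcl]
        refine hs0.eventually_of_forall (Or.inr rfl) h0I (neg_pos.2 hp) fun e he _ => ?_
        exact ⟨_, (hb0 _).2 ⟨by linarith [he.2], by linarith [he.1]⟩, rfl⟩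
      · refine ⟨_, ⟨hd12, ?_⟩, rfl⟩
        rw [hcl]
        refine hs1.eventually_of_forall (Or.inr rfl) hqI hq fun e he _ => ?_
        exact ⟨_, (hb1 _).2 ⟨by linarith [he.2], by linarith [he.1]⟩, rfl⟩
      · refine ⟨_, ⟨hd20, ?_⟩, rfl⟩
        rw [hcl]
        refine hs2.eventually_of_forall (Or.inl rfl) hpI (neg_pos.2 hp) fun e he _ => ?_
        exact ⟨_, (hb2 _).2 ⟨by linarith [he.1], by linarith [he.2]⟩, rfl⟩
  have hdist : ∀ {τ₁ τ₂ d₁ d₂ x y : ℝ} {f₁ f₂ : ℝ → ℝ}, P.IsStrand ψ τ₁ d₁ f₁ →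
      P.IsStrand ψ τ₂ d₂ f₂ → x ∈ Set.Ioo (-1 : ℝ) 1 → y ∈ Set.Ioo (-1 : ℝ) 1 → x ≠ y →
      ((τ₁ + d₁ * x : ℝ) : AddCircle (2 * Real.pi)) ≠ ((τ₂ + d₂ * y : ℝ) : AddCircle _) := by
    intro τ₁ τ₂ d₁ d₂ x y f₁ f₂ h1 h2 hx hy hxy he
    have h3 := P.curve_eq_of_sameParam (sameParam_iff_coe_eq.2 he)
    rw [h1 x (Set.Ioo_subset_Icc_self hx), h2 y (Set.Ioo_subset_Icc_self hy)] at h3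
    exact hxy (congrArg Prod.fst (hψ.injective h3))
  rw [ncard_sides hF, hstart, Set.ncard_eq_three.2 ⟨_, _, _, hdist hs0 hs1 h0I hqI hq.ne,
    hdist hs0 hs2 h0I hpI hp.ne', hdist hs1 hs2 hqI hpI (by linarith), rfl⟩]
  decide

/-- The knot projection run through in the opposite direction. -/
def reverse (P : KnotProjection) : KnotProjection where
  curve t := P.curve (-t)
  smooth := P.smooth.comp contDiff_neg
  periodic t := P.curve_eq_of_sameParam ⟨1, by push_cast; ring⟩
  mem_sphere t := P.mem_sphere _
  immersion t := by
    rw [deriv_comp_neg]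
    exact neg_ne_zero.2 (P.immersion _)
  transverse s t h hn := by
    have h1 := P.transverse _ _ h fun ⟨n, hn'⟩ => hn ⟨-n, by push_cast; linarith⟩
    rw [deriv_comp_neg, deriv_comp_neg]
    have h2 := h1.units_smul ![-1, -1]
    convert h2 using 1
    ext i j
    fin_cases i <;> simp
  no_triple s t u h1 h2 := by
    have hneg : ∀ {a b : ℝ}, SameParam (-a) (-b) → SameParam a b := fun ⟨n, hn⟩ =>
      ⟨-n, by push_cast; linarith⟩
    exact (P.no_triple _ _ _ h1 h2).imp hneg (Or.imp hneg hneg)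
  finite_double := by
    refine P.finite_double.subset ?_
    rintro p ⟨s, t, hs, ht, hn⟩
    exact ⟨-s, -t, hs, ht, fun ⟨n, hn'⟩ => hn ⟨-n, by push_cast; linarith⟩⟩

lemma reparam_reverse (P : KnotProjection) : P.Reparam P.reverse :=
  ⟨fun t => -t, contDiff_neg, fun t => by simp, Or.inr fun t => by ring, fun _ => rfl⟩

/-- The rotation by a half turn, followed by a planar chart. -/
lemma IsPlanarChart.comp_neg (hψ : IsPlanarChart ψ) : IsPlanarChart fun z => ψ (-z) where
  smooth := hψ.smooth.comp contDiff_neg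
  injective := hψ.injective.comp neg_injective
  mem_sphere z := hψ.mem_sphere _
  oriented z := by
    have h1 := hψ.triple_pos (-z)
    have h2 : fderiv ℝ (fun z => ψ (-z)) z = -fderiv ℝ ψ (-z) := by
      have h3 := ((hψ.smooth.differentiable (by simp) (-z)).hasFDerivAt.comp z
        (hasFDerivAt_id z).neg).fderiv
      refine h3.trans (ContinuousLinearMap.ext fun v => ?_)
      simp
    rw [h2]
    have h3 := triple_smul_middle (ψ (-z)) (fderiv ℝ ψ (-z) (1, 0)) (fderiv ℝ ψ (-z) (0, 1)) (-1)
    have h4 := triple_smul_right (ψ (-z)) ((-1 : ℝ) • fderiv ℝ ψ (-z) (1, 0))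
      (fderiv ℝ ψ (-z) (0, 1)) (-1)
    rw [h3, neg_one_smul, neg_one_smul] at h4
    change 0 < triple (ψ (-z)) (-fderiv ℝ ψ (-z) (1, 0)) (-fderiv ℝ ψ (-z) (0, 1))
    rw [h4]
    linarith

/-- Both sides of a strong third move have a coherent triangle. For the side with the triangle above
the origin, rotate the picture by a half turn and reverse the direction of the curve. -/
lemma cohOdd_eq_of_strongRIII {P P' : KnotProjection} (h : P.StrongRIII P') :
    P.cohOdd = P'.cohOdd := by
  obtain ⟨g, k, p, q, p', q', hg, hp, hq, hk, hq', hp', ψ, τ, hψ, h1, h2, -⟩ := h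
  refine cohOdd_eq_cohOdd ⟨fun _ => ?_, fun _ => exists_isOddCoherent_of_triangle hψ h1 hg hp hq⟩
  suffices ∃ F, P'.reverse.IsOddCoherent F by
    obtain ⟨F, hF⟩ := this
    exact ⟨F, (isOddCoherent_iff_of_reparam P'.reparam_reverse F).1 hF⟩
  refine exists_isOddCoherent_of_triangle (g := fun x => -k (-x)) (p := -p') (q := -q')
    (τ := fun i => -τ i) hψ.comp_neg ⟨?_, ?_⟩ ?_ (neg_neg_of_pos hp') (neg_pos.2 hq')
  · intro i x hx
    have hx' : -x ∈ Set.Icc (-1 : ℝ) 1 := ⟨by linarith [hx.2], by linarith [hx.1]⟩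
    have h3 := h2.1 i (-x) hx'
    change P'.curve (-(-τ i + _)) = ψ (-(x, _))
    rw [neg_add, neg_neg, ← mul_neg, h3]
    refine congrArg ψ (Prod.ext rfl ?_)
    fin_cases i
    · change -x / 2 = -(x / 2); ring
    · change - -x / 2 = -(-x / 2); ring
    · exact (neg_neg _).symm
  · rintro t ⟨z, hz, hzt⟩
    have hz' : -z ∈ square := by
      rw [mem_square] at *
      simp only [Prod.fst_neg, Prod.snd_neg]
      constructor <;> constructor <;> linarith [hz.1.1, hz.1.2, hz.2.1, hz.2.2]
    obtain ⟨i, n, hn⟩ := h2.2 (-t) ⟨-z, hz', hzt⟩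
    refine ⟨i, -n, ?_⟩
    rw [← abs_neg]
    convert hn using 2
    push_cast; ring
  · obtain ⟨a1, a2, a3, a4, a5, a6, a7, a8, a9⟩ := hk
    refine ⟨⟨by linarith [a1.2], by linarith [a1.1]⟩, ⟨by linarith [a2.2], by linarith [a2.1]⟩,
      ?_, ?_, ?_, ?_, ?_, ?_, ?_⟩
    · intro x hx
      simp only [abs_neg]
      exact a3 (-x) ⟨by linarith [hx.2], by linarith [hx.1]⟩
    · simp only [neg_neg, a4]; ring
    · intro x hx
      have := a6 (-x) ⟨by linarith [hx.2], by linarith [hx.1]⟩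
      simp only; linarith
    · intro x hx
      have := a5 (-x) ⟨by linarith [hx.2], by linarith [hx.1]⟩
      simp only; linarith
    · simp only [neg_neg, a7]; ring
    · intro x hx
      have := a9 (-x) ⟨by linarith [hx.2], by linarith [hx.1]⟩
      simp only; linarith
    · intro x hx
      have := a8 (-x) ⟨by linarith [hx.2], by linarith [hx.1]⟩
      simp only; linarith

end KnotProjection

namespace KnotProjection

/-! ### Two parallel strands and the band between them -/

/-- The closed band between the graphs of `0` and `g` over `[-1, 1]`. -/
def band (g : ℝ → ℝ) : Set (ℝ × ℝ) :=
  {z | z.1 ∈ Set.Icc (-1) 1 ∧ min 0 (g z.1) ≤ z.2 ∧ z.2 ≤ max 0 (g z.1)}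

/-- The part of the square above both graphs. -/
def above (g : ℝ → ℝ) : Set (ℝ × ℝ) := {z | z ∈ square ∧ max 0 (g z.1) < z.2}

/-- The part of the square below both graphs. -/
def below (g : ℝ → ℝ) : Set (ℝ × ℝ) := {z | z ∈ square ∧ z.2 < min 0 (g z.1)}

/-- The map that is affine on vertical segments and takes the parts of the square above and below
the band of `g` to the parts above and below the band of `g'`. Its values on the band are
irrelevant. -/
noncomputable def rescale (g g' : ℝ → ℝ) (z : ℝ × ℝ) : ℝ × ℝ :=
  open Classical in
  if max 0 (g z.1) < z.2 then
    (z.1, 1 - (1 - z.2) * (1 - max 0 (g' z.1)) / (1 - max 0 (g z.1)))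
  else (z.1, -1 + (1 + z.2) * (1 + min 0 (g' z.1)) / (1 + min 0 (g z.1)))

section Rescale

variable {g g' : ℝ → ℝ}

lemma max_lt_one {x : ℝ} (hg : ∀ x ∈ Set.Icc (-1 : ℝ) 1, |g x| < 1)
    (hx : x ∈ Set.Icc (-1 : ℝ) 1) : 0 < 1 - max 0 (g x) :=
  sub_pos.2 (max_lt one_pos (abs_lt.1 (hg x hx)).2)

lemma neg_one_lt_min {x : ℝ} (hg : ∀ x ∈ Set.Icc (-1 : ℝ) 1, |g x| < 1)
    (hx : x ∈ Set.Icc (-1 : ℝ) 1) : 0 < 1 + min 0 (g x) := by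
  have := lt_min (by norm_num : (-1 : ℝ) < 0) (abs_lt.1 (hg x hx)).1
  linarith

lemma rescale_of_above {z : ℝ × ℝ} (hz : z ∈ above g) :
    rescale g g' z = (z.1, 1 - (1 - z.2) * (1 - max 0 (g' z.1)) / (1 - max 0 (g z.1))) :=
  if_pos hz.2

lemma not_above_of_below {z : ℝ × ℝ} (hz : z ∈ below g) : ¬ max 0 (g z.1) < z.2 := by
  have h1 := hz.2
  have h2 : min 0 (g z.1) ≤ max 0 (g z.1) := min_le_max
  linarith

lemma rescale_of_below {z : ℝ × ℝ} (hz : z ∈ below g) :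
    rescale g g' z = (z.1, -1 + (1 + z.2) * (1 + min 0 (g' z.1)) / (1 + min 0 (g z.1))) :=
  if_neg (not_above_of_below hz)

lemma rescale_mem_above (hg : ∀ x ∈ Set.Icc (-1 : ℝ) 1, |g x| < 1)
    (hg' : ∀ x ∈ Set.Icc (-1 : ℝ) 1, |g' x| < 1) {z : ℝ × ℝ} (hz : z ∈ above g) :
    rescale g g' z ∈ above g' := by
  have h1 := max_lt_one hg hz.1.1
  have h2 := max_lt_one hg' hz.1.1
  have h3 := hz.2
  have h4 := hz.1.2.2
  rw [rescale_of_above hz]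
  have h5 : (1 - z.2) * (1 - max 0 (g' z.1)) / (1 - max 0 (g z.1)) < 1 - max 0 (g' z.1) := by
    rw [div_lt_iff₀ h1, mul_comm]
    exact mul_lt_mul_of_pos_left (by linarith) h2
  have h6 : 0 ≤ (1 - z.2) * (1 - max 0 (g' z.1)) / (1 - max 0 (g z.1)) :=
    div_nonneg (mul_nonneg (by linarith) h2.le) h1.le
  have h7 : 0 ≤ max 0 (g' z.1) := le_max_left _ _
  refine ⟨⟨hz.1.1, ?_, ?_⟩, ?_⟩ <;> simp only <;> linarith

lemma rescale_mem_below (hg : ∀ x ∈ Set.Icc (-1 : ℝ) 1, |g x| < 1)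
    (hg' : ∀ x ∈ Set.Icc (-1 : ℝ) 1, |g' x| < 1) {z : ℝ × ℝ} (hz : z ∈ below g) :
    rescale g g' z ∈ below g' := by
  have h1 := neg_one_lt_min hg hz.1.1
  have h2 := neg_one_lt_min hg' hz.1.1
  have h3 := hz.2
  have h4 := hz.1.2.1
  rw [rescale_of_below hz]
  have h5 : (1 + z.2) * (1 + min 0 (g' z.1)) / (1 + min 0 (g z.1)) < 1 + min 0 (g' z.1) := by
    rw [div_lt_iff₀ h1, mul_comm]
    exact mul_lt_mul_of_pos_left (by linarith) h2
  have h6 : 0 ≤ (1 + z.2) * (1 + min 0 (g' z.1)) / (1 + min 0 (g z.1)) :=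
    div_nonneg (mul_nonneg (by linarith) h2.le) h1.le
  have h7 : min 0 (g' z.1) ≤ 0 := min_le_left _ _
  refine ⟨⟨hz.1.1, ?_, ?_⟩, ?_⟩ <;> simp only <;> linarith

lemma rescale_rescale (hg : ∀ x ∈ Set.Icc (-1 : ℝ) 1, |g x| < 1)
    (hg' : ∀ x ∈ Set.Icc (-1 : ℝ) 1, |g' x| < 1) {z : ℝ × ℝ} (hz : z ∈ above g ∪ below g) :
    rescale g' g (rescale g g' z) = z := by
  rcases hz with hz | hz
  · have h1 := max_lt_one hg hz.1.1
    have h2 := max_lt_one hg' hz.1.1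
    rw [rescale_of_above (rescale_mem_above hg hg' hz), rescale_of_above hz]
    refine Prod.ext rfl ?_
    simp only
    field_simp
    ring
  · have h1 := neg_one_lt_min hg hz.1.1
    have h2 := neg_one_lt_min hg' hz.1.1
    rw [rescale_of_below (rescale_mem_below hg hg' hz), rescale_of_below hz]
    refine Prod.ext rfl ?_
    simp only
    field_simp
    ring

lemma rescale_eq_self (hg : ∀ x ∈ Set.Icc (-1 : ℝ) 1, |g x| < 1) (h1 : g 1 = g' 1)
    (h2 : g (-1) = g' (-1)) {z : ℝ × ℝ} (hz : z ∈ above g ∪ below g) (hn : square ∉ 𝓝 z) :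
    rescale g g' z = z := by
  have hsq : z ∈ square := hz.elim (·.1) (·.1)
  have hbd : g' z.1 = g z.1 ∨ z.2 = -1 ∨ z.2 = 1 := by
    by_contra! h
    refine hn (prod_mem_nhds (Icc_mem_nhds ?_ ?_) (Icc_mem_nhds ?_ ?_))
    · refine lt_of_le_of_ne hsq.1.1 fun h3 => h.1 ?_
      rw [← h3, h2]
    · refine lt_of_le_of_ne hsq.1.2 fun h3 => h.1 ?_
      rw [h3, h1]
    · exact lt_of_le_of_ne hsq.2.1 (Ne.symm h.2.1)
    · exact lt_of_le_of_ne hsq.2.2 h.2.2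
  rcases hz with hz | hz
  · have h3 := max_lt_one hg hz.1.1
    have h4 : -1 < z.2 := by
      have := hz.2
      have := le_max_left 0 (g z.1)
      linarith
    rw [rescale_of_above hz]
    refine Prod.ext rfl ?_
    simp only
    rcases hbd with h | h | h
    · rw [h, mul_div_cancel_right₀ _ h3.ne']; ring
    · linarith
    · rw [h]; simp
  · have h3 := neg_one_lt_min hg hz.1.1
    have h4 : z.2 < 1 := by
      have := hz.2
      have := min_le_left 0 (g z.1)
      linarith
    rw [rescale_of_below hz]
    refine Prod.ext rfl ?_
    simp only
    rcases hbd with h | h | h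
    · rw [h, mul_div_cancel_right₀ _ h3.ne']; ring
    · rw [h]; simp
    · linarith

lemma continuousOn_rescale (hg : ∀ x ∈ Set.Icc (-1 : ℝ) 1, |g x| < 1)
    (hgc : ContinuousOn g (Set.Icc (-1) 1)) (hgc' : ContinuousOn g' (Set.Icc (-1) 1)) :
    ContinuousOn (rescale g g') (above g ∪ below g) := by
  have hmaps : Set.MapsTo Prod.fst (above g ∪ below g) (Set.Icc (-1 : ℝ) 1) := fun z hz =>
    hz.elim (·.1.1) (·.1.1)
  have h1 : ContinuousOn (fun z : ℝ × ℝ => g z.1) (above g ∪ below g) :=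
    hgc.comp continuousOn_fst hmaps
  have h2 : ContinuousOn (fun z : ℝ × ℝ => g' z.1) (above g ∪ below g) :=
    hgc'.comp continuousOn_fst hmaps
  have hc0 : ∀ c : ℝ, ContinuousOn (fun _ : ℝ × ℝ => c) (above g ∪ below g) :=
    fun c => continuousOn_const
  have hs2 : ContinuousOn (fun z : ℝ × ℝ => z.2) (above g ∪ below g) := continuousOn_snd
  have hmax := (hc0 0).sup h1
  have hmin := (hc0 0).inf h1
  intro z hz
  have hzI := hmaps hz
  rcases hz with hz | hz
  · have hc := continuousOn_fst.prodMk ((hc0 1).sub ((((hc0 1).sub hs2).mul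
      ((hc0 1).sub ((hc0 0).sup h2))).div ((hc0 1).sub hmax)
      fun w hw => (max_lt_one hg (hmaps hw)).ne'))
    refine (hc z (Or.inl hz)).congr_of_eventuallyEq ?_ (rescale_of_above hz)
    filter_upwards [(hmax z (Or.inl hz)).eventually_lt (hs2 z (Or.inl hz)) hz.2] with w hw
    exact if_pos hw
  · have hc := continuousOn_fst.prodMk ((hc0 (-1)).add ((((hc0 1).add hs2).mul
      ((hc0 1).add ((hc0 0).inf h2))).div ((hc0 1).add hmin)
      fun w hw => (neg_one_lt_min hg (hmaps hw)).ne'))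
    refine (hc z (Or.inr hz)).congr_of_eventuallyEq ?_ (rescale_of_below hz)
    filter_upwards [(hs2 z (Or.inr hz)).eventually_lt (hmin z (Or.inr hz)) hz.2,
      self_mem_nhdsWithin] with w hw hwm
    exact rescale_of_below ⟨hwm.elim (·.1) (·.1), hw⟩

lemma mem_band_or (z : ℝ × ℝ) (hz : z ∈ square) : z ∈ band g ∨ z ∈ above g ∪ below g := by
  by_cases h1 : max 0 (g z.1) < z.2
  · exact Or.inr (Or.inl ⟨hz, h1⟩)
  by_cases h2 : z.2 < min 0 (g z.1)
  · exact Or.inr (Or.inr ⟨hz, h2⟩)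
  exact Or.inl ⟨hz.1, not_lt.1 h2, not_lt.1 h1⟩

lemma band_subset_square (hg : ∀ x ∈ Set.Icc (-1 : ℝ) 1, |g x| < 1) : band g ⊆ square := by
  rintro z ⟨h1, h2, h3⟩
  have h4 := max_lt_one hg h1
  have h5 := neg_one_lt_min hg h1
  exact ⟨h1, by linarith, by linarith⟩

lemma disjoint_band : Disjoint (band g) (above g ∪ below g) := by
  rw [Set.disjoint_left]
  rintro z ⟨-, h1, h2⟩ (h3 | h3)
  · exact absurd h3.2 (not_lt.2 h2)
  · exact absurd h3.2 (not_lt.2 h1)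

lemma isPreconnected_above (hg : ∀ x ∈ Set.Icc (-1 : ℝ) 1, |g x| < 1)
    (hgc : ContinuousOn g (Set.Icc (-1) 1)) : IsPreconnected (above g) := by
  have h : (fun w : ℝ × ℝ => (w.1, 1 - w.2 * (1 - max 0 (g w.1)))) ''
      (Set.Icc (-1) 1 ×ˢ Set.Ico 0 1) = above g := by
    ext z
    constructor
    · rintro ⟨w, ⟨h1, h2, h3⟩, rfl⟩
      have h4 := max_lt_one hg h1
      have h5 := mul_lt_mul_of_pos_right h3 h4
      have h6 := mul_nonneg h2 h4.le
      have h7 := le_max_left 0 (g w.1)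
      refine ⟨⟨h1, ?_, ?_⟩, ?_⟩ <;> simp only <;> linarith
    · rintro ⟨⟨h1, h2, h3⟩, h4⟩
      have h5 := max_lt_one hg h1
      refine ⟨(z.1, (1 - z.2) / (1 - max 0 (g z.1))),
        ⟨h1, div_nonneg (by linarith) h5.le, (div_lt_one h5).2 (by linarith)⟩, ?_⟩
      simp only
      rw [div_mul_cancel₀ _ h5.ne', sub_sub_cancel]
  rw [← h]
  refine (isPreconnected_Icc.prod isPreconnected_Ico).image _ ?_
  have h1 : ContinuousOn (fun w : ℝ × ℝ => g w.1) (Set.Icc (-1) 1 ×ˢ Set.Ico 0 1) :=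
    hgc.comp continuousOn_fst fun w hw => hw.1
  exact continuousOn_fst.prodMk (continuousOn_const.sub (continuousOn_snd.mul
    (continuousOn_const.sub (continuousOn_const.sup h1))))

lemma isPreconnected_below (hg : ∀ x ∈ Set.Icc (-1 : ℝ) 1, |g x| < 1)
    (hgc : ContinuousOn g (Set.Icc (-1) 1)) : IsPreconnected (below g) := by
  have h : (fun w : ℝ × ℝ => (w.1, -1 + w.2 * (1 + min 0 (g w.1)))) ''
      (Set.Icc (-1) 1 ×ˢ Set.Ico 0 1) = below g := by
    ext z
    constructor
    · rintro ⟨w, ⟨h1, h2, h3⟩, rfl⟩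
      have h4 := neg_one_lt_min hg h1
      have h5 := mul_lt_mul_of_pos_right h3 h4
      have h6 := mul_nonneg h2 h4.le
      have h7 := min_le_left 0 (g w.1)
      refine ⟨⟨h1, ?_, ?_⟩, ?_⟩ <;> simp only <;> linarith
    · rintro ⟨⟨h1, h2, h3⟩, h4⟩
      have h5 := neg_one_lt_min hg h1
      refine ⟨(z.1, (1 + z.2) / (1 + min 0 (g z.1))),
        ⟨h1, div_nonneg (by linarith) h5.le, (div_lt_one h5).2 (by linarith)⟩, ?_⟩
      simp only
      rw [div_mul_cancel₀ _ h5.ne', neg_add_cancel_left]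
  rw [← h]
  refine (isPreconnected_Icc.prod isPreconnected_Ico).image _ ?_
  have h1 : ContinuousOn (fun w : ℝ × ℝ => g w.1) (Set.Icc (-1) 1 ×ˢ Set.Ico 0 1) :=
    hgc.comp continuousOn_fst fun w hw => hw.1
  exact continuousOn_fst.prodMk (continuousOn_const.add (continuousOn_snd.mul
    (continuousOn_const.add (continuousOn_const.inf h1))))

lemma isCompact_band (hgc : ContinuousOn g (Set.Icc (-1) 1)) : IsCompact (band g) := by
  have h : (fun w : ℝ × ℝ => (w.1, w.2 * g w.1)) '' (Set.Icc (-1) 1 ×ˢ Set.Icc 0 1) = band g := by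
    ext z
    constructor
    · rintro ⟨w, ⟨h1, h2, h3⟩, rfl⟩
      refine ⟨h1, ?_, ?_⟩
      · rcases le_total 0 (g w.1) with h | h
        · exact (min_le_left _ _).trans (mul_nonneg h2 h)
        · refine (min_le_right _ _).trans ?_
          simp only; nlinarith
      · rcases le_total 0 (g w.1) with h | h
        · refine le_trans ?_ (le_max_right _ _)
          simp only; nlinarith
        · exact (mul_nonpos_of_nonneg_of_nonpos h2 h).trans (le_max_left _ _)
    · rintro ⟨h1, h2, h3⟩
      refine ⟨(z.1, z.2 / g z.1), ⟨h1, ?_⟩, Prod.ext rfl (div_mul_cancel_of_imp fun h => ?_)⟩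
      · rcases le_total 0 (g z.1) with h | h
        · rw [min_eq_left h] at h2
          rw [max_eq_right h] at h3
          exact ⟨div_nonneg h2 h, div_le_one_of_le₀ h3 h⟩
        · rw [min_eq_right h] at h2
          rw [max_eq_left h] at h3
          exact ⟨div_nonneg_of_nonpos h3 h, div_le_one_of_ge h2 h⟩
      · rw [h, min_self] at h2
        rw [h, max_self] at h3
        exact le_antisymm h3 h2
  rw [← h]
  refine (isCompact_Icc.prod isCompact_Icc).image_of_continuousOn ?_
  have h1 : ContinuousOn (fun w : ℝ × ℝ => g w.1) (Set.Icc (-1) 1 ×ˢ Set.Icc 0 1) :=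
    hgc.comp continuousOn_fst fun w hw => hw.1
  exact continuousOn_fst.prodMk (continuousOn_snd.mul h1)

end Rescale

end KnotProjection

namespace KnotProjection

lemma _root_.exists_mem_Ioo_of_eventually {x : ℝ} (hx : x ∈ Set.Icc (-1 : ℝ) 1) {p : ℝ → Prop}
    (h : ∀ᶠ y in 𝓝[Set.Icc (-1) 1] x, p y) : ∃ y ∈ Set.Ioo (-1 : ℝ) 1, p y := by
  have h1 : (𝓝[Set.Ioo (-1 : ℝ) 1] x).NeBot := by
    rw [← mem_closure_iff_nhdsWithin_neBot, closure_Ioo (by norm_num)]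
    exact hx
  obtain ⟨y, h2, h3⟩ := ((h.filter_mono (nhdsWithin_mono x Set.Ioo_subset_Icc_self)).and
    self_mem_nhdsWithin).exists
  exact ⟨y, h3, h2⟩

/-- In the disk `ψ(square)` the curve consists of two strands, the graph of `0` starting at time
`τ₀ - 1` and the graph of `g` starting at time `τ₁ - 1`. Both run to the right, and the second one
is above the first one at both ends. -/
structure BandPicture (P : KnotProjection) (ψ : ℝ × ℝ → E3) (τ₀ τ₁ : ℝ) (g : ℝ → ℝ) : Prop where
  chart : IsPlanarChart ψ
  flat : P.IsStrand ψ τ₀ 1 (fun _ => 0)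
  graph : P.IsStrand ψ τ₁ 1 g
  lt_one : ∀ x ∈ Set.Icc (-1 : ℝ) 1, |g x| < 1
  cover : ∀ t, ∀ z ∈ square, P.curve t = ψ z →
    (z.2 = 0 ∧ SameParam (τ₀ + 1 * z.1) t) ∨ (z.2 = g z.1 ∧ SameParam (τ₁ + 1 * z.1) t)
  left_pos : 0 < g (-1)
  right_pos : 0 < g 1

namespace BandPicture

variable {P : KnotProjection} {ψ : ℝ × ℝ → E3} {τ₀ τ₁ : ℝ} {g : ℝ → ℝ} {F : Set E3}

lemma continuousOn (b : P.BandPicture ψ τ₀ τ₁ g) : ContinuousOn g (Set.Icc (-1) 1) :=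
  b.graph.continuousOn b.chart

lemma not_sameParam (b : P.BandPicture ψ τ₀ τ₁ g) (x : ℝ) :
    ¬ SameParam (τ₀ + 1 * x) (τ₁ + 1 * x) :=
  not_sameParam_of_parallel b.chart b.flat b.graph b.right_pos.ne x

lemma mem_square (b : P.BandPicture ψ τ₀ τ₁ g) {x : ℝ} (hx : x ∈ Set.Icc (-1 : ℝ) 1) :
    (x, (0 : ℝ)) ∈ square ∧ (x, g x) ∈ square := by
  have h1 := abs_lt.1 (b.lt_one x hx)
  exact ⟨⟨hx, by norm_num, by norm_num⟩, hx, h1.1.le, h1.2.le⟩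

lemma flat_mem_doubleParams_iff (b : P.BandPicture ψ τ₀ τ₁ g) {x : ℝ}
    (hx : x ∈ Set.Icc (-1 : ℝ) 1) : τ₀ + 1 * x ∈ P.doubleParams ↔ g x = 0 := by
  constructor
  · rintro ⟨s, hs, hn⟩
    rw [b.flat x hx] at hs
    rcases b.cover s (x, 0) (b.mem_square hx).1 hs with h | h
    · exact absurd h.2.symm hn
    · exact h.1.symm
  · exact fun h => (b.flat.mem_doubleParams b.graph hx h.symm (b.not_sameParam x)).1

lemma graph_mem_doubleParams_iff (b : P.BandPicture ψ τ₀ τ₁ g) {x : ℝ}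
    (hx : x ∈ Set.Icc (-1 : ℝ) 1) : τ₁ + 1 * x ∈ P.doubleParams ↔ g x = 0 := by
  constructor
  · rintro ⟨s, hs, hn⟩
    rw [b.graph x hx] at hs
    rcases b.cover s (x, g x) (b.mem_square hx).2 hs with h | h
    · exact h.1
    · exact absurd h.2.symm hn
  · exact fun h => (b.flat.mem_doubleParams b.graph hx h.symm (b.not_sameParam x)).2

lemma eq_or_eq_of_mem_image (b : P.BandPicture ψ τ₀ τ₁ g) {z : ℝ × ℝ} (hz : z ∈ square)
    (h : ψ z ∈ P.image) : z.2 = 0 ∨ z.2 = g z.1 := by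
  obtain ⟨t, ht⟩ := h
  exact (b.cover t z hz ht).imp And.left And.left

lemma mem_image_of_eq_or_eq (b : P.BandPicture ψ τ₀ τ₁ g) {z : ℝ × ℝ}
    (hz : z.1 ∈ Set.Icc (-1 : ℝ) 1) (h : z.2 = 0 ∨ z.2 = g z.1) : ψ z ∈ P.image := by
  rcases h with h | h
  · exact ⟨_, (b.flat z.1 hz).trans (congrArg ψ (Prod.ext rfl h.symm))⟩
  · exact ⟨_, (b.graph z.1 hz).trans (congrArg ψ (Prod.ext rfl h.symm))⟩

lemma strictly_between (b : P.BandPicture ψ τ₀ τ₁ g) {z : ℝ × ℝ} (hz : z ∈ band g)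
    (h : ψ z ∉ P.image) : min 0 (g z.1) < z.2 ∧ z.2 < max 0 (g z.1) := by
  have h1 : z.2 ≠ 0 := fun h1 => h (b.mem_image_of_eq_or_eq hz.1 (Or.inl h1))
  have h2 : z.2 ≠ g z.1 := fun h1 => h (b.mem_image_of_eq_or_eq hz.1 (Or.inr h1))
  constructor
  · refine lt_of_le_of_ne hz.2.1 ?_
    rcases min_choice 0 (g z.1) with h3 | h3 <;> rw [h3]
    exacts [h1.symm, h2.symm]
  · refine lt_of_le_of_ne hz.2.2 ?_
    rcases max_choice 0 (g z.1) with h3 | h3 <;> rw [h3]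
    exacts [h1, h2]

lemma image_above_subset (b : P.BandPicture ψ τ₀ τ₁ g) :
    ψ '' above g ⊆ sphere2 \ P.image := by
  rintro _ ⟨z, hz, rfl⟩
  refine ⟨b.chart.mem_sphere z, fun h => ?_⟩
  have h1 := hz.2
  rcases b.eq_or_eq_of_mem_image hz.1 h with h2 | h2
  · exact absurd (le_max_left 0 (g z.1)) (not_le.2 (h2 ▸ h1))
  · exact absurd (le_max_right 0 (g z.1)) (not_le.2 (h2 ▸ h1))

lemma image_below_subset (b : P.BandPicture ψ τ₀ τ₁ g) :
    ψ '' below g ⊆ sphere2 \ P.image := by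
  rintro _ ⟨z, hz, rfl⟩
  refine ⟨b.chart.mem_sphere z, fun h => ?_⟩
  have h1 := hz.2
  rcases b.eq_or_eq_of_mem_image hz.1 h with h2 | h2
  · exact absurd (min_le_left 0 (g z.1)) (not_le.2 (h2 ▸ h1))
  · exact absurd (min_le_right 0 (g z.1)) (not_le.2 (h2 ▸ h1))

lemma above_subset_face (b : P.BandPicture ψ τ₀ τ₁ g) (hF : P.IsFace F)
    (h : (F ∩ ψ '' above g).Nonempty) : ψ '' above g ⊆ F := by
  obtain ⟨x, h1, h2⟩ := h
  exact hF.subset_of_isPreconnected ((isPreconnected_above b.lt_one b.continuousOn).image _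
    b.chart.continuous.continuousOn) b.image_above_subset h2 h1

lemma below_subset_face (b : P.BandPicture ψ τ₀ τ₁ g) (hF : P.IsFace F)
    (h : (F ∩ ψ '' below g).Nonempty) : ψ '' below g ⊆ F := by
  obtain ⟨x, h1, h2⟩ := h
  exact hF.subset_of_isPreconnected ((isPreconnected_below b.lt_one b.continuousOn).image _
    b.chart.continuous.continuousOn) b.image_below_subset h2 h1

/-- A polygon that contains a point between the strands lies to the right of one strand and to the
left of the other one, because both run in the same direction. -/
lemma disjoint_band_of_isCoherent (b : P.BandPicture ψ τ₀ τ₁ g) (hF : P.IsFace F)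
    (hc : P.IsCoherent F) : Disjoint F (ψ '' band g) := by
  rw [Set.disjoint_left]
  rintro _ hzF ⟨z, hz, rfl⟩
  obtain ⟨hz1, hz2⟩ := b.strictly_between hz (hF.subset hzF).2
  have hcont := b.continuousOn z.1 hz.1
  have hev : ∀ᶠ x in 𝓝[Set.Icc (-1) 1] z.1,
      (min 0 (g x) < z.2 ∧ z.2 < max 0 (g x)) ∧ ψ (x, z.2) ∈ F := by
    have h1 : Tendsto (fun x : ℝ => ψ (x, z.2)) (𝓝[Set.Icc (-1) 1] z.1) (𝓝 (ψ z)) :=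
      ((b.chart.continuous.comp (Continuous.prodMk_left z.2)).tendsto z.1).mono_left
        nhdsWithin_le_nhds
    filter_upwards [(continuousWithinAt_const.inf hcont).eventually_lt continuousWithinAt_const hz1,
      continuousWithinAt_const.eventually_lt (continuousWithinAt_const.sup hcont) hz2,
      h1.eventually (hF.eventually_mem hzF)] with x h2 h3 h4
    exact ⟨⟨h2, h3⟩, h4 (b.chart.mem_sphere _)⟩
  obtain ⟨x, hx, ⟨hx1, hx2⟩, hxF⟩ := exists_mem_Ioo_of_eventually hz.1 hev
  have hxI := Set.Ioo_subset_Icc_self hx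
  have hlt : min 0 (g x) < max 0 (g x) := hx1.trans hx2
  have hg0 : g x ≠ 0 := by
    intro h; rw [h, min_self, max_self] at hlt; exact lt_irrefl _ hlt
  have hsub : ∀ y ∈ Set.Ioo (min 0 (g x)) (max 0 (g x)), ψ (x, y) ∈ F := by
    intro y hy
    refine hF.subset_of_isPreconnected (S := (fun y => ψ (x, y)) '' Set.Ioo _ _)
      (isPreconnected_Ioo.image _
        (b.chart.continuous.comp (Continuous.prodMk_right x)).continuousOn) ?_
      ⟨z.2, ⟨hx1, hx2⟩, rfl⟩ hxF ⟨y, hy, rfl⟩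
    rintro _ ⟨w, hw, rfl⟩
    have hsq : (x, w) ∈ square := band_subset_square b.lt_one ⟨hxI, hw.1.le, hw.2.le⟩
    refine ⟨b.chart.mem_sphere _, fun h => ?_⟩
    rcases b.eq_or_eq_of_mem_image hsq h with h1 | h1 <;> simp only at h1 <;> rw [h1] at hw
    · rcases le_total 0 (g x) with h2 | h2
      · rw [min_eq_left h2] at hw; exact lt_irrefl _ hw.1
      · rw [max_eq_left h2] at hw; exact lt_irrefl _ hw.2
    · rcases le_total 0 (g x) with h2 | h2
      · rw [max_eq_right h2] at hw; exact lt_irrefl _ hw.2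
      · rw [min_eq_right h2] at hw; exact lt_irrefl _ hw.1
  have hpos : 0 < max 0 (g x) - min 0 (g x) := sub_pos.2 hlt
  have hup : ∀ᶠ ε in 𝓝[>] (0 : ℝ), ψ (x, min 0 (g x) + 1 * ε) ∈ F := by
    filter_upwards [Ioo_mem_nhdsGT hpos] with ε hε
    exact hsub _ ⟨by linarith [hε.1], by linarith [hε.2]⟩
  have hdown : ∀ᶠ ε in 𝓝[>] (0 : ℝ), ψ (x, max 0 (g x) + -1 * ε) ∈ F := by
    filter_upwards [Ioo_mem_nhdsGT hpos] with ε hε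
    exact hsub _ ⟨by linarith [hε.2], by linarith [hε.1]⟩
  have n0 : τ₀ + 1 * x ∉ P.doubleParams := fun h => hg0 ((b.flat_mem_doubleParams_iff hxI).1 h)
  have n1 : τ₁ + 1 * x ∉ P.doubleParams := fun h => hg0 ((b.graph_mem_doubleParams_iff hxI).1 h)
  have hl0 := b.flat.onLeft_iff b.chart hF hx n0 (c := 1) (by norm_num)
  have hl1 := b.graph.onLeft_iff b.chart hF hx n1 (c := 1) (by norm_num)
  have hr0 := b.flat.onRight_iff b.chart hF hx n0 (c := -1) (by norm_num)
  have hr1 := b.graph.onRight_iff b.chart hF hx n1 (c := -1) (by norm_num)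
  rcases le_total 0 (g x) with h | h
  · rw [min_eq_left h] at hup
    rw [max_eq_right h] at hdown
    rcases (isCoherent_iff hF).1 hc with h1 | h1
    · exact h1 _ n1 (hr1.2 hdown)
    · exact h1 _ n0 (hl0.2 hup)
  · rw [min_eq_right h] at hup
    rw [max_eq_left h] at hdown
    rcases (isCoherent_iff hF).1 hc with h1 | h1
    · exact h1 _ n0 (hr0.2 hdown)
    · exact h1 _ n1 (hl1.2 hup)

section Sides

variable {τ : ℝ} {f : ℝ → ℝ} {x : ℝ}

/-- To the left of the upper strand is what lies above the band. -/
lemma onLeft_iff_of_max (b : P.BandPicture ψ τ₀ τ₁ g) (hF : P.IsFace F) (hs : P.IsStrand ψ τ 1 f)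
    (hx : x ∈ Set.Ioo (-1 : ℝ) 1) (ht : τ + 1 * x ∉ P.doubleParams) (hf : f x = max 0 (g x)) :
    P.OnLeft F (τ + 1 * x) ↔ (F ∩ ψ '' above g).Nonempty := by
  have hxI := Set.Ioo_subset_Icc_self hx
  have hev : ∀ᶠ ε in 𝓝[>] (0 : ℝ), (x, f x + 1 * ε) ∈ above g := by
    filter_upwards [Ioo_mem_nhdsGT (max_lt_one b.lt_one hxI)] with ε hε
    have h1 : 0 ≤ max 0 (g x) := le_max_left _ _
    rw [hf]
    exact ⟨⟨hxI, by simp only; linarith [hε.1], by simp only; linarith [hε.2]⟩,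
      by simp only; linarith [hε.1]⟩
  rw [hs.onLeft_iff b.chart hF hx ht (c := 1) (by norm_num)]
  constructor
  · intro h
    obtain ⟨ε, h1, h2⟩ := (h.and hev).exists
    exact ⟨_, h1, _, h2, rfl⟩
  · intro h
    filter_upwards [hev] with ε h1
    exact b.above_subset_face hF h ⟨_, h1, rfl⟩

/-- To the right of the lower strand is what lies below the band. -/
lemma onRight_iff_of_min (b : P.BandPicture ψ τ₀ τ₁ g) (hF : P.IsFace F) (hs : P.IsStrand ψ τ 1 f)
    (hx : x ∈ Set.Ioo (-1 : ℝ) 1) (ht : τ + 1 * x ∉ P.doubleParams) (hf : f x = min 0 (g x)) :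
    P.OnRight F (τ + 1 * x) ↔ (F ∩ ψ '' below g).Nonempty := by
  have hxI := Set.Ioo_subset_Icc_self hx
  have hev : ∀ᶠ ε in 𝓝[>] (0 : ℝ), (x, f x + -1 * ε) ∈ below g := by
    filter_upwards [Ioo_mem_nhdsGT (neg_one_lt_min b.lt_one hxI)] with ε hε
    have h1 : min 0 (g x) ≤ 0 := min_le_left _ _
    rw [hf]
    exact ⟨⟨hxI, by simp only; linarith [hε.2], by simp only; linarith [hε.1]⟩,
      by simp only; linarith [hε.1]⟩
  rw [hs.onRight_iff b.chart hF hx ht (c := -1) (by norm_num)]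
  constructor
  · intro h
    obtain ⟨ε, h1, h2⟩ := (h.and hev).exists
    exact ⟨_, h1, _, h2, rfl⟩
  · intro h
    filter_upwards [hev] with ε h1
    exact b.below_subset_face hF h ⟨_, h1, rfl⟩

lemma not_onRight_of_max (b : P.BandPicture ψ τ₀ τ₁ g) (hF : P.IsFace F)
    (hFb : Disjoint F (ψ '' band g)) (hs : P.IsStrand ψ τ 1 f)
    (hx : x ∈ Set.Ioo (-1 : ℝ) 1) (ht : τ + 1 * x ∉ P.doubleParams) (hf : f x = max 0 (g x))
    (hg : g x ≠ 0) : ¬ P.OnRight F (τ + 1 * x) := by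
  have hlt : 0 < max 0 (g x) - min 0 (g x) := sub_pos.2 (min_lt_max.2 hg.symm)
  rw [hs.onRight_iff b.chart hF hx ht (c := -1) (by norm_num)]
  intro h
  obtain ⟨ε, h1, h2⟩ := (h.and (Ioo_mem_nhdsGT hlt)).exists
  refine Set.disjoint_left.1 hFb h1 ⟨_, ⟨Set.Ioo_subset_Icc_self hx, ?_, ?_⟩, rfl⟩ <;>
    simp only <;> linarith [h2.1, h2.2]

lemma not_onLeft_of_min (b : P.BandPicture ψ τ₀ τ₁ g) (hF : P.IsFace F)
    (hFb : Disjoint F (ψ '' band g)) (hs : P.IsStrand ψ τ 1 f)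
    (hx : x ∈ Set.Ioo (-1 : ℝ) 1) (ht : τ + 1 * x ∉ P.doubleParams) (hf : f x = min 0 (g x))
    (hg : g x ≠ 0) : ¬ P.OnLeft F (τ + 1 * x) := by
  have hlt : 0 < max 0 (g x) - min 0 (g x) := sub_pos.2 (min_lt_max.2 hg.symm)
  rw [hs.onLeft_iff b.chart hF hx ht (c := 1) (by norm_num)]
  intro h
  obtain ⟨ε, h1, h2⟩ := (h.and (Ioo_mem_nhdsGT hlt)).exists
  refine Set.disjoint_left.1 hFb h1 ⟨_, ⟨Set.Ioo_subset_Icc_self hx, ?_, ?_⟩, rfl⟩ <;>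
    simp only <;> linarith [h2.1, h2.2]

lemma curve_mem_closure_iff_of_max (b : P.BandPicture ψ τ₀ τ₁ g) (hF : P.IsFace F)
    (hFb : Disjoint F (ψ '' band g)) (hs : P.IsStrand ψ τ 1 f)
    (hx : x ∈ Set.Ioo (-1 : ℝ) 1) (ht : τ + 1 * x ∉ P.doubleParams) (hf : f x = max 0 (g x))
    (hg : g x ≠ 0) : ψ (x, f x) ∈ closure F ↔ (F ∩ ψ '' above g).Nonempty := by
  rw [← hs x (Set.Ioo_subset_Icc_self hx), curve_mem_closure_iff ht hF,
    b.onLeft_iff_of_max hF hs hx ht hf, or_iff_left (b.not_onRight_of_max hF hFb hs hx ht hf hg)]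

lemma curve_mem_closure_iff_of_min (b : P.BandPicture ψ τ₀ τ₁ g) (hF : P.IsFace F)
    (hFb : Disjoint F (ψ '' band g)) (hs : P.IsStrand ψ τ 1 f)
    (hx : x ∈ Set.Ioo (-1 : ℝ) 1) (ht : τ + 1 * x ∉ P.doubleParams) (hf : f x = min 0 (g x))
    (hg : g x ≠ 0) : ψ (x, f x) ∈ closure F ↔ (F ∩ ψ '' below g).Nonempty := by
  rw [← hs x (Set.Ioo_subset_Icc_self hx), curve_mem_closure_iff ht hF,
    b.onRight_iff_of_min hF hs hx ht hf, or_iff_right (b.not_onLeft_of_min hF hFb hs hx ht hf hg)]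

end Sides

lemma eventually_pos (b : P.BandPicture ψ τ₀ τ₁ g) : ∃ x ∈ Set.Ioo (-1 : ℝ) 1, 0 < g x :=
  exists_mem_Ioo_of_eventually ⟨le_rfl, by norm_num⟩
    ((b.continuousOn (-1) ⟨le_rfl, by norm_num⟩).eventually (lt_mem_nhds b.left_pos))

lemma exists_onLeft_of_above (b : P.BandPicture ψ τ₀ τ₁ g) (hF : P.IsFace F)
    (h : (F ∩ ψ '' above g).Nonempty) : ∃ t, t ∉ P.doubleParams ∧ P.OnLeft F t := by
  obtain ⟨x, hx, hg⟩ := b.eventually_pos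
  have ht : τ₁ + 1 * x ∉ P.doubleParams := fun h1 =>
    hg.ne' ((b.graph_mem_doubleParams_iff (Set.Ioo_subset_Icc_self hx)).1 h1)
  exact ⟨_, ht, (b.onLeft_iff_of_max hF b.graph hx ht (max_eq_right hg.le).symm).2 h⟩

lemma exists_onRight_of_below (b : P.BandPicture ψ τ₀ τ₁ g) (hF : P.IsFace F)
    (h : (F ∩ ψ '' below g).Nonempty) : ∃ t, t ∉ P.doubleParams ∧ P.OnRight F t := by
  obtain ⟨x, hx, hg⟩ := b.eventually_pos
  have ht : τ₀ + 1 * x ∉ P.doubleParams := fun h1 =>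
    hg.ne' ((b.flat_mem_doubleParams_iff (Set.Ioo_subset_Icc_self hx)).1 h1)
  exact ⟨_, ht, (b.onRight_iff_of_min hF b.flat hx ht (min_eq_left hg.le).symm).2 h⟩

/-- A property of parameters that holds near a parameter at which the curve passes through the disk
also holds at a parameter in the interior of one of the two strands. -/
lemma exists_of_eventually (b : P.BandPicture ψ τ₀ τ₁ g) {t : ℝ} (ht : t ∉ P.doubleParams)
    (htD : P.curve t ∈ ψ '' square) {p : ℝ → Prop} (hp : ∀ᶠ s in 𝓝 t, p s)
    (hsame : ∀ r s, SameParam r s → p s → p r) :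
    ∃ x ∈ Set.Ioo (-1 : ℝ) 1, g x ≠ 0 ∧ (p (τ₀ + 1 * x) ∨ p (τ₁ + 1 * x)) := by
  obtain ⟨z, hz, hzt⟩ := htD
  have key : ∀ σ, SameParam (σ + 1 * z.1) t →
      ∃ x ∈ Set.Ioo (-1 : ℝ) 1, σ + 1 * x ∉ P.doubleParams ∧ p (σ + 1 * x) := by
    rintro σ ⟨n, rfl⟩
    refine exists_mem_Ioo_of_eventually hz.1 (eventually_nhdsWithin_of_eventually_nhds ?_)
    have h1 : Tendsto (fun x => σ + 1 * x + 2 * Real.pi * n) (𝓝 z.1)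
        (𝓝 (σ + 1 * z.1 + 2 * Real.pi * n)) := Continuous.tendsto (by fun_prop) _
    filter_upwards [h1.eventually hp, h1.eventually (eventually_notMem_doubleParams_nhds ht)]
      with x h2 h3
    exact ⟨fun h4 => h3 (mem_doubleParams_of_sameParam ⟨n, rfl⟩ h4), hsame _ _ ⟨n, rfl⟩ h2⟩
  rcases b.cover t z hz hzt.symm with h | h
  · obtain ⟨x, hx, h1, h2⟩ := key τ₀ h.2
    exact ⟨x, hx, fun h3 => h1 ((b.flat_mem_doubleParams_iff (Set.Ioo_subset_Icc_self hx)).2 h3),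
      Or.inl h2⟩
  · obtain ⟨x, hx, h1, h2⟩ := key τ₁ h.2
    exact ⟨x, hx, fun h3 => h1 ((b.graph_mem_doubleParams_iff (Set.Ioo_subset_Icc_self hx)).2 h3),
      Or.inr h2⟩

lemma above_of_onLeft (b : P.BandPicture ψ τ₀ τ₁ g) (hF : P.IsFace F)
    (hFb : Disjoint F (ψ '' band g)) {t : ℝ} (ht : t ∉ P.doubleParams)
    (htD : P.curve t ∈ ψ '' square) (hl : P.OnLeft F t) : (F ∩ ψ '' above g).Nonempty := by
  obtain ⟨x, hx, hg, h⟩ := b.exists_of_eventually ht htD (hl.eventually ht hF)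
    fun r s hrs => (onLeft_iff_of_sameParam hrs).2
  have hxI := Set.Ioo_subset_Icc_self hx
  have n0 : τ₀ + 1 * x ∉ P.doubleParams := fun h => hg ((b.flat_mem_doubleParams_iff hxI).1 h)
  have n1 : τ₁ + 1 * x ∉ P.doubleParams := fun h => hg ((b.graph_mem_doubleParams_iff hxI).1 h)
  rcases le_total 0 (g x) with h0 | h0 <;> rcases h with h | h
  · exact absurd h (b.not_onLeft_of_min hF hFb b.flat hx n0 (min_eq_left h0).symm hg)
  · exact (b.onLeft_iff_of_max hF b.graph hx n1 (max_eq_right h0).symm).1 h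
  · exact (b.onLeft_iff_of_max hF b.flat hx n0 (max_eq_left h0).symm).1 h
  · exact absurd h (b.not_onLeft_of_min hF hFb b.graph hx n1 (min_eq_right h0).symm hg)

lemma below_of_onRight (b : P.BandPicture ψ τ₀ τ₁ g) (hF : P.IsFace F)
    (hFb : Disjoint F (ψ '' band g)) {t : ℝ} (ht : t ∉ P.doubleParams)
    (htD : P.curve t ∈ ψ '' square) (hr : P.OnRight F t) : (F ∩ ψ '' below g).Nonempty := by
  obtain ⟨x, hx, hg, h⟩ := b.exists_of_eventually ht htD (hr.eventually ht hF)
    fun r s hrs => (onRight_iff_of_sameParam hrs).2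
  have hxI := Set.Ioo_subset_Icc_self hx
  have n0 : τ₀ + 1 * x ∉ P.doubleParams := fun h => hg ((b.flat_mem_doubleParams_iff hxI).1 h)
  have n1 : τ₁ + 1 * x ∉ P.doubleParams := fun h => hg ((b.graph_mem_doubleParams_iff hxI).1 h)
  rcases le_total 0 (g x) with h0 | h0 <;> rcases h with h | h
  · exact (b.onRight_iff_of_min hF b.flat hx n0 (min_eq_left h0).symm).1 h
  · exact absurd h (b.not_onRight_of_max hF hFb b.graph hx n1 (max_eq_right h0).symm hg)
  · exact absurd h (b.not_onRight_of_max hF hFb b.flat hx n0 (max_eq_left h0).symm hg)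
  · exact (b.onRight_iff_of_min hF b.graph hx n1 (min_eq_right h0).symm).1 h

end BandPicture

end KnotProjection

namespace KnotProjection

/-! ### Replacing one band by another -/

/-- The map that rescales the parts of the disk `ψ(square)` above and below the band, and is the
identity outside the disk. -/
noncomputable def swapMap (ψ : ℝ × ℝ → E3) (g g' : ℝ → ℝ) (x : E3) : E3 :=
  open Classical in
  if x ∈ ψ '' square then ψ (rescale g g' (Function.invFun ψ x)) else x

/-- The two curves agree outside the disk `ψ(square)`, inside which they consist of two strands. -/
structure BandSwap (P P' : KnotProjection) (ψ : ℝ × ℝ → E3) (τ₀ τ₁ : ℝ) (g g' : ℝ → ℝ) :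
    Prop where
  fst : P.BandPicture ψ τ₀ τ₁ g
  snd : P'.BandPicture ψ τ₀ τ₁ g'
  right_eq : g 1 = g' 1
  left_eq : g (-1) = g' (-1)
  eq_of_notMem : ∀ t, P.curve t ∉ ψ '' square → P'.curve t = P.curve t
  eq_of_notMem' : ∀ t, P'.curve t ∉ ψ '' square → P.curve t = P'.curve t

namespace BandSwap

variable {P P' : KnotProjection} {ψ : ℝ × ℝ → E3} {τ₀ τ₁ : ℝ} {g g' : ℝ → ℝ} {F : Set E3}

lemma symm (b : BandSwap P P' ψ τ₀ τ₁ g g') : BandSwap P' P ψ τ₀ τ₁ g' g :=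
  ⟨b.snd, b.fst, b.right_eq.symm, b.left_eq.symm, b.eq_of_notMem', b.eq_of_notMem⟩

lemma curve_mem_iff (b : BandSwap P P' ψ τ₀ τ₁ g g') (t : ℝ) :
    P'.curve t ∈ ψ '' square ↔ P.curve t ∈ ψ '' square := by
  constructor <;> intro h <;> by_contra h1
  · rw [b.eq_of_notMem t h1] at h; exact h1 h
  · rw [b.eq_of_notMem' t h1] at h; exact h1 h

lemma swapMap_of_notMem {x : E3} (hx : x ∉ ψ '' square) : swapMap ψ g g' x = x := if_neg hx

lemma swapMap_apply (hψ : IsPlanarChart ψ) {z : ℝ × ℝ} (hz : z ∈ square) :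
    swapMap ψ g g' (ψ z) = ψ (rescale g g' z) := by
  rw [swapMap, if_pos ⟨z, hz, rfl⟩, hψ.invFun_apply]

/-- The points of the sphere that lie neither on the curve nor in the band. -/
def outside (P : KnotProjection) (ψ : ℝ × ℝ → E3) (g : ℝ → ℝ) : Set E3 :=
  sphere2 \ (P.image ∪ ψ '' band g)

lemma exists_of_mem_outside {x : E3} (hx : x ∈ outside P ψ g)
    (hxD : x ∈ ψ '' square) : ∃ z ∈ above g ∪ below g, ψ z = x := by
  obtain ⟨z, hz, rfl⟩ := hxD
  exact ⟨z, (mem_band_or z hz).resolve_left fun h => hx.2 (Or.inr ⟨z, h, rfl⟩), rfl⟩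

lemma mem_outside (b : P.BandPicture ψ τ₀ τ₁ g) {z : ℝ × ℝ} (hz : z ∈ above g ∪ below g) :
    ψ z ∈ outside P ψ g := by
  have h1 : ψ z ∈ sphere2 \ P.image := by
    rcases hz with hz | hz
    · exact b.image_above_subset ⟨z, hz, rfl⟩
    · exact b.image_below_subset ⟨z, hz, rfl⟩
  refine ⟨h1.1, ?_⟩
  rintro (h | ⟨w, hw, hwz⟩)
  · exact h1.2 h
  · exact Set.disjoint_left.1 disjoint_band (b.chart.injective hwz ▸ hw) hz

lemma subset_outside (hF : P.IsFace F) (hFb : Disjoint F (ψ '' band g)) : F ⊆ outside P ψ g :=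
  fun _ hx => ⟨(hF.subset hx).1, fun h => h.elim (hF.subset hx).2 (Set.disjoint_left.1 hFb hx)⟩

lemma eventually_mem_outside (b : P.BandPicture ψ τ₀ τ₁ g) {x : E3} (hx : x ∈ outside P ψ g) :
    ∀ᶠ y in 𝓝 x, y ∈ sphere2 → y ∈ outside P ψ g := by
  have h1 : IsClosed (P.image ∪ ψ '' band g) := P.isCompact_image.isClosed.union
    ((isCompact_band b.continuousOn).image b.chart.continuous).isClosed
  filter_upwards [h1.isOpen_compl.mem_nhds hx.2] with y h2 h3
  exact ⟨h3, h2⟩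

lemma rescale_mem (b : BandSwap P P' ψ τ₀ τ₁ g g') {z : ℝ × ℝ} (hz : z ∈ above g ∪ below g) :
    rescale g g' z ∈ above g' ∪ below g' :=
  hz.imp (rescale_mem_above b.fst.lt_one b.snd.lt_one) (rescale_mem_below b.fst.lt_one b.snd.lt_one)

lemma swapMap_of_mem (b : BandSwap P P' ψ τ₀ τ₁ g g') {z : ℝ × ℝ} (hz : z ∈ above g ∪ below g) :
    swapMap ψ g g' (ψ z) = ψ (rescale g g' z) :=
  swapMap_apply b.fst.chart (hz.elim (·.1) (·.1))

lemma swapMap_mem_outside (b : BandSwap P P' ψ τ₀ τ₁ g g') {x : E3} (hx : x ∈ outside P ψ g) :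
    swapMap ψ g g' x ∈ outside P' ψ g' := by
  by_cases hxD : x ∈ ψ '' square
  · obtain ⟨z, hz, rfl⟩ := exists_of_mem_outside hx hxD
    rw [b.swapMap_of_mem hz]
    exact mem_outside b.snd (b.rescale_mem hz)
  · rw [swapMap_of_notMem hxD]
    refine ⟨hx.1, ?_⟩
    rintro (⟨t, rfl⟩ | ⟨w, hw, rfl⟩)
    · exact hx.2 (Or.inl ⟨t, b.eq_of_notMem' t hxD⟩)
    · exact hxD ⟨w, band_subset_square b.snd.lt_one hw, rfl⟩

lemma swapMap_mem_iff (b : BandSwap P P' ψ τ₀ τ₁ g g') {x : E3} (hx : x ∈ outside P ψ g) :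
    swapMap ψ g g' x ∈ ψ '' square ↔ x ∈ ψ '' square := by
  by_cases hxD : x ∈ ψ '' square
  · obtain ⟨z, hz, rfl⟩ := exists_of_mem_outside hx hxD
    rw [b.swapMap_of_mem hz]
    exact iff_of_true ⟨_, (b.rescale_mem hz).elim (·.1) (·.1), rfl⟩ hxD
  · rw [swapMap_of_notMem hxD]

lemma swapMap_swapMap (b : BandSwap P P' ψ τ₀ τ₁ g g') {x : E3} (hx : x ∈ outside P ψ g) :
    swapMap ψ g' g (swapMap ψ g g' x) = x := by
  by_cases hxD : x ∈ ψ '' square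
  · obtain ⟨z, hz, rfl⟩ := exists_of_mem_outside hx hxD
    rw [b.swapMap_of_mem hz, b.symm.swapMap_of_mem (b.rescale_mem hz),
      rescale_rescale b.fst.lt_one b.snd.lt_one hz]
  · rw [swapMap_of_notMem hxD, swapMap_of_notMem hxD]

/-- The map is continuous across the boundary of the disk, where `rescale` is the identity. -/
lemma continuousOn_swapMap (b : BandSwap P P' ψ τ₀ τ₁ g g') :
    ContinuousOn (swapMap ψ g g') (outside P ψ g) := by
  intro x hx
  have hDc := isClosed_image_square b.fst.chart
  by_cases hxD : x ∈ ψ '' square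
  · obtain ⟨z, hz, rfl⟩ := exists_of_mem_outside hx hxD
    have hin : ContinuousWithinAt (swapMap ψ g g') (outside P ψ g ∩ ψ '' square) (ψ z) := by
      have h1 : ContinuousWithinAt (Function.invFun ψ) (outside P ψ g ∩ ψ '' square) (ψ z) :=
        (b.fst.chart.continuousWithinAt_invFun z).mono fun y hy => hy.1.1
      have h2 : Set.MapsTo (Function.invFun ψ) (outside P ψ g ∩ ψ '' square)
          (above g ∪ below g) := by
        rintro y ⟨h3, h4⟩
        obtain ⟨w, hw, rfl⟩ := exists_of_mem_outside h3 h4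
        rwa [b.fst.chart.invFun_apply]
      have h3 : ContinuousWithinAt (rescale g g') (above g ∪ below g)
          (Function.invFun ψ (ψ z)) := by
        rw [b.fst.chart.invFun_apply]
        exact continuousOn_rescale b.fst.lt_one b.fst.continuousOn
          b.snd.continuousOn z hz
      exact (b.fst.chart.continuous.continuousAt.comp_continuousWithinAt (h3.comp h1 h2)).congr
        (fun y hy => if_pos hy.2) (if_pos hxD)
    have hout : ContinuousWithinAt (swapMap ψ g g') (outside P ψ g \ ψ '' square) (ψ z) := by
      by_cases hn : square ∈ 𝓝 z
      · have h1 : 𝓝[outside P ψ g \ ψ '' square] (ψ z) = ⊥ := by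
          rw [← Filter.empty_mem_iff_bot, mem_nhdsWithin_iff_eventually]
          filter_upwards [b.fst.chart.eventually_mem_image hn] with y h2 h3
          exact h3.2 (h2 h3.1.1)
        rw [ContinuousWithinAt, h1]
        exact tendsto_bot
      · refine continuousWithinAt_id.congr (fun y hy => swapMap_of_notMem hy.2) ?_
        rw [b.swapMap_of_mem hz, rescale_eq_self b.fst.lt_one b.right_eq b.left_eq hz hn, id]
    have h := hin.union hout
    rwa [Set.inter_union_sdiff] at h
  · refine ContinuousAt.continuousWithinAt (continuousAt_id.congr ?_)
    filter_upwards [hDc.isOpen_compl.mem_nhds hxD] with y hy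
    exact (swapMap_of_notMem hy).symm

lemma image_swapMap_image (b : BandSwap P P' ψ τ₀ τ₁ g g') (hF : F ⊆ outside P ψ g) :
    swapMap ψ g' g '' (swapMap ψ g g' '' F) = F := by
  rw [Set.image_image]
  refine (Set.image_congr fun x hx => b.swapMap_swapMap (hF hx)).trans (Set.image_id' F)

lemma mem_image_iff_of_notMem (b : BandSwap P P' ψ τ₀ τ₁ g g') (hF : F ⊆ outside P ψ g) {x : E3}
    (hx : x ∉ ψ '' square) : x ∈ swapMap ψ g g' '' F ↔ x ∈ F := by
  constructor
  · rintro ⟨y, hy, rfl⟩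
    rwa [swapMap_of_notMem fun h => hx ((b.swapMap_mem_iff (hF hy)).2 h)]
  · exact fun h => ⟨x, h, swapMap_of_notMem hx⟩

lemma disjoint_image (b : BandSwap P P' ψ τ₀ τ₁ g g') (hF : F ⊆ outside P ψ g) :
    Disjoint (swapMap ψ g g' '' F) (ψ '' band g') := by
  rw [Set.disjoint_left]
  rintro _ ⟨x, hx, rfl⟩ h
  exact (b.swapMap_mem_outside (hF hx)).2 (Or.inr h)

/-- No point of the band that is not on the curve is adherent to the image of a polygon lying
outside the band. -/
lemma notMem_closure_image (b : BandSwap P P' ψ τ₀ τ₁ g g') (hF : P.IsFace F)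
    (hFb : Disjoint F (ψ '' band g)) {z : ℝ × ℝ} (hz : z ∈ band g') (hzi : ψ z ∉ P'.image) :
    ψ z ∉ closure (swapMap ψ g g' '' F) := by
  intro hcl
  have hFo := subset_outside hF hFb
  obtain ⟨hz1, hz2⟩ := b.snd.strictly_between hz hzi
  have hcont := b.snd.continuousOn z.1 hz.1
  -- near `ψ z`, the disk only contains points of the band
  have hnear : ∀ᶠ y in 𝓝 (ψ z), y ∈ sphere2 → y ∈ ψ '' square → y ∈ ψ '' band g' := by
    have h1 : ∀ᶠ w in 𝓝 z, w ∈ square → w ∈ band g' := by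
      have hc2 : ContinuousWithinAt (fun w : ℝ × ℝ => g' w.1) square z :=
        hcont.comp continuousWithinAt_fst fun w hw => hw.1
      have hs2 : ContinuousWithinAt (fun w : ℝ × ℝ => w.2) square z := continuousWithinAt_snd
      have h2 := (continuousWithinAt_const.inf hc2).eventually_lt hs2 hz1
      have h3 := hs2.eventually_lt (continuousWithinAt_const.sup hc2) hz2
      rw [eventually_nhdsWithin_iff] at h2 h3
      filter_upwards [h2, h3] with w h4 h5 hw
      exact ⟨hw.1, (h4 hw).le, (h5 hw).le⟩
    filter_upwards [b.fst.chart.eventually_mem_image h1] with y h2 h3 h4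
    obtain ⟨w, hw, rfl⟩ := h2 h3
    obtain ⟨w', hw', h5⟩ := h4
    rw [b.fst.chart.injective h5] at hw'
    exact ⟨w, hw hw', rfl⟩
  have hout : ∀ᶠ y in 𝓝 (ψ z), y ∈ swapMap ψ g g' '' F → y ∉ ψ '' square ∧ y ∈ F := by
    filter_upwards [hnear] with y h1 h2
    have h3 : y ∉ ψ '' square := by
      obtain ⟨x, hx, rfl⟩ := h2
      intro h4
      have h5 := b.swapMap_mem_outside (hFo hx)
      exact h5.2 (Or.inr (h1 h5.1 h4))
    exact ⟨h3, (b.mem_image_iff_of_notMem hFo h3).1 h2⟩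
  have hsq := band_subset_square b.snd.lt_one hz
  by_cases hn : square ∈ 𝓝 z
  · obtain ⟨y, h1, h2, h3⟩ := ((mem_closure_iff_frequently.1 hcl).and_eventually
      (hout.and (b.fst.chart.eventually_mem_image hn))).exists
    exact (h2 h1).1 (h3 (hF.subset (h2 h1).2).1)
  · have hgg : g z.1 = g' z.1 := by
      by_contra hne
      refine hn (prod_mem_nhds (Icc_mem_nhds ?_ ?_) (Icc_mem_nhds ?_ ?_))
      · refine lt_of_le_of_ne hz.1.1 fun h3 => hne ?_
        rw [← h3, b.left_eq]
      · refine lt_of_le_of_ne hz.1.2 fun h3 => hne ?_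
        rw [h3, b.right_eq]
      · linarith [neg_one_lt_min b.snd.lt_one hz.1]
      · linarith [max_lt_one b.snd.lt_one hz.1]
    have hzb : z ∈ band g := by
      refine ⟨hz.1, ?_, ?_⟩
      · rw [hgg]; exact hz.2.1
      · rw [hgg]; exact hz.2.2
    have hzP : ψ z ∉ P.image := by
      intro h
      have h1 := b.fst.eq_or_eq_of_mem_image hsq h
      rw [hgg] at h1
      exact hzi (b.snd.mem_image_of_eq_or_eq hz.1 h1)
    have hclF : ψ z ∈ closure F := by
      rw [mem_closure_iff_frequently] at hcl ⊢
      exact (hcl.and_eventually hout).mono fun y h => (h.2 h.1).2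
    exact Set.disjoint_left.1 hFb
      (hF.mem_of_mem_closure ⟨b.fst.chart.mem_sphere z, hzP⟩ hclF) ⟨z, hzb, rfl⟩

/-- Polygons of the first curve that lie outside the band correspond to polygons of the second
one. -/
lemma isFace_image (b : BandSwap P P' ψ τ₀ τ₁ g g') (hF : P.IsFace F)
    (hFb : Disjoint F (ψ '' band g)) : P'.IsFace (swapMap ψ g g' '' F) := by
  have hFo := subset_outside hF hFb
  refine isFace_of_isClopen (hF.nonempty.image _)
    (hF.isPreconnected.image _ (b.continuousOn_swapMap.mono hFo)) ?_ ?_ ?_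
  · rintro _ ⟨x, hx, rfl⟩
    have h1 := b.swapMap_mem_outside (hFo hx)
    exact ⟨h1.1, fun h => h1.2 (Or.inl h)⟩
  · rintro _ ⟨x, hx, rfl⟩
    have h1 := b.swapMap_mem_outside (hFo hx)
    have h2 := b.symm.continuousOn_swapMap _ h1
    rw [ContinuousWithinAt, b.swapMap_swapMap (hFo hx)] at h2
    have h3 := h2.eventually (hF.eventually_mem hx)
    rw [eventually_nhdsWithin_iff] at h3
    filter_upwards [h3, eventually_mem_outside b.snd h1] with y h4 h5 hy
    have h6 := h5 hy
    exact ⟨_, h4 h6 (b.symm.swapMap_mem_outside h6).1, b.symm.swapMap_swapMap h6⟩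
  · intro x hx hcl
    by_cases hxb : x ∈ ψ '' band g'
    · obtain ⟨z, hz, rfl⟩ := hxb
      exact absurd hcl (b.notMem_closure_image hF hFb hz hx.2)
    · have hxo : x ∈ outside P' ψ g' := ⟨hx.1, fun h => h.elim hx.2 hxb⟩
      have h1 := (b.symm.continuousOn_swapMap x hxo).mono (s := swapMap ψ g g' '' F) (by
        rintro _ ⟨y, hy, rfl⟩
        exact b.swapMap_mem_outside (hFo hy))
      have h2 := h1.mem_closure_image hcl
      rw [b.image_swapMap_image hFo] at h2
      have h3 := b.symm.swapMap_mem_outside hxo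
      exact ⟨_, hF.mem_of_mem_closure ⟨h3.1, fun h => h3.2 (Or.inl h)⟩ h2,
        b.symm.swapMap_swapMap hxo⟩

lemma above_image (b : BandSwap P P' ψ τ₀ τ₁ g g') (h : (F ∩ ψ '' above g).Nonempty) :
    (swapMap ψ g g' '' F ∩ ψ '' above g').Nonempty := by
  obtain ⟨_, h1, z, hz, rfl⟩ := h
  exact ⟨_, ⟨_, h1, rfl⟩, _, rescale_mem_above b.fst.lt_one b.snd.lt_one hz,
    (b.swapMap_of_mem (Or.inl hz)).symm⟩

lemma below_image (b : BandSwap P P' ψ τ₀ τ₁ g g') (h : (F ∩ ψ '' below g).Nonempty) :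
    (swapMap ψ g g' '' F ∩ ψ '' below g').Nonempty := by
  obtain ⟨_, h1, z, hz, rfl⟩ := h
  exact ⟨_, ⟨_, h1, rfl⟩, _, rescale_mem_below b.fst.lt_one b.snd.lt_one hz,
    (b.swapMap_of_mem (Or.inr hz)).symm⟩

section Off

variable {t : ℝ}

lemma mem_doubleParams (b : BandSwap P P' ψ τ₀ τ₁ g g') (ht : P.curve t ∉ ψ '' square)
    (h : t ∈ P.doubleParams) : t ∈ P'.doubleParams := by
  obtain ⟨s, hs, hn⟩ := h
  refine ⟨s, ?_, hn⟩
  rw [b.eq_of_notMem t ht, b.eq_of_notMem s (hs ▸ ht), hs]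

lemma eventually_notMem (b : BandSwap P P' ψ τ₀ τ₁ g g') (ht : P.curve t ∉ ψ '' square) :
    ∀ᶠ s in 𝓝 t, P.curve s ∉ ψ '' square :=
  P.continuous_curve.continuousAt.eventually
    ((isClosed_image_square b.fst.chart).isOpen_compl.mem_nhds ht)

lemma normalPoint_eq_of_notMem (b : BandSwap P P' ψ τ₀ τ₁ g g') (ht : P.curve t ∉ ψ '' square) :
    P'.normalPoint t = P.normalPoint t := by
  have h1 : P'.curve =ᶠ[𝓝 t] P.curve := by
    filter_upwards [b.eventually_notMem ht] with s hs using b.eq_of_notMem s hs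
  unfold normalPoint
  rw [h1.deriv_eq, b.eq_of_notMem t ht]

lemma onLeft_image_iff (b : BandSwap P P' ψ τ₀ τ₁ g g') (hF : F ⊆ outside P ψ g)
    (ht : P.curve t ∉ ψ '' square) :
    P'.OnLeft (swapMap ψ g g' '' F) t ↔ P.OnLeft F t := by
  unfold OnLeft
  rw [b.normalPoint_eq_of_notMem ht]
  refine eventually_congr ?_
  filter_upwards [(P.tendsto_normalPoint t continuous_id rfl).eventually
    ((isClosed_image_square b.fst.chart).isOpen_compl.mem_nhds ht)] with ε hε
  exact b.mem_image_iff_of_notMem hF hε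

lemma onRight_image_iff (b : BandSwap P P' ψ τ₀ τ₁ g g') (hF : F ⊆ outside P ψ g)
    (ht : P.curve t ∉ ψ '' square) :
    P'.OnRight (swapMap ψ g g' '' F) t ↔ P.OnRight F t := by
  unfold OnRight
  rw [b.normalPoint_eq_of_notMem ht]
  refine eventually_congr ?_
  filter_upwards [(P.tendsto_normalPoint t continuous_neg neg_zero).eventually
    ((isClosed_image_square b.fst.chart).isOpen_compl.mem_nhds ht)] with ε hε
  exact b.mem_image_iff_of_notMem hF hε

lemma curve_mem_closure_image_iff (b : BandSwap P P' ψ τ₀ τ₁ g g') (hF : F ⊆ outside P ψ g)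
    (ht : P.curve t ∉ ψ '' square) :
    P'.curve t ∈ closure (swapMap ψ g g' '' F) ↔ P.curve t ∈ closure F := by
  rw [b.eq_of_notMem t ht, mem_closure_iff_frequently, mem_closure_iff_frequently]
  refine frequently_congr ?_
  filter_upwards [(isClosed_image_square b.fst.chart).isOpen_compl.mem_nhds ht] with x hx
  exact b.mem_image_iff_of_notMem hF hx

end Off

lemma isCoherent_image (b : BandSwap P P' ψ τ₀ τ₁ g g') (hF : P.IsFace F)
    (hFb : Disjoint F (ψ '' band g)) (hc : P.IsCoherent F) :
    P'.IsCoherent (swapMap ψ g g' '' F) := by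
  have hFo := subset_outside hF hFb
  have hF' := b.isFace_image hF hFb
  have hFb' := b.disjoint_image hFo
  rw [isCoherent_iff hF']
  refine ((isCoherent_iff hF).1 hc).imp (fun h t ht hr => ?_) (fun h t ht hl => ?_)
  · by_cases htD : P'.curve t ∈ ψ '' square
    · have h1 := b.symm.below_image (b.snd.below_of_onRight hF' hFb' ht htD hr)
      rw [b.image_swapMap_image hFo] at h1
      obtain ⟨s, h2, h3⟩ := b.fst.exists_onRight_of_below hF h1
      exact h s h2 h3
    · rw [b.curve_mem_iff] at htD
      exact h t (fun h1 => ht (b.mem_doubleParams htD h1)) ((b.onRight_image_iff hFo htD).1 hr)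
  · by_cases htD : P'.curve t ∈ ψ '' square
    · have h1 := b.symm.above_image (b.snd.above_of_onLeft hF' hFb' ht htD hl)
      rw [b.image_swapMap_image hFo] at h1
      obtain ⟨s, h2, h3⟩ := b.fst.exists_onLeft_of_above hF h1
      exact h s h2 h3
    · rw [b.curve_mem_iff] at htD
      exact h t (fun h1 => ht (b.mem_doubleParams htD h1)) ((b.onLeft_image_iff hFo htD).1 hl)

lemma mem_startSet_image_iff (b : BandSwap P P' ψ τ₀ τ₁ g g') (hF : F ⊆ outside P ψ g) {t : ℝ}
    (ht : P.curve t ∉ ψ '' square) :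
    t ∈ P'.startSet (swapMap ψ g g' '' F) ↔ t ∈ P.startSet F := by
  have hd : t ∈ P'.doubleParams ↔ t ∈ P.doubleParams :=
    ⟨b.symm.mem_doubleParams (mt (b.curve_mem_iff t).1 ht), b.mem_doubleParams ht⟩
  refine and_congr hd (eventually_congr ?_)
  filter_upwards [nhdsWithin_le_nhds (b.eventually_notMem ht)] with s hs
  exact b.curve_mem_closure_image_iff hF hs

end BandSwap

end KnotProjection

namespace KnotProjection

/-! ### The weak second Reidemeister move -/

lemma mem_startSet_of_sameParam {P : KnotProjection} {F : Set E3} {s t : ℝ} (h : SameParam s t)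
    (hs : s ∈ P.startSet F) : t ∈ P.startSet F := by
  refine ⟨mem_doubleParams_of_sameParam h hs.1, ?_⟩
  obtain ⟨n, rfl⟩ := h
  have h1 : Tendsto (fun u => u - 2 * Real.pi * n) (𝓝[>] (s + 2 * Real.pi * n)) (𝓝[>] s) := by
    refine tendsto_nhdsWithin_iff.2 ⟨?_, ?_⟩
    · have h2 : Tendsto (fun u => u - 2 * Real.pi * n) (𝓝 (s + 2 * Real.pi * n))
          (𝓝 (s + 2 * Real.pi * n - 2 * Real.pi * n)) := Continuous.tendsto (by fun_prop) _
      rw [add_sub_cancel_right] at h2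
      exact h2.mono_left nhdsWithin_le_nhds
    · filter_upwards [self_mem_nhdsWithin] with u hu
      rw [Set.mem_Ioi] at *
      linarith
  filter_upwards [h1.eventually hs.2] with u hu
  rwa [curve_sub_int] at hu

lemma _root_.Set.finite_and_even_ncard_of_pairs {α : Type*} {T : Set α} {a b c d : α} {A B : Prop}
    (hT : ∀ t, t ∈ T ↔ (t = a ∨ t = d) ∧ A ∨ (t = b ∨ t = c) ∧ B) (had : a ≠ d) (hbc : b ≠ c)
    (hab : a ≠ b) (hac : a ≠ c) (hdb : d ≠ b) (hdc : d ≠ c) : T.Finite ∧ Even T.ncard := by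
  by_cases hA : A <;> by_cases hB : B <;> simp only [hA, hB, and_true, and_false, or_false,
    false_or] at hT
  · have h : T = {a, d} ∪ {b, c} := Set.ext hT
    rw [h]
    refine ⟨Set.toFinite _, ?_⟩
    rw [Set.ncard_union_eq, Set.ncard_pair had, Set.ncard_pair hbc]
    · decide
    · rw [Set.disjoint_left]
      rintro x (rfl | rfl) (h | h)
      exacts [hab h, hac h, hdb h, hdc h]
  · have h : T = {a, d} := Set.ext hT
    rw [h, Set.ncard_pair had]
    exact ⟨Set.toFinite _, even_two⟩
  · have h : T = {b, c} := Set.ext hT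
    rw [h, Set.ncard_pair hbc]
    exact ⟨Set.toFinite _, even_two⟩
  · have h : T = ∅ := Set.ext hT
    rw [h, Set.ncard_empty]
    exact ⟨Set.toFinite _, Even.zero⟩

namespace BandPicture

variable {P : KnotProjection} {ψ : ℝ × ℝ → E3} {τ₀ τ₁ : ℝ} {g : ℝ → ℝ} {F : Set E3}

section Strand

variable {τ : ℝ} {f : ℝ → ℝ} {x η : ℝ}

lemma mem_startSet_iff_of_max (b : P.BandPicture ψ τ₀ τ₁ g)
    (hF : P.IsFace F) (hFb : Disjoint F (ψ '' band g)) (hs : P.IsStrand ψ τ 1 f)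
    (hx : x ∈ Set.Ioo (-1 : ℝ) 1) (hd : τ + 1 * x ∈ P.doubleParams) (hη : 0 < η)
    (hn : ∀ y ∈ Set.Ioo x (x + η), y ∈ Set.Ioo (-1 : ℝ) 1 →
      τ + 1 * y ∉ P.doubleParams ∧ f y = max 0 (g y) ∧ g y ≠ 0) :
    τ + 1 * x ∈ P.startSet F ↔ (F ∩ ψ '' above g).Nonempty := by
  constructor
  · intro h
    obtain ⟨e, he, he1, he2⟩ := hs.exists_mem_of_eventually (Or.inl rfl) hx (SameParam.refl _)
      (S := closure F) h.2 η hη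
    rw [one_mul] at he1 he2
    obtain ⟨h1, h2, h3⟩ := hn (x + e) ⟨by linarith [he.1], by linarith [he.2]⟩ he1
    exact (b.curve_mem_closure_iff_of_max hF hFb hs he1 h1 h2 h3).1 he2
  · intro h
    refine ⟨hd, hs.eventually_of_forall (η := min η (1 - x)) (Or.inl rfl) hx
      (lt_min hη (by linarith [hx.2])) fun e he _ => ?_⟩
    have e1 := he.2.trans_le (min_le_left _ _)
    have e2 := he.2.trans_le (min_le_right _ _)
    have he1 : x + 1 * e ∈ Set.Ioo (-1 : ℝ) 1 :=
      ⟨by linarith [he.1, hx.1], by linarith⟩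
    obtain ⟨h1, h2, h3⟩ := hn (x + 1 * e) ⟨by linarith [he.1], by linarith⟩ he1
    exact (b.curve_mem_closure_iff_of_max hF hFb hs he1 h1 h2 h3).2 h

lemma mem_startSet_iff_of_min (b : P.BandPicture ψ τ₀ τ₁ g)
    (hF : P.IsFace F) (hFb : Disjoint F (ψ '' band g)) (hs : P.IsStrand ψ τ 1 f)
    (hx : x ∈ Set.Ioo (-1 : ℝ) 1) (hd : τ + 1 * x ∈ P.doubleParams) (hη : 0 < η)
    (hn : ∀ y ∈ Set.Ioo x (x + η), y ∈ Set.Ioo (-1 : ℝ) 1 →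
      τ + 1 * y ∉ P.doubleParams ∧ f y = min 0 (g y) ∧ g y ≠ 0) :
    τ + 1 * x ∈ P.startSet F ↔ (F ∩ ψ '' below g).Nonempty := by
  constructor
  · intro h
    obtain ⟨e, he, he1, he2⟩ := hs.exists_mem_of_eventually (Or.inl rfl) hx (SameParam.refl _)
      (S := closure F) h.2 η hη
    rw [one_mul] at he1 he2
    obtain ⟨h1, h2, h3⟩ := hn (x + e) ⟨by linarith [he.1], by linarith [he.2]⟩ he1
    exact (b.curve_mem_closure_iff_of_min hF hFb hs he1 h1 h2 h3).1 he2
  · intro h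
    refine ⟨hd, hs.eventually_of_forall (η := min η (1 - x)) (Or.inl rfl) hx
      (lt_min hη (by linarith [hx.2])) fun e he _ => ?_⟩
    have e1 := he.2.trans_le (min_le_left _ _)
    have e2 := he.2.trans_le (min_le_right _ _)
    have he1 : x + 1 * e ∈ Set.Ioo (-1 : ℝ) 1 :=
      ⟨by linarith [he.1, hx.1], by linarith⟩
    obtain ⟨h1, h2, h3⟩ := hn (x + 1 * e) ⟨by linarith [he.1], by linarith⟩ he1
    exact (b.curve_mem_closure_iff_of_min hF hFb hs he1 h1 h2 h3).2 h

end Strand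

/-- Creating two crossings adds two sides to the polygon above the band, two sides to the polygon
below it, and none to the others. If both are the same polygon, it gains four sides. -/
lemma even_ncard_startSet (b : P.BandPicture ψ τ₀ τ₁ g)
    (hF : P.IsFace F) (hFb : Disjoint F (ψ '' band g)) {p q : ℝ} (hp : -1 < p) (hpq : p < q)
    (hq : q < 1) (hgp : g p = 0) (hgq : g q = 0) (hneg : ∀ x ∈ Set.Ioo p q, g x < 0)
    (hpos₀ : ∀ x ∈ Set.Ico (-1) p, 0 < g x) (hpos₁ : ∀ x ∈ Set.Ioc q 1, 0 < g x) :
    ((fun a : ℝ => (a : AddCircle (2 * Real.pi))) ''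
      {a | a ∈ P.startSet F ∧ P.curve a ∈ ψ '' square}).Finite ∧
    Even ((fun a : ℝ => (a : AddCircle (2 * Real.pi))) ''
      {a | a ∈ P.startSet F ∧ P.curve a ∈ ψ '' square}).ncard := by
  have hpI : p ∈ Set.Ioo (-1 : ℝ) 1 := ⟨hp, hpq.trans hq⟩
  have hqI : q ∈ Set.Ioo (-1 : ℝ) 1 := ⟨hp.trans hpq, hq⟩
  have hpC := Set.Ioo_subset_Icc_self hpI
  have hqC := Set.Ioo_subset_Icc_self hqI
  have hd0 : ∀ {x}, x ∈ Set.Icc (-1 : ℝ) 1 → g x ≠ 0 → τ₀ + 1 * x ∉ P.doubleParams :=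
    fun hx h h1 => h ((b.flat_mem_doubleParams_iff hx).1 h1)
  have hd1 : ∀ {x}, x ∈ Set.Icc (-1 : ℝ) 1 → g x ≠ 0 → τ₁ + 1 * x ∉ P.doubleParams :=
    fun hx h h1 => h ((b.graph_mem_doubleParams_iff hx).1 h1)
  -- to the right of `p` the flat strand is the upper one, to the right of `q` the other one is
  have hnp : ∀ y ∈ Set.Ioo p (p + (q - p)), g y < 0 := fun y hy =>
    hneg y ⟨hy.1, by linarith [hy.2]⟩
  have hnq : ∀ y ∈ Set.Ioo q (q + (1 - q)), 0 < g y := fun y hy =>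
    hpos₁ y ⟨hy.1, by linarith [hy.2]⟩
  have s0p := b.mem_startSet_iff_of_max hF hFb b.flat hpI
    ((b.flat_mem_doubleParams_iff hpC).2 hgp) (sub_pos.2 hpq) fun y hy hyI =>
    ⟨hd0 (Set.Ioo_subset_Icc_self hyI) (hnp y hy).ne, (max_eq_left (hnp y hy).le).symm,
      (hnp y hy).ne⟩
  have s1p := b.mem_startSet_iff_of_min hF hFb b.graph hpI
    ((b.graph_mem_doubleParams_iff hpC).2 hgp) (sub_pos.2 hpq) fun y hy hyI =>
    ⟨hd1 (Set.Ioo_subset_Icc_self hyI) (hnp y hy).ne, (min_eq_right (hnp y hy).le).symm,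
      (hnp y hy).ne⟩
  have s0q := b.mem_startSet_iff_of_min hF hFb b.flat hqI
    ((b.flat_mem_doubleParams_iff hqC).2 hgq) (sub_pos.2 hq) fun y hy hyI =>
    ⟨hd0 (Set.Ioo_subset_Icc_self hyI) (hnq y hy).ne', (min_eq_left (hnq y hy).le).symm,
      (hnq y hy).ne'⟩
  have s1q := b.mem_startSet_iff_of_max hF hFb b.graph hqI
    ((b.graph_mem_doubleParams_iff hqC).2 hgq) (sub_pos.2 hq) fun y hy hyI =>
    ⟨hd1 (Set.Ioo_subset_Icc_self hyI) (hnq y hy).ne', (max_eq_right (hnq y hy).le).symm,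
      (hnq y hy).ne'⟩
  have c0p : P.curve (τ₀ + 1 * p) = ψ (p, 0) := b.flat p hpC
  have c1p : P.curve (τ₁ + 1 * p) = ψ (p, 0) := by rw [b.graph p hpC, hgp]
  have c0q : P.curve (τ₀ + 1 * q) = ψ (q, 0) := b.flat q hqC
  have c1q : P.curve (τ₁ + 1 * q) = ψ (q, 0) := by rw [b.graph q hqC, hgq]
  have hzero : ∀ x ∈ Set.Icc (-1 : ℝ) 1, g x = 0 → x = p ∨ x = q := by
    intro x hx hgx
    rcases lt_trichotomy x p with h | h | h
    · exact absurd hgx (hpos₀ x ⟨hx.1, h⟩).ne'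
    · exact Or.inl h
    rcases lt_trichotomy x q with h' | h' | h'
    · exact absurd hgx (hneg x ⟨h, h'⟩).ne
    · exact Or.inr h'
    · exact absurd hgx (hpos₁ x ⟨h', hx.2⟩).ne'
  have hne : ∀ {s t : ℝ} {x y : ℝ}, x ≠ y → P.curve s = ψ (x, 0) → P.curve t = ψ (y, 0) →
      (s : AddCircle (2 * Real.pi)) ≠ t := by
    intro s t x y hxy hs ht h
    have h1 := P.curve_eq_of_sameParam (sameParam_iff_coe_eq.2 h)
    rw [hs, ht] at h1
    exact hxy (congrArg Prod.fst (b.chart.injective h1))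
  refine Set.finite_and_even_ncard_of_pairs
    (a := ((τ₀ + 1 * p : ℝ) : AddCircle (2 * Real.pi))) (d := ((τ₁ + 1 * q : ℝ) : AddCircle _))
    (b := ((τ₁ + 1 * p : ℝ) : AddCircle _)) (c := ((τ₀ + 1 * q : ℝ) : AddCircle _))
    (A := (F ∩ ψ '' above g).Nonempty) (B := (F ∩ ψ '' below g).Nonempty) (fun t => ?_)
    (hne hpq.ne c0p c1q) (hne hpq.ne c1p c0q)
    (mt sameParam_iff_coe_eq.2 (b.not_sameParam p)) (hne hpq.ne c0p c0q)
    (hne hpq.ne' c1q c1p) (Ne.symm (mt sameParam_iff_coe_eq.2 (b.not_sameParam q)))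
  constructor
  · rintro ⟨a, ⟨ha, z, hz, hza⟩, rfl⟩
    rcases b.cover a z hz hza.symm with ⟨-, h⟩ | ⟨-, h⟩
    · have hs := mem_startSet_of_sameParam h.symm ha
      rcases hzero z.1 hz.1 ((b.flat_mem_doubleParams_iff hz.1).1 hs.1) with h1 | h1 <;>
        rw [h1] at h hs
      · exact Or.inl ⟨Or.inl (sameParam_iff_coe_eq.1 h).symm, s0p.1 hs⟩
      · exact Or.inr ⟨Or.inr (sameParam_iff_coe_eq.1 h).symm, s0q.1 hs⟩
    · have hs := mem_startSet_of_sameParam h.symm ha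
      rcases hzero z.1 hz.1 ((b.graph_mem_doubleParams_iff hz.1).1 hs.1) with h1 | h1 <;>
        rw [h1] at h hs
      · exact Or.inr ⟨Or.inl (sameParam_iff_coe_eq.1 h).symm, s1p.1 hs⟩
      · exact Or.inl ⟨Or.inr (sameParam_iff_coe_eq.1 h).symm, s1q.1 hs⟩
  · rintro (⟨rfl | rfl, h⟩ | ⟨rfl | rfl, h⟩)
    · exact ⟨_, ⟨s0p.2 h, c0p ▸ ⟨_, (b.mem_square hpC).1, rfl⟩⟩, rfl⟩
    · exact ⟨_, ⟨s1q.2 h, c1q ▸ ⟨_, (b.mem_square hqC).1, rfl⟩⟩, rfl⟩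
    · exact ⟨_, ⟨s1p.2 h, c1p ▸ ⟨_, (b.mem_square hpC).1, rfl⟩⟩, rfl⟩
    · exact ⟨_, ⟨s0q.2 h, c0q ▸ ⟨_, (b.mem_square hqC).1, rfl⟩⟩, rfl⟩

end BandPicture

lemma BandSwap.odd_ncard_sides_iff {P P' : KnotProjection} {ψ : ℝ × ℝ → E3} {τ₀ τ₁ : ℝ}
    {g g' : ℝ → ℝ} {F : Set E3} (b : BandSwap P P' ψ τ₀ τ₁ g g') (hF : P.IsFace F)
    (hFb : Disjoint F (ψ '' band g)) (hg : ∀ x ∈ Set.Icc (-1 : ℝ) 1, 0 < g x) {p q : ℝ}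
    (hp : -1 < p) (hpq : p < q) (hq : q < 1) (hgp : g' p = 0) (hgq : g' q = 0)
    (hneg : ∀ x ∈ Set.Ioo p q, g' x < 0) (hpos₀ : ∀ x ∈ Set.Ico (-1) p, 0 < g' x)
    (hpos₁ : ∀ x ∈ Set.Ioc q 1, 0 < g' x) :
    Odd (P'.sides (swapMap ψ g g' '' F)).ncard ↔ Odd (P.sides F).ncard := by
  have hFo := BandSwap.subset_outside hF hFb
  have hF' := b.isFace_image hF hFb
  have hFb' := b.disjoint_image hFo
  obtain ⟨hfin, heven⟩ := b.snd.even_ncard_startSet hF' hFb' hp hpq hq hgp hgq hneg hpos₀ hpos₁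
  rw [ncard_sides hF, ncard_sides hF']
  set F' := swapMap ψ g g' '' F
  set N := {a | a ∈ P'.startSet F' ∧ P'.curve a ∈ ψ '' square}
  have hnot : ∀ a ∈ P.startSet F, P.curve a ∉ ψ '' square := by
    rintro a ⟨ha, -⟩ ⟨z, hz, hza⟩
    rcases b.fst.cover a z hz hza.symm with h | h
    · exact (hg z.1 hz.1).ne'
        ((b.fst.flat_mem_doubleParams_iff hz.1).1 (mem_doubleParams_of_sameParam h.2.symm ha))
    · exact (hg z.1 hz.1).ne'
        ((b.fst.graph_mem_doubleParams_iff hz.1).1 (mem_doubleParams_of_sameParam h.2.symm ha))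
  have hunion : P'.startSet F' = P.startSet F ∪ N := by
    ext a
    by_cases ha : P.curve a ∈ ψ '' square
    · constructor
      · exact fun h => Or.inr ⟨h, (b.curve_mem_iff a).2 ha⟩
      · exact fun h => h.elim (fun h => absurd ha (hnot a h)) And.left
    · rw [b.mem_startSet_image_iff hFo ha]
      constructor
      · exact Or.inl
      · exact fun h => h.resolve_right fun h1 => ha ((b.curve_mem_iff a).1 h1.2)
  have hdisj : Disjoint ((fun a : ℝ => (a : AddCircle (2 * Real.pi))) '' P.startSet F)
      ((fun a : ℝ => (a : AddCircle (2 * Real.pi))) '' N) := by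
    rw [Set.disjoint_left]
    rintro _ ⟨a, ha, rfl⟩ ⟨c, hc, hca⟩
    have h1 := P'.curve_eq_of_sameParam (sameParam_iff_coe_eq.2 hca)
    exact hnot a ha ((b.curve_mem_iff a).1 (h1 ▸ hc.2))
  rw [hunion, Set.image_union]
  by_cases hfin0 : ((fun a : ℝ => (a : AddCircle (2 * Real.pi))) '' P.startSet F).Finite
  · rw [Set.ncard_union_eq hdisj hfin0 hfin, Nat.odd_add]
    exact iff_true_right heven
  · rw [Set.Infinite.ncard hfin0,
      Set.Infinite.ncard (Set.Infinite.mono Set.subset_union_left hfin0)]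

lemma one_le_abs_sub_two_pi_mul_int {c : ℝ} (hc : |c| = 1) (n : ℤ) :
    1 ≤ |c - 2 * Real.pi * n| := by
  rcases eq_or_ne n 0 with rfl | hn
  · simp [hc]
  have h1 : (1 : ℝ) ≤ |(n : ℝ)| := by exact_mod_cast Int.one_le_abs hn
  have h2 := abs_sub_abs_le_abs_sub (2 * Real.pi * n) c
  rw [abs_mul, abs_of_pos Real.two_pi_pos, hc, abs_sub_comm] at h2
  nlinarith [Real.pi_gt_three]

lemma HasPicture.bandPicture {P : KnotProjection} {ψ : ℝ × ℝ → E3} {τ : Fin 2 → ℝ} {g : ℝ → ℝ}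
    (hψ : IsPlanarChart ψ) (h : P.HasPicture ψ τ ![1, 1] ![fun _ => 0, g])
    (hg : ∀ x ∈ Set.Icc (-1 : ℝ) 1, |g x| < 1) (hl : 0 < g (-1)) (hr : 0 < g 1) :
    P.BandPicture ψ (τ 0) (τ 1) g where
  chart := hψ
  flat x hx := h.1 0 x hx
  graph x hx := h.1 1 x hx
  lt_one := hg
  cover t z hz ht := by
    obtain ⟨i, h1, h2⟩ := h.exists_strand hψ (fun i => by fin_cases i <;> simp) hz ht
    fin_cases i
    · exact Or.inl ⟨h1, h2⟩
    · exact Or.inr ⟨h1, h2⟩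
  left_pos := hl
  right_pos := hr

/-- If the curve is outside the disk at the time `t`, then `t` belongs to the time interval of
neither strand. -/
lemma BandPicture.one_le_abs_of_notMem {P : KnotProjection} {ψ : ℝ × ℝ → E3} {τ : Fin 2 → ℝ}
    {g : ℝ → ℝ} (b : P.BandPicture ψ (τ 0) (τ 1) g) {t : ℝ} (ht : P.curve t ∉ ψ '' square)
    (i : Fin 2) (n : ℤ) : 1 ≤ |t - τ i - 2 * Real.pi * n| := by
  by_contra! h
  set x := t - τ i - 2 * Real.pi * n with hx
  have hxC : x ∈ Set.Icc (-1 : ℝ) 1 := abs_le.1 h.le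
  have h1 : P.curve (τ i + 1 * x) = P.curve t := P.curve_eq_of_sameParam ⟨n, by rw [hx]; ring⟩
  refine ht (h1 ▸ ?_)
  fin_cases i
  · exact b.flat x hxC ▸ ⟨_, (b.mem_square hxC).1, rfl⟩
  · exact b.graph x hxC ▸ ⟨_, (b.mem_square hxC).2, rfl⟩

lemma bandSwap_of_weakRII {P P' : KnotProjection} {h k : ℝ → ℝ}
    (hh : ∀ x ∈ Set.Icc (-1 : ℝ) 1, 0 < h x ∧ h x < 1)
    (hk : ∀ x ∈ Set.Icc (-1 : ℝ) 1, |k x| < 1) (hkl : 0 < k (-1)) (hkr : 0 < k 1)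
    (hPP : LocalReplacement P P' ![1, 1] ![fun _ => 0, h] ![fun _ => 0, k]) :
    ∃ ψ τ₀ τ₁, BandSwap P P' ψ τ₀ τ₁ h k := by
  obtain ⟨ψ, τ, hψ, h1, h2, hout⟩ := hPP
  have hl : (-1 : ℝ) ∈ Set.Icc (-1 : ℝ) 1 := by norm_num
  have hr : (1 : ℝ) ∈ Set.Icc (-1 : ℝ) 1 := by norm_num
  have b := h1.bandPicture hψ
    (fun x hx => abs_lt.2 ⟨by linarith [(hh x hx).1], (hh x hx).2⟩) (hh _ hl).1 (hh _ hr).1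
  have b' := h2.bandPicture hψ hk hkl hkr
  -- at its ends, the second strand is outside the time intervals of both strands
  have hend : ∀ c ∈ Set.Icc (-1 : ℝ) 1, |c| = 1 → h c = k c := by
    intro c hcI hc
    have h3 : P'.curve (τ 1 + 1 * c) = P.curve (τ 1 + 1 * c) := by
      refine hout _ fun i n => ?_
      fin_cases i
      · by_contra! h3
        set x := τ 1 + 1 * c - τ 0 - 2 * Real.pi * n with hx
        have hxC : x ∈ Set.Icc (-1 : ℝ) 1 := abs_le.1 (le_of_lt h3)
        have h4 : P.curve (τ 0 + 1 * x) = P.curve (τ 1 + 1 * c) :=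
          P.curve_eq_of_sameParam ⟨n, by rw [hx]; ring⟩
        rw [b.flat x hxC, b.graph c hcI] at h4
        exact (hh c hcI).1.ne (congrArg Prod.snd (hψ.injective h4))
      · convert one_le_abs_sub_two_pi_mul_int hc n using 2
        simp
    rw [b'.graph c hcI, b.graph c hcI] at h3
    exact (congrArg Prod.snd (hψ.injective h3)).symm
  exact ⟨ψ, τ 0, τ 1, b, b', hend 1 hr (by norm_num), hend (-1) hl (by norm_num),
    fun t ht => hout t (b.one_le_abs_of_notMem ht),
    fun t ht => (hout t (b'.one_le_abs_of_notMem ht)).symm⟩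

theorem cohOdd_eq_of_weakRII {P P' : KnotProjection} (h : P.WeakRII P') :
    P.cohOdd = P'.cohOdd := by
  obtain ⟨h, k, p, q, hp, hpq, hq, hh, hk, hkp, hkq, hneg, hpos₀, hpos₁, hPP⟩ := h
  obtain ⟨ψ, τ₀, τ₁, b⟩ := bandSwap_of_weakRII hh hk (hpos₀ _ ⟨le_rfl, hp⟩)
    (hpos₁ _ ⟨hq, le_rfl⟩) hPP
  refine cohOdd_eq_cohOdd ⟨?_, ?_⟩
  · rintro ⟨F, hF, hc, ho⟩
    have hFb := b.fst.disjoint_band_of_isCoherent hF hc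
    exact ⟨_, b.isFace_image hF hFb, b.isCoherent_image hF hFb hc,
      (b.odd_ncard_sides_iff hF hFb (fun x hx => (hh x hx).1) hp hpq hq hkp hkq hneg hpos₀
        hpos₁).2 ho⟩
  · rintro ⟨F, hF, hc, ho⟩
    have hFb := b.snd.disjoint_band_of_isCoherent hF hc
    have hFo := BandSwap.subset_outside hF hFb
    have hF' := b.symm.isFace_image hF hFb
    have hFb' := b.symm.disjoint_image hFo
    refine ⟨_, hF', b.symm.isCoherent_image hF hFb hc,
      (b.odd_ncard_sides_iff hF' hFb' (fun x hx => (hh x hx).1) hp hpq hq hkp hkq hneg hpos₀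
        hpos₁).1 ?_⟩
    rwa [b.symm.image_swapMap_image hFo]

end KnotProjection

theorem mainTheorem2 (P P' : KnotProjection)
    (h : KnotProjection.WeakIIStrongIIIEquiv P P') :
    P.cohOdd = P'.cohOdd := by
  induction h with
  | rel P P' h =>
    rcases h with h | h | h | h
    · exact KnotProjection.cohOdd_eq_of_reparam h
    · exact KnotProjection.cohOdd_eq_of_sphereIsotopic h
    · exact KnotProjection.cohOdd_eq_of_weakRII h
    · exact KnotProjection.cohOdd_eq_of_strongRIII h
  | refl => rfl
  | symm _ _ _ ih => exact ih.symm
  | trans _ _ _ _ _ ih₁ ih₂ => exact ih₁.trans ih₂
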